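/- Let $n\ge 2$ and let $\mathbb{C}H^n$ be the complex hyperbolic space of constant holomorphic sectional curvature $-1$, on which $G=SU(1,n)$ acts by isometries. Let $o\in\mathbb{C}H^n$, let $\mathfrak{g}=\mathfrak{su}(1,n)=\mathfrak{k}\oplus\mathfrak{p}$ be the Cartan decomposition with respect to $o$, let $\mathfrak{a}\subset\mathfrak{p}$ be a maximal abelian subspace, and let $\mathfrak{g}=\mathfrak{g}_{-2\alpha}\oplus\mathfrak{g}_{-\alpha}\oplus\mathfrak{g}_{0}\oplus\mathfrak{g}_{\alpha}\oplus\mathfrak{g}_{2\alpha}$ be the root space decomposition with respect to $\mathfrak{a}$. The map $X\mapsto \frac{d}{dt}\big|_{t=0}\exp(tX)\cdot o$ identifies $\mathfrak{a}\oplus\mathfrak{g}_\alpha\oplus\mathfrak{g}_{2\alpha}$ with $T_o\mathbb{C}H^n$ and so gives $\mathfrak{g}_\alpha$ an inner product and a complex structure $J$. For a proper subspace $\mathfrak{w}\subsetneq\mathfrak{g}_\alpha$, let $W_{\mathfrak{w}}$ be the orbit through $o$ of the connected subgroup of $G$ with Lie algebra $\mathfrak{a}\oplus\mathfrak{w}\oplus\mathfrak{g}_{2\alpha}$,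 let $\mathfrak{w}^\perp=\mathfrak{g}_\alpha\ominus\mathfrak{w}$ and $k=\dim_{\mathbb{R}}\mathfrak{w}^\perp$. For $r>0$ let $M^r$ be the tube of radius $r$ around $W_{\mathfrak{w}}$, that is, the set of all points $\gamma_\xi(r)$, where $\gamma_\xi$ is the geodesic with initial velocity $\xi$ and $\xi$ runs through the unit normal vectors of $W_{\mathfrak{w}}$. The Kähler angle of $0\neq\xi\in\mathfrak{w}^\perp$ is the angle $\varphi_\xi\in[0,\pi/2]$ between $J\xi$ and $\mathfrak{w}^\perp$, and $\mathfrak{w}^\perp$ has constant Kähler angle if $\varphi_\xi$ does not depend on $\xi$. Then, for every proper subspace $\mathfrak{w}$ of $\mathfrak{g}_\alpha$ and every $r>0$: 1. $M^r$ is an isoparametric hypersurface of $\mathbb{C}H^n$: it is a smooth embedded hypersurface, and a regular level set of an isoparametric function on $\mathbb{C}H^n$, that is, of a nonconstant smooth function $f$ such that $|\nabla f|^2=a(f)$ and $\Delta f=b(f)$ for some smooth $a$ and continuous $b$. 2. $M^r$ has constant mean curvature: the trace of its shape operator at $\gamma_\xi(r)$ with respect to the unit normal vector $-\dot\gamma_\xi(r)$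 is $$\frac{k-1+2n\sinh^2(r/2)}{2\sinh(r/2)\cosh(r/2)}$$ for every unit normal vector $\xi$ of $W_{\mathfrak{w}}$. 3. $M^r$ is homogeneous if and only if $\mathfrak{w}^\perp$ has constant Kähler angle. This holds both when homogeneous means that the isometries of $\mathbb{C}H^n$ preserving $M^r$ act transitively on $M^r$, and when only the isometries given by elements of $SU(1,n)$ are allowed. Moreover, if $n\ge 3$, there is a proper subspace $\mathfrak{w}$ of $\mathfrak{g}_\alpha$ such that for every $r>0$ the tube $M^r$ around $W_{\mathfrak{w}}$ is an isoparametric hypersurface that is not homogeneous (under all isometries of $\mathbb{C}H^n$). -/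

import Mathlib

open scoped ContDiff Topology

namespace ComplexHyperbolic

noncomputable section

/-! ## Riemannian geometry of a metric given in one global chart

`E` is a finite-dimensional real vector space, and `g z` is the inner product on the tangent space
`E` at the point `z` (only the points of an open set matter). -/

section Riemannian

variable {E : Type*} [NormedAddCommGroup E] [NormedSpace ℝ E]

/-- The Christoffel operator `X ↦ Γ_z(X, v)` of the Levi-Civita connection of `g`, given by
`g(Γ(X, v), w) = (D_X g(v, w) + D_v g(X, w) - D_w g(v, X)) / 2`. The inverse of
`g z : E → E*` raises the index. -/
def christoffel (g : E → E →L[ℝ] E →L[ℝ] ℝ) (z v : E) : E →L[ℝ] E :=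
  (g z).inverse ∘L ((1 / 2 : ℝ) • ((fderiv ℝ g z).flip v + fderiv ℝ g z v
    - ((fderiv ℝ g z).flip v).flip))

/-- The covariant derivative `X ↦ ∇_X V` at `z` of a vector field `V`. -/
def nabla (g : E → E →L[ℝ] E →L[ℝ] ℝ) (V : E → E) (z : E) : E →L[ℝ] E :=
  fderiv ℝ V z + christoffel g z (V z)

/-- The gradient of a function. -/
def gradient (g : E → E →L[ℝ] E →L[ℝ] ℝ) (f : E → ℝ) (z : E) : E :=
  (g z).inverse (fderiv ℝ f z)

/-- The Laplace-Beltrami operator `Δ f = div (grad f)`. -/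
def laplacian (g : E → E →L[ℝ] E →L[ℝ] ℝ) (f : E → ℝ) (z : E) : ℝ :=
  LinearMap.trace ℝ E (nabla g (gradient g f) z : E →ₗ[ℝ] E)

/-- A complete geodesic in the open set `U`: a smooth curve with `∇_γ' γ' = 0`. -/
structure IsGeodesic (g : E → E →L[ℝ] E →L[ℝ] ℝ) (U : Set E) (γ : ℝ → E) : Prop where
  mem : ∀ t, γ t ∈ U
  smooth : ContDiff ℝ ∞ γ
  eqn : ∀ t, deriv (deriv γ) t + christoffel g (γ t) (deriv γ t) (deriv γ t) = 0

/-- The tangent space at `p` of a submanifold `M`: the velocities at `p` of the smooth curves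
in `M`. (For a submanifold these already form a subspace.) -/
def tangentSubspace (M : Set E) (p : E) : Submodule ℝ E :=
  Submodule.span ℝ {v | ∃ c : ℝ → E, ContDiffAt ℝ ∞ c 0 ∧ (∀ᶠ t in 𝓝 (0 : ℝ), c t ∈ M) ∧
    c 0 = p ∧ deriv c 0 = v}

/-- `ξ` is a unit normal vector of `M` at `p`. -/
def IsUnitNormal (g : E → E →L[ℝ] E →L[ℝ] ℝ) (M : Set E) (p ξ : E) : Prop :=
  g p ξ ξ = 1 ∧ ∀ v ∈ tangentSubspace M p, g p ξ v = 0

/-- The tube of radius `r` around `W`: the points reached after time `r` by the unit speed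
geodesics that start at a point of `W` perpendicularly to `W`. -/
def tube (g : E → E →L[ℝ] E →L[ℝ] ℝ) (U W : Set E) (r : ℝ) : Set E :=
  {x | ∃ γ : ℝ → E, IsGeodesic g U γ ∧ γ 0 ∈ W ∧ IsUnitNormal g W (γ 0) (deriv γ 0) ∧ γ r = x}

/-- `M` is a nonempty embedded smooth real hypersurface of the open set `U`. -/
def IsHypersurface (U M : Set E) : Prop :=
  M.Nonempty ∧ M ⊆ U ∧ ∀ p ∈ M, ∃ h : E → ℝ, ContDiffAt ℝ ∞ h p ∧ fderiv ℝ h p ≠ 0 ∧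
    ∀ᶠ q in 𝓝 p, (q ∈ M ↔ h q = 0)

/-- The hypersurface `M` has at `p`, with respect to the unit normal vector `ν`, the mean
curvature `H`: the trace of the shape operator `S X = -∇_X N`, where `N` is a local unit normal
field with `N p = ν`. -/
def HasMeanCurvatureAt (g : E → E →L[ℝ] E →L[ℝ] ℝ) (M : Set E) (p ν : E) (H : ℝ) : Prop :=
  ∃ N : E → E, ContDiffAt ℝ ∞ N p ∧ N p = ν ∧ (∀ᶠ q in 𝓝[M] p, IsUnitNormal g M q (N q)) ∧
    ∃ S : tangentSubspace M p →ₗ[ℝ] tangentSubspace M p,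
      (∀ X : tangentSubspace M p, (S X : E) = -nabla g N p X) ∧
      LinearMap.trace ℝ (tangentSubspace M p) S = H

/-- An isoparametric function on `U`: a smooth nonconstant function `f` such that both
`|grad f|²` (smoothly) and `Δ f` (continuously) are functions of `f`. -/
def IsIsoparametricFunction (g : E → E →L[ℝ] E →L[ℝ] ℝ) (U : Set E) (f : E → ℝ) : Prop :=
  ContDiffOn ℝ ∞ f U ∧ (∃ x ∈ U, ∃ y ∈ U, f x ≠ f y) ∧
    ∃ a b : ℝ → ℝ, ContDiff ℝ ∞ a ∧ Continuous b ∧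
      ∀ z ∈ U, g z (gradient g f z) (gradient g f z) = a (f z) ∧ laplacian g f z = b (f z)

/-- An isoparametric hypersurface of `U`: a hypersurface that is a (regular) level set of an
isoparametric function. -/
def IsIsoparametricHypersurface (g : E → E →L[ℝ] E →L[ℝ] ℝ) (U M : Set E) : Prop :=
  IsHypersurface U M ∧ ∃ f : E → ℝ, IsIsoparametricFunction g U f ∧
    ∃ c : ℝ, M = {z | z ∈ U ∧ f z = c} ∧ ∀ z ∈ M, fderiv ℝ f z ≠ 0

/-- The isometries of the Riemannian manifold `(U, g)`. (The inverse of such a map is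
automatically smooth.) -/
def isometries (g : E → E →L[ℝ] E →L[ℝ] ℝ) (U : Set E) : Set (E → E) :=
  {f | Set.BijOn f U U ∧ ContDiffOn ℝ ∞ f U ∧
    ∀ z ∈ U, ∀ u v, g (f z) (fderiv ℝ f z u) (fderiv ℝ f z v) = g z u v}

/-- `M` is homogeneous under the transformations `Φ`: those that preserve `M` act transitively
on `M`. -/
def IsHomogeneous (Φ : Set (E → E)) (M : Set E) : Prop :=
  ∀ p ∈ M, ∀ q ∈ M, ∃ f ∈ Φ, f '' M = M ∧ f p = q

end Riemannian

/-! ## The complex hyperbolic space: the unit ball with the Bergman metric -/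

/-- The open unit ball in `ℂⁿ`. -/
def CH (n : ℕ) : Set (EuclideanSpace ℂ (Fin n)) := Metric.ball 0 1

/-- The Bergman metric on the unit ball, with constant holomorphic sectional curvature `-1`. -/
def metric (n : ℕ) (z : EuclideanSpace ℂ (Fin n)) :
    EuclideanSpace ℂ (Fin n) →L[ℝ] EuclideanSpace ℂ (Fin n) →L[ℝ] ℝ :=
  LinearMap.toContinuousBilinearMap <| LinearMap.mk₂ ℝ
    (fun u v => 4 * ((inner ℂ u v).re / (1 - ‖z‖ ^ 2)
      + (inner ℂ u z * inner ℂ z v).re / (1 - ‖z‖ ^ 2) ^ 2))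
    (by intro u u' v; simp only [inner_add_left, add_mul, Complex.add_re]; ring)
    (by
      intro c u v
      have h : c • u = (c : ℂ) • u := (Complex.coe_smul c u).symm
      rw [h]
      simp only [inner_smul_left, Complex.conj_ofReal, mul_assoc, Complex.re_ofReal_mul,
        smul_eq_mul]
      ring)
    (by intro u v v'; simp only [inner_add_right, mul_add, Complex.add_re]; ring)
    (by
      intro c u v
      have h : c • v = (c : ℂ) • v := (Complex.coe_smul c v).symm
      rw [h]
      simp only [inner_smul_right, mul_left_comm _ (c : ℂ), Complex.re_ofReal_mul, smul_eq_mul]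
      ring)

attribute [local instance 100] LieRing.ofAssociativeRing

/-- The complex `(n+1) × (n+1)` matrices. -/
abbrev Mat (n : ℕ) : Type := Matrix (Fin (n + 1)) (Fin (n + 1)) ℂ

/-- The matrix `diag(-1, 1, …, 1)` of the Hermitian form of signature `(1, n)`. -/
def form (n : ℕ) : Mat n := Matrix.diagonal (Fin.cons (-1) fun _ => 1)

/-- The vector `(1, z)` of `ℂ^{1,n}`, which spans the negative line of the point `z`. -/
def lift {n : ℕ} (z : EuclideanSpace ℂ (Fin n)) : Fin (n + 1) → ℂ := Fin.cons 1 fun i => z i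

/-- The action of matrices on the ball by fractional linear transformations, which is their
action on negative lines. -/
def act {n : ℕ} (A : Mat n) (z : EuclideanSpace ℂ (Fin n)) : EuclideanSpace ℂ (Fin n) :=
  WithLp.toLp 2 fun i => A.mulVec (lift z) i.succ / A.mulVec (lift z) 0

/-- The group `SU(1,n)`. -/
def SU (n : ℕ) : Subgroup (Mat n)ˣ where
  carrier := {A | (A : Mat n).conjTranspose * form n * (A : Mat n) = form n ∧
    (A : Mat n).det = 1}
  one_mem' := by simp
  mul_mem' := by
    rintro A B ⟨hA, hA'⟩ ⟨hB, hB'⟩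
    refine ⟨?_, by simp [hA', hB']⟩
    calc _ = (B : Mat n).conjTranspose * ((A : Mat n).conjTranspose * form n * (A : Mat n))
          * (B : Mat n) := by
            simp only [Units.val_mul, Matrix.conjTranspose_mul, mul_assoc]
      _ = _ := by rw [hA, hB]
  inv_mem' := by
    rintro A ⟨hA, hA'⟩
    have h1 : (A : Mat n) * ((A⁻¹ : (Mat n)ˣ) : Mat n) = 1 := A.mul_inv
    refine ⟨?_, ?_⟩
    · have h2 : ((A⁻¹ : (Mat n)ˣ) : Mat n).conjTranspose * (A : Mat n).conjTranspose = 1 := by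
        rw [← Matrix.conjTranspose_mul, h1, Matrix.conjTranspose_one]
      calc _ = ((A⁻¹ : (Mat n)ˣ) : Mat n).conjTranspose
            * ((A : Mat n).conjTranspose * form n * (A : Mat n))
            * ((A⁻¹ : (Mat n)ˣ) : Mat n) := by rw [hA]
        _ = (((A⁻¹ : (Mat n)ˣ) : Mat n).conjTranspose * (A : Mat n).conjTranspose) * form n
            * ((A : Mat n) * ((A⁻¹ : (Mat n)ˣ) : Mat n)) := by simp only [mul_assoc]
        _ = _ := by rw [h1, h2, one_mul, mul_one]
    · have h3 := congrArg Matrix.det h1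
      rw [Matrix.det_mul, hA', one_mul, Matrix.det_one] at h3
      exact h3

/-- The Lie algebra `𝔤 = 𝔰𝔲(1,n)`. -/
def su (n : ℕ) : LieSubalgebra ℝ (Mat n) where
  carrier := {X | X.conjTranspose * form n + form n * X = 0 ∧ X.trace = 0}
  add_mem' := by
    rintro X Y ⟨hX, hX'⟩ ⟨hY, hY'⟩
    refine ⟨?_, by rw [Matrix.trace_add, hX', hY', add_zero]⟩
    rw [Matrix.conjTranspose_add, add_mul, mul_add, add_add_add_comm, hX, hY, add_zero]
  zero_mem' := by simp
  smul_mem' := by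
    rintro c X ⟨hX, hX'⟩
    refine ⟨?_, by rw [Matrix.trace_smul, hX', smul_zero]⟩
    rw [Matrix.conjTranspose_smul, star_trivial, smul_mul_assoc, mul_smul_comm, ← smul_add, hX,
      smul_zero]
  lie_mem' := by
    rintro X Y ⟨hX, -⟩ ⟨hY, -⟩
    refine ⟨?_, ?_⟩
    · have hX1 := eq_neg_of_add_eq_zero_left hX
      have hY1 := eq_neg_of_add_eq_zero_left hY
      rw [Ring.lie_def, Matrix.conjTranspose_sub, Matrix.conjTranspose_mul,
        Matrix.conjTranspose_mul, sub_mul, mul_assoc, mul_assoc, hX1, hY1, mul_neg, mul_neg,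
        ← mul_assoc, ← mul_assoc, hX1, hY1]
      noncomm_ring
    · rw [Ring.lie_def, Matrix.trace_sub, Matrix.trace_mul_comm, sub_self]

/-- `𝔨`, the Lie algebra of the isotropy group of `SU(1,n)` at the point `o`. -/
def isotropyAlgebra {n : ℕ} (o : EuclideanSpace ℂ (Fin n)) : Set (Mat n) :=
  {X | X ∈ su n ∧ ∀ t : ℝ, act (NormedSpace.exp (t • X)) o = o}

/-- `𝔭`, the other summand of the Cartan decomposition `𝔤 = 𝔨 ⊕ 𝔭` with respect to `o`: the
orthogonal complement of `𝔨` for the Killing form, which is `2(n+1) Re tr(XY)` on `𝔰𝔲(1,n)`. -/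
def cartanComplement {n : ℕ} (o : EuclideanSpace ℂ (Fin n)) : Submodule ℝ (Mat n) where
  carrier := {X | X ∈ su n ∧ ∀ Y ∈ isotropyAlgebra o, 2 * (n + 1) * (X * Y).trace.re = 0}
  add_mem' := by
    rintro X Y ⟨hX, hX'⟩ ⟨hY, hY'⟩
    refine ⟨add_mem hX hY, fun Z hZ => ?_⟩
    rw [add_mul, Matrix.trace_add, Complex.add_re, mul_add, hX' Z hZ, hY' Z hZ, add_zero]
  zero_mem' := ⟨zero_mem _, fun Z _ => by simp⟩
  smul_mem' := by
    rintro c X ⟨hX, hX'⟩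
    refine ⟨(su n).smul_mem c hX, fun Z hZ => ?_⟩
    rw [smul_mul_assoc, Matrix.trace_smul, Complex.smul_re, smul_eq_mul, mul_left_comm, hX' Z hZ,
      mul_zero]

/-- `𝔞` is a maximal abelian subspace of `𝔭`. -/
def IsMaximalAbelian {n : ℕ} (𝔭 𝔞 : Submodule ℝ (Mat n)) : Prop :=
  Maximal (fun 𝔟 : Submodule ℝ (Mat n) => 𝔟 ≤ 𝔭 ∧ ∀ X ∈ 𝔟, ∀ Y ∈ 𝔟, ⁅X, Y⁆ = 0) 𝔞

/-- The (restricted) root space `𝔤_β` with respect to `𝔞`. -/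
def rootSpace {n : ℕ} (𝔞 : Submodule ℝ (Mat n)) (β : Module.Dual ℝ 𝔞) :
    Submodule ℝ (Mat n) where
  carrier := {X | X ∈ su n ∧ ∀ H : 𝔞, ⁅(H : Mat n), X⁆ = β H • X}
  add_mem' := by
    rintro X Y ⟨hX, hX'⟩ ⟨hY, hY'⟩
    exact ⟨add_mem hX hY, fun H => by rw [lie_add, hX', hY', smul_add]⟩
  zero_mem' := ⟨zero_mem _, fun H => by simp⟩
  smul_mem' := by
    rintro c X ⟨hX, hX'⟩
    exact ⟨(su n).smul_mem c hX, fun H => by rw [lie_smul, hX', smul_comm]⟩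

/-- The connected subgroup with Lie algebra `𝔥` (for `𝔥` a Lie algebra): the subgroup generated
by `exp 𝔥`. -/
def connectedSubgroup {n : ℕ} (𝔥 : Submodule ℝ (Mat n)) : Subgroup (Mat n)ˣ :=
  Subgroup.closure {A | ∃ X ∈ 𝔥, (A : Mat n) = NormedSpace.exp X}

/-- The orbit `W_𝔴` through `o` of the connected subgroup `S_𝔴` with Lie algebra
`𝔰_𝔴 = 𝔞 ⊕ 𝔴 ⊕ 𝔤_{2α}`. -/
def orbitW {n : ℕ} (o : EuclideanSpace ℂ (Fin n)) (𝔞 : Submodule ℝ (Mat n))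
    (α : Module.Dual ℝ 𝔞) (𝔴 : Submodule ℝ (Mat n)) : Set (EuclideanSpace ℂ (Fin n)) :=
  {z | ∃ A ∈ connectedSubgroup (𝔞 ⊔ 𝔴 ⊔ rootSpace 𝔞 ((2 : ℝ) • α)), act (A : Mat n) o = z}

/-- The map `𝔤 → T_o ℂHⁿ` that sends `X` to the velocity at `t = 0` of `exp(tX) · o`; it restricts
to the identification of `𝔞 ⊕ 𝔫` with `T_o ℂHⁿ`. -/
def velocity {n : ℕ} (o : EuclideanSpace ℂ (Fin n)) : Mat n →ₗ[ℝ] EuclideanSpace ℂ (Fin n) where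
  toFun X := WithLp.toLp 2 fun i => X.mulVec (lift o) i.succ - X.mulVec (lift o) 0 * o i
  map_add' X Y := by
    ext i
    simp only [Matrix.add_mulVec, Pi.add_apply, PiLp.add_apply]
    ring
  map_smul' c X := by
    ext i
    simp only [Matrix.smul_mulVec, Pi.smul_apply, PiLp.smul_apply, RingHom.id_apply, smul_sub,
      smul_mul_assoc]

/-- `𝔴^⊥ = 𝔤_α ⊖ 𝔴`, for the inner product of `T_o ℂHⁿ ≅ 𝔞 ⊕ 𝔫`. -/
def wPerp {n : ℕ} (o : EuclideanSpace ℂ (Fin n)) (𝔞 : Submodule ℝ (Mat n))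
    (α : Module.Dual ℝ 𝔞) (𝔴 : Submodule ℝ (Mat n)) : Submodule ℝ (Mat n) where
  carrier := {X | X ∈ rootSpace 𝔞 α ∧ ∀ Y ∈ 𝔴, metric n o (velocity o X) (velocity o Y) = 0}
  add_mem' := by
    rintro X X' ⟨hX, h⟩ ⟨hX', h'⟩
    refine ⟨add_mem hX hX', fun Y hY => ?_⟩
    rw [map_add, map_add, _root_.add_apply, h Y hY, h' Y hY, add_zero]
  zero_mem' := ⟨zero_mem _, fun Y _ => by simp⟩
  smul_mem' := by
    rintro c X ⟨hX, h⟩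
    refine ⟨Submodule.smul_mem _ c hX, fun Y hY => ?_⟩
    rw [map_smul, map_smul, _root_.smul_apply, h Y hY, smul_zero]

/-- `φ ∈ [0, π/2]` is the Kähler angle of `ξ` with respect to the real subspace `V` of `T_o ℂHⁿ`
that contains `ξ`, that is, the angle between `Jξ` and `V`: the orthogonal projection `Fξ` of
`Jξ` onto `V` satisfies `⟨Fξ, Fξ⟩ = cos² φ ⟨ξ, ξ⟩`. -/
def IsKahlerAngle {n : ℕ} (o : EuclideanSpace ℂ (Fin n))
    (V : Submodule ℝ (EuclideanSpace ℂ (Fin n))) (ξ : EuclideanSpace ℂ (Fin n)) (φ : ℝ) : Prop :=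
  φ ∈ Set.Icc 0 (Real.pi / 2) ∧ ∃ F ∈ V, (∀ η ∈ V, metric n o (Complex.I • ξ - F) η = 0) ∧
    metric n o F F = Real.cos φ ^ 2 * metric n o ξ ξ

/-- The real subspace `V` of `T_o ℂHⁿ` has constant Kähler angle. -/
def HasConstantKahlerAngle {n : ℕ} (o : EuclideanSpace ℂ (Fin n))
    (V : Submodule ℝ (EuclideanSpace ℂ (Fin n))) : Prop :=
  ∃ φ : ℝ, ∀ ξ ∈ V, ξ ≠ 0 → IsKahlerAngle o V ξ φ

end

end ComplexHyperbolic

open ComplexHyperbolic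

/-!
# Isoparametric tubes in complex hyperbolic spaces

Points of the ball are negative lines of the Lorentz space `ℂ^{1,n}` with its Hermitian form `[x,
y]`, and tangent vectors are handled through the projections of `ℂ^{1,n}`. The starting point is
that the submanifold `W_𝔴` has a simple equation in this model. The flat `𝔞` is spanned by an
infinitesimal boost with null eigenvectors `ℓ`, `m` (`exists_isBase`); the root spaces are `𝔤_α =
{rot ℓ u | u ⟂ ℓ, m}` and `𝔤_{2α} = iℝ · outer ℓ ℓ` (`IsRootData.mem_rootSpace`,
`IsRootData.mem_rootSpace_two`), so `𝔤_α` is a copy of the positive definite space `{ℓ, m}^⊥`. If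
`ξ_1, …, ξ_k` is an orthonormal basis of the real subspace that corresponds to `𝔴^⊥`, then the
group with Lie algebra `𝔞 ⊕ 𝔴 ⊕ 𝔤_{2α}` rescales `ℓ` and moves each `ξ_j` by an imaginary multiple
of `ℓ`, and `W_𝔴` is the common zero set of the functions `G_j(Z) = Re([ξ_j, Z] conj [ℓ, Z]) /
-[Z, Z]` (`IsRootData.orbitW_eq`).

With `φ(Z) = |[ℓ, Z]|² / -[Z, Z]`, the exponential of a Busemann function, the invariant function
is `F = ∑ G_j² / φ` (`isoFun`). Gradients, their inner products and Laplacians of all functions of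
the type `Re([x, Z] conj [y, Z]) / -[Z, Z]` are explicit, and give `|∇F|² = F (1 + F)` and an
affine expression in `F` for `ΔF`, so `F` is isoparametric on the whole ball. Along a unit speed
geodesic normal to `W_𝔴`, which is an explicit hyperbolic combination of two vectors, `F = sinh²(t
/ 2)`; hence the tube of radius `r` is the level set `F = sinh²(r / 2)` (`IsConfig.tube_eq`), and
its mean curvature follows from `|∇F|²` and `ΔF`.

An isometry that preserves a tube maps its normal geodesics to normal geodesics
(`IsConfig.isometry_comp_normal_geodesic`). If the tube is homogeneous, then the unit normal
vectors of `W_𝔴` at `p` are moved to each other by isometries that fix `p` and preserve the normal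
space at `p`. The differential of such an isometry commutes or anticommutes with `J`
(`isometry_fderiv_I`), so the length of the projection of `Jξ` to the normal space does not depend
on `ξ` (`IsConfig.hasConstantKahlerAngle_of_isHomogeneous`). Conversely, if the Kähler angle is
constant, the skew endomorphism `ξ ↦ (Jξ)^⊥` of `𝔴^⊥` squares to a multiple of the identity, so
the orthogonal maps that commute with it act transitively on the unit sphere; by Witt's theorem
they extend to unitary transformations that fix `ℓ` and `m`, and together with the transitive
action on `W_𝔴` they act transitively on the tube
(`IsConfig.isHomogeneous_of_hasConstantKahlerAngle`). For `n ≥ 3` a real line `𝔴` in `𝔤_α` gives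
normal vectors of Kähler angle `π / 2` and `0`.
-/

namespace ComplexHyperbolic

/-! ### Riemannian metrics in one chart -/

section Riemannian

variable {E : Type*} [NormedAddCommGroup E] [NormedSpace ℝ E]

/-- `g` is a Riemannian metric on the open set `U`. -/
structure IsRiemannian (g : E → E →L[ℝ] E →L[ℝ] ℝ) (U : Set E) : Prop where
  isOpen : IsOpen U
  smooth : ContDiffOn ℝ ∞ g U
  symm : ∀ z ∈ U, ∀ u v, g z u v = g z v u
  pos : ∀ z ∈ U, ∀ v, v ≠ 0 → 0 < g z v v

variable {g : E → E →L[ℝ] E →L[ℝ] ℝ} {U : Set E}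

namespace IsRiemannian

theorem contDiffAt (hg : IsRiemannian g U) {z : E} (hz : z ∈ U) : ContDiffAt ℝ ∞ g z :=
  hg.smooth.contDiffAt (hg.isOpen.mem_nhds hz)

theorem differentiableAt (hg : IsRiemannian g U) {z : E} (hz : z ∈ U) :
    DifferentiableAt ℝ g z :=
  (hg.contDiffAt hz).differentiableAt (by simp)

theorem eq_of_forall (hg : IsRiemannian g U) {z : E} (hz : z ∈ U) {u v : E}
    (h : ∀ w, g z u w = g z v w) : u = v := by
  by_contra hne
  have := hg.pos z hz (u - v) (sub_ne_zero.2 hne)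
  rw [(g z).map_sub, sub_apply, h, sub_self] at this
  exact lt_irrefl _ this

theorem fderiv_symm (hg : IsRiemannian g U) {z : E} (hz : z ∈ U) (X u v : E) :
    fderiv ℝ g z X u v = fderiv ℝ g z X v u := by
  have hd := (hg.differentiableAt hz).hasFDerivAt
  have h1 : ∀ u v, HasFDerivAt (fun q => g q u v) (((fderiv ℝ g z).flip u).flip v) z := by
    intro u v
    have := (hd.clm_apply (hasFDerivAt_const u z)).clm_apply (hasFDerivAt_const v z)
    refine this.congr_fderiv ?_
    ext X
    simp
  have h2 : (fun q => g q u v) =ᶠ[𝓝 z] fun q => g q v u := by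
    filter_upwards [hg.isOpen.mem_nhds hz] with q hq using hg.symm q hq u v
  have := (h1 u v).unique ((h1 v u).congr_of_eventuallyEq h2)
  simpa using congrArg (fun L => L X) this

variable [FiniteDimensional ℝ E]

theorem isInvertible (hg : IsRiemannian g U) {z : E} (hz : z ∈ U) : (g z).IsInvertible := by
  have hinj : Function.Injective (g z : E →ₗ[ℝ] E →L[ℝ] ℝ) := by
    intro u v huv
    exact hg.eq_of_forall hz fun w => congrArg (fun L => L w) huv
  have hdim : Module.finrank ℝ E = Module.finrank ℝ (E →L[ℝ] ℝ) := by
    rw [← (LinearMap.toContinuousLinearMap : (E →ₗ[ℝ] ℝ) ≃ₗ[ℝ] E →L[ℝ] ℝ).finrank_eq]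
    exact (Subspace.dual_finrank_eq (K := ℝ) (V := E)).symm
  refine ⟨(LinearEquiv.ofInjectiveOfFinrankEq _ hinj hdim).toContinuousLinearEquiv, ?_⟩
  ext u
  rfl

theorem gradient_apply (hg : IsRiemannian g U) {z : E} (hz : z ∈ U) (f : E → ℝ) (v : E) :
    g z (gradient g f z) v = fderiv ℝ f z v := by
  rw [gradient, (hg.isInvertible hz).self_apply_inverse]

theorem gradient_eq (hg : IsRiemannian g U) {z : E} (hz : z ∈ U) {f : E → ℝ} {V : E}
    (h : ∀ v, g z V v = fderiv ℝ f z v) : gradient g f z = V :=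
  hg.eq_of_forall hz fun w => by rw [hg.gradient_apply hz, h]

theorem contDiffAt_gradient (hg : IsRiemannian g U) {z : E} (hz : z ∈ U) {f : E → ℝ}
    (hf : ContDiffAt ℝ ∞ f z) : ContDiffAt ℝ ∞ (gradient g f) z := by
  have h1 : ContDiffAt ℝ ∞ (fun q => (g q).inverse) z :=
    (hg.isInvertible hz).contDiffAt_map_inverse.comp z (hg.contDiffAt hz)
  exact h1.clm_apply (hf.fderiv_right (by simp))

/-- The Koszul formula for the Christoffel operator. -/
theorem christoffel_apply (hg : IsRiemannian g U) {z : E} (hz : z ∈ U) (v X w : E) :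
    g z (christoffel g z v X) w =
      (fderiv ℝ g z X v w + fderiv ℝ g z v X w - fderiv ℝ g z w v X) / 2 := by
  rw [christoffel, ContinuousLinearMap.comp_apply, (hg.isInvertible hz).self_apply_inverse]
  simp
  ring

theorem christoffel_eq (hg : IsRiemannian g U) {z : E} (hz : z ∈ U) {v X V : E}
    (h : ∀ w, g z V w =
      (fderiv ℝ g z X v w + fderiv ℝ g z v X w - fderiv ℝ g z w v X) / 2) :
    christoffel g z v X = V :=
  hg.eq_of_forall hz fun w => by rw [hg.christoffel_apply hz, h]

/-- Compatibility with the metric, for the Christoffel operators. -/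
theorem fderiv_eq_christoffel (hg : IsRiemannian g U) {z : E} (hz : z ∈ U) (X v w : E) :
    fderiv ℝ g z X v w = g z (christoffel g z v X) w + g z v (christoffel g z w X) := by
  rw [hg.symm z hz v, hg.christoffel_apply hz, hg.christoffel_apply hz,
    hg.fderiv_symm hz X w v, hg.fderiv_symm hz v X w, hg.fderiv_symm hz w X v]
  ring

/-- The Levi-Civita connection is compatible with the metric. -/
theorem fderiv_metric (hg : IsRiemannian g U) {z : E} (hz : z ∈ U) {V V' : E → E}
    (hV : DifferentiableAt ℝ V z) (hV' : DifferentiableAt ℝ V' z) (X : E) :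
    fderiv ℝ (fun q => g q (V q) (V' q)) z X =
      g z (nabla g V z X) (V' z) + g z (V z) (nabla g V' z X) := by
  have := (((hg.differentiableAt hz).hasFDerivAt.clm_apply hV.hasFDerivAt).clm_apply
    hV'.hasFDerivAt).fderiv
  rw [this]
  simp [nabla, hg.fderiv_eq_christoffel hz]
  ring

end IsRiemannian

theorem nabla_smul {c : E → ℝ} {V : E → E} {z : E} (hc : DifferentiableAt ℝ c z)
    (hV : DifferentiableAt ℝ V z) (hlin : ∀ (a : ℝ) (v : E),
      christoffel g z (a • v) = a • christoffel g z v) :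
    nabla g (fun q => c q • V q) z = c z • nabla g V z + (fderiv ℝ c z).smulRight (V z) := by
  rw [nabla, nabla, fderiv_fun_smul hc hV, hlin]
  ext X
  simp
  module

theorem christoffel_smul (g : E → E →L[ℝ] E →L[ℝ] ℝ) (z : E) (a : ℝ) (v : E) :
    christoffel g z (a • v) = a • christoffel g z v := by
  ext X
  simp only [christoffel, ContinuousLinearMap.comp_apply, map_smul, smul_apply, add_apply,
    sub_apply, ContinuousLinearMap.flip_apply, ← smul_add]
  simp only [← map_smul]
  congr 1
  ext w
  simp
  ring

theorem christoffel_add (g : E → E →L[ℝ] E →L[ℝ] ℝ) (z : E) (u v : E) :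
    christoffel g z (u + v) = christoffel g z u + christoffel g z v := by
  ext X
  simp only [christoffel, ContinuousLinearMap.comp_apply, add_apply, ← map_add]
  congr 1
  ext w
  simp
  ring

theorem trace_smulRight [FiniteDimensional ℝ E] (φ : E →L[ℝ] ℝ) (v : E) :
    LinearMap.trace ℝ E (φ.smulRight v : E →L[ℝ] E) = φ v := by
  have : ((φ.smulRight v : E →L[ℝ] E) : E →ₗ[ℝ] E) = (φ : E →ₗ[ℝ] ℝ).smulRight v := rfl
  rw [this]
  simp

/-- The divergence of `c V`. -/
theorem trace_nabla_smul [FiniteDimensional ℝ E] {c : E → ℝ} {V : E → E} {z : E}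
    (hc : DifferentiableAt ℝ c z) (hV : DifferentiableAt ℝ V z) :
    LinearMap.trace ℝ E (nabla g (fun q => c q • V q) z) =
      c z * LinearMap.trace ℝ E (nabla g V z) + fderiv ℝ c z (V z) := by
  rw [nabla_smul hc hV (christoffel_smul g z)]
  simp only [ContinuousLinearMap.toLinearMap_add, ContinuousLinearMap.toLinearMap_smul, map_add, map_smul,
    trace_smulRight, smul_eq_mul]

/-! ### Isometries -/

theorem isometries_comp (hU : IsOpen U) {F G : E → E} (hF : F ∈ isometries g U)
    (hG : G ∈ isometries g U) : F ∘ G ∈ isometries g U := by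
  refine ⟨hF.1.comp hG.1, hF.2.1.comp hG.2.1 hG.1.mapsTo, fun z hz u v => ?_⟩
  have h1 : DifferentiableAt ℝ G z :=
    (hG.2.1.contDiffAt (hU.mem_nhds hz)).differentiableAt (by simp)
  have h2 : DifferentiableAt ℝ F (G z) :=
    (hF.2.1.contDiffAt (hU.mem_nhds (hG.1.mapsTo hz))).differentiableAt (by simp)
  rw [fderiv_comp z h2 h1]
  simp only [ContinuousLinearMap.comp_apply, Function.comp_apply]
  rw [hF.2.2 _ (hG.1.mapsTo hz), hG.2.2 z hz]

namespace IsRiemannian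

theorem isometry_injective (hg : IsRiemannian g U) {F : E → E} (hF : F ∈ isometries g U) {z : E}
    (hz : z ∈ U) : Function.Injective (fderiv ℝ F z) := by
  intro u v huv
  refine hg.eq_of_forall hz fun w => ?_
  rw [← hF.2.2 z hz, ← hF.2.2 z hz, huv]

variable [FiniteDimensional ℝ E]

theorem isometry_surjective (hg : IsRiemannian g U) {F : E → E} (hF : F ∈ isometries g U) {z : E}
    (hz : z ∈ U) : Function.Surjective (fderiv ℝ F z) :=
  (LinearMap.injective_iff_surjective (f := (fderiv ℝ F z : E →ₗ[ℝ] E))).1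
    (hg.isometry_injective hF hz)

/-- Naturality of the Levi-Civita connection under isometries. -/
theorem christoffel_isometry (hg : IsRiemannian g U) {F : E → E} (hF : F ∈ isometries g U) {z : E}
    (hz : z ∈ U) (v X : E) :
    fderiv ℝ F z (christoffel g z v X) =
      christoffel g (F z) (fderiv ℝ F z v) (fderiv ℝ F z X) + fderiv ℝ (fderiv ℝ F) z X v := by
  have hFz : F z ∈ U := hF.1.mapsTo hz
  have hFc : ContDiffAt ℝ ∞ F z := hF.2.1.contDiffAt (hg.isOpen.mem_nhds hz)
  have hF1 : DifferentiableAt ℝ F z := hFc.differentiableAt (by simp)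
  have hF2 : DifferentiableAt ℝ (fderiv ℝ F) z :=
    (hFc.fderiv_right (m := ∞) (by simp)).differentiableAt (by simp)
  have hsymm : ∀ u w, fderiv ℝ (fderiv ℝ F) z u w = fderiv ℝ (fderiv ℝ F) z w u := by
    have h2 : (2 : WithTop ℕ∞) ≤ ∞ := ENat.LEInfty.out
    have := hFc.isSymmSndFDerivAt (by simpa using h2)
    exact fun u w => this u w
  -- the derivative of the identity `g (F z) (dF u) (dF v) = g z u v`
  have key : ∀ Y u w, fderiv ℝ g (F z) (fderiv ℝ F z Y) (fderiv ℝ F z u) (fderiv ℝ F z w)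
      + g (F z) (fderiv ℝ (fderiv ℝ F) z Y u) (fderiv ℝ F z w)
      + g (F z) (fderiv ℝ F z u) (fderiv ℝ (fderiv ℝ F) z Y w) = fderiv ℝ g z Y u w := by
    intro Y u w
    have h0 : HasFDerivAt (fun q => g (F q)) (fderiv ℝ g (F z) ∘L fderiv ℝ F z) z :=
      HasFDerivAt.comp (g := g) z (hg.differentiableAt hFz).hasFDerivAt hF1.hasFDerivAt
    have hD : ∀ u, HasFDerivAt (fun q => fderiv ℝ F q u) ((fderiv ℝ (fderiv ℝ F) z).flip u) z := by
      intro u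
      refine (hF2.hasFDerivAt.clm_apply (hasFDerivAt_const u z)).congr_fderiv ?_
      ext X
      simp
    have h1 := (h0.clm_apply (hD u)).clm_apply (hD w)
    have h2 := (((hg.differentiableAt hz).hasFDerivAt.clm_apply
      (hasFDerivAt_const u z)).clm_apply (hasFDerivAt_const w z))
    have h3 : (fun q => g (F q) (fderiv ℝ F q u) (fderiv ℝ F q w)) =ᶠ[𝓝 z]
        fun q => g q u w := by
      filter_upwards [hg.isOpen.mem_nhds hz] with q hq using hF.2.2 q hq u w
    have := congrArg (fun L => L Y) (h1.unique (h2.congr_of_eventuallyEq h3))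
    simp at this
    linarith
  refine hg.eq_of_forall hFz fun w' => ?_
  obtain ⟨w, rfl⟩ := hg.isometry_surjective hF hz w'
  rw [hF.2.2 z hz, hg.christoffel_apply hz, (g (F z)).map_add, add_apply,
    hg.christoffel_apply hFz, ← key, ← key, ← key, hsymm v X, hsymm w v, hsymm w X,
    hg.symm _ hFz _ (fderiv ℝ F z X), hg.symm _ hFz (fderiv ℝ F z v)]
  ring

/-- Isometries map geodesics to geodesics. -/
theorem isGeodesic_comp (hg : IsRiemannian g U) {F : E → E} (hF : F ∈ isometries g U)
    {γ : ℝ → E} (hγ : IsGeodesic g U γ) : IsGeodesic g U (F ∘ γ) := by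
  have hF1 : ∀ z ∈ U, ContDiffAt ℝ ∞ F z := fun z hz =>
    hF.2.1.contDiffAt (hg.isOpen.mem_nhds hz)
  have hd : ∀ t, HasDerivAt γ (deriv γ t) t := fun t =>
    (hγ.smooth.differentiable (by simp) t).hasDerivAt
  have hd2 : ∀ t, HasDerivAt (deriv γ) (deriv (deriv γ) t) t := fun t =>
    ((contDiff_infty_iff_deriv.1 hγ.smooth).2.differentiable (by simp) t).hasDerivAt
  have h1 : deriv (F ∘ γ) = fun t => fderiv ℝ F (γ t) (deriv γ t) := by
    funext t
    exact (((hF1 _ (hγ.mem t)).differentiableAt (by simp)).hasFDerivAt.comp_hasDerivAt t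
      (hd t)).deriv
  refine ⟨fun t => hF.1.mapsTo (hγ.mem t), ?_, fun t => ?_⟩
  · exact contDiff_iff_contDiffAt.2 fun t => (hF1 _ (hγ.mem t)).comp t hγ.smooth.contDiffAt
  · have hF2 : DifferentiableAt ℝ (fderiv ℝ F) (γ t) :=
      ((hF1 _ (hγ.mem t)).fderiv_right (m := ∞) (by simp)).differentiableAt (by simp)
    have h2 : HasDerivAt (fun t => fderiv ℝ F (γ t) (deriv γ t))
        (fderiv ℝ (fderiv ℝ F) (γ t) (deriv γ t) (deriv γ t)
          + fderiv ℝ F (γ t) (deriv (deriv γ) t)) t :=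
      (hF2.hasFDerivAt.comp_hasDerivAt t (hd t)).clm_apply (hd2 t)
    rw [h1, h2.deriv]
    have h3 := congrArg (fderiv ℝ F (γ t)) (hγ.eqn t)
    rw [map_add, hg.christoffel_isometry hF (hγ.mem t), map_zero] at h3
    rw [← h3]
    simp only [Function.comp_apply]
    abel

end IsRiemannian

/-- Affine reparametrizations of geodesics are geodesics. -/
theorem IsGeodesic.reparam {γ : ℝ → E} (hγ : IsGeodesic g U γ) (a b : ℝ) :
    IsGeodesic g U fun t => γ (a * t + b) := by
  have hd : ∀ t, HasDerivAt γ (deriv γ t) t := fun t =>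
    (hγ.smooth.differentiable (by simp) t).hasDerivAt
  have hd2 : ∀ t, HasDerivAt (deriv γ) (deriv (deriv γ) t) t := fun t =>
    ((contDiff_infty_iff_deriv.1 hγ.smooth).2.differentiable (by simp) t).hasDerivAt
  have hl : ∀ t, HasDerivAt (fun t => a * t + b) a t := fun t => by
    simpa using ((hasDerivAt_id t).const_mul a).add_const b
  have h1 : deriv (fun t => γ (a * t + b)) = fun t => a • deriv γ (a * t + b) := by
    funext t
    exact ((hd _).scomp t (hl t)).deriv
  refine ⟨fun t => hγ.mem _, by have := hγ.smooth; fun_prop, fun t => ?_⟩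
  have h2 : HasDerivAt (fun t => a • deriv γ (a * t + b))
      (a • a • deriv (deriv γ) (a * t + b)) t := ((hd2 _).scomp t (hl t)).const_smul a
  have h3 := hγ.eqn (a * t + b)
  rw [h1, h2.deriv, christoffel_smul, smul_apply, map_smul, ← smul_add, ← smul_add, h3]
  simp

/-! ### Level sets -/

/-- A function that is constant on a set near `p` has vanishing derivative along the set. -/
theorem tangentSubspace_le {M : Set E} {p : E} {h : E → ℝ} (hh : DifferentiableAt ℝ h p)
    {c : ℝ} (hM : ∀ᶠ q in 𝓝 p, q ∈ M → h q = c) {v : E} (hv : v ∈ tangentSubspace M p) :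
    fderiv ℝ h p v = 0 := by
  have : tangentSubspace M p ≤ LinearMap.ker (fderiv ℝ h p : E →ₗ[ℝ] ℝ) := by
    refine Submodule.span_le.2 ?_
    rintro v ⟨γ, hγ, hγM, hγp, rfl⟩
    have hd : HasDerivAt γ (deriv γ 0) 0 := (hγ.differentiableAt (by simp)).hasDerivAt
    have h1 : HasDerivAt (h ∘ γ) (fderiv ℝ h p (deriv γ 0)) 0 := by
      rw [← hγp] at hh ⊢
      exact hh.hasFDerivAt.comp_hasDerivAt 0 hd
    have h2 : (h ∘ γ) =ᶠ[𝓝 0] fun _ => c := by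
      have hc := hd.continuousAt.tendsto
      rw [hγp] at hc
      filter_upwards [hc.eventually hM, hγM] with t ht ht' using ht ht'
    exact h1.unique ((hasDerivAt_const 0 c).congr_of_eventuallyEq h2)
  exact this hv

/-- The tangent space of a regular level set. -/
theorem mem_tangentSubspace_iff [CompleteSpace E] {M : Set E} {p : E} (hp : p ∈ M) {h : E → ℝ}
    (hh : ContDiffAt ℝ ∞ h p)
    (hd : fderiv ℝ h p ≠ 0) {c : ℝ} (hM : ∀ᶠ q in 𝓝 p, q ∈ M ↔ h q = c) {v : E} :
    v ∈ tangentSubspace M p ↔ fderiv ℝ h p v = 0 := by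
  refine ⟨tangentSubspace_le (hh.differentiableAt (by simp)) (hM.mono fun q hq => hq.1), ?_⟩
  intro hv
  obtain ⟨w, hw⟩ : ∃ w, fderiv ℝ h p w = 1 := by
    obtain ⟨w, hw⟩ := DFunLike.ne_iff.1 hd
    exact ⟨(fderiv ℝ h p w)⁻¹ • w, by rw [map_smul, smul_eq_mul, inv_mul_cancel₀ hw]⟩
  -- straighten the level set by the local diffeomorphism `Φ`, which has derivative `id` at `p`
  let Φ : E → E := fun x => x + (h x - c - fderiv ℝ h p (x - p)) • w
  have hΦ : ContDiffAt ℝ ∞ Φ p := by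
    have : ContDiff ℝ ∞ fun x => fderiv ℝ h p (x - p) := by fun_prop
    exact contDiffAt_id.add (((hh.sub contDiffAt_const).sub this.contDiffAt).smul
      contDiffAt_const)
  have hΦ' : HasFDerivAt Φ ((ContinuousLinearEquiv.refl ℝ E : E ≃L[ℝ] E) : E →L[ℝ] E) p := by
    have h1 : HasFDerivAt (fun x => fderiv ℝ h p (x - p)) (fderiv ℝ h p) p := by
      exact ((fderiv ℝ h p).hasFDerivAt.comp p ((hasFDerivAt_id p).sub_const p))
    have := (hasFDerivAt_id p).add
      ((((hh.differentiableAt (by simp)).hasFDerivAt.sub_const c).sub h1).smul_const w)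
    refine this.congr_fderiv ?_
    ext x
    simp
  have hc : h p = c := hM.self_of_nhds.1 hp
  have hΦp : Φ p = p := by simp [Φ, hc]
  let Ψ := hΦ.localInverse hΦ' (by simp)
  have hΨ : ContDiffAt ℝ ∞ Ψ p := by
    have := hΦ.to_localInverse hΦ' (by simp)
    rwa [hΦp] at this
  have hΨp : Ψ p = p := by
    have := hΦ.localInverse_apply_image hΦ' (by simp)
    rwa [hΦp] at this
  have hΦΨ : ∀ᶠ y in 𝓝 p, Φ (Ψ y) = y := by
    have := (hΦ.hasStrictFDerivAt' hΦ' (by simp)).eventually_right_inverse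
    rwa [hΦp] at this
  have hΨ' : fderiv ℝ Ψ p v = v := by
    have h1 : HasFDerivAt Φ (ContinuousLinearMap.id ℝ E) (Ψ p) := by rw [hΨp]; exact hΦ'
    have h2 := h1.comp p (hΨ.differentiableAt (by simp)).hasFDerivAt
    have h3 : Φ ∘ Ψ =ᶠ[𝓝 p] id := hΦΨ
    have h4 := h2.unique ((hasFDerivAt_id p).congr_of_eventuallyEq h3)
    simpa using congrArg (fun L => L v) h4
  have hlin : HasDerivAt (fun t : ℝ => p + t • v) v 0 := by
    simpa using ((hasDerivAt_id (0 : ℝ)).smul_const v).const_add p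
  have hlim : Filter.Tendsto (fun t : ℝ => p + t • v) (𝓝 0) (𝓝 p) := by
    simpa using hlin.continuousAt.tendsto
  refine Submodule.subset_span ⟨fun t => Ψ (p + t • v), ?_, ?_, by simp [hΨp], ?_⟩
  · have h1 : ContDiffAt ℝ ∞ Ψ ((fun t : ℝ => p + t • v) 0) := by simpa using hΨ
    have h2 : ContDiffAt ℝ ∞ (fun t : ℝ => p + t • v) 0 := by fun_prop
    exact h1.comp 0 h2
  · have h1 : Filter.Tendsto Ψ (𝓝 p) (𝓝 p) := by
      have := hΨ.continuousAt.tendsto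
      rwa [hΨp] at this
    filter_upwards [hlim.eventually hΦΨ, (h1.comp hlim).eventually hM] with t ht ht'
    refine ht'.2 ?_
    have h2 := congrArg (fun y => fderiv ℝ h p (y - p)) ht
    simp only [Φ, map_sub, map_add, map_smul, smul_eq_mul, hw, hv] at h2
    simp only [Function.comp_apply]
    linarith
  · have h1 : HasFDerivAt Ψ (fderiv ℝ Ψ p) ((fun t : ℝ => p + t • v) 0) := by
      simpa using (hΨ.differentiableAt (by simp)).hasFDerivAt
    have h2 := (h1.comp_hasDerivAt 0 hlin).deriv
    rwa [hΨ'] at h2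

/-- Where `|grad f|² = a(f)` is positive, the level set of `f` has, for the unit normal vector
`-grad f / √(a(f))`, the mean curvature `(Δf - a'(f) / 2) / √(a(f))`. -/
theorem IsRiemannian.hasMeanCurvatureAt_level [FiniteDimensional ℝ E] (hg : IsRiemannian g U)
    {f : E → ℝ} (hf : ContDiffOn ℝ ∞ f U) {a : ℝ → ℝ} (ha : ContDiff ℝ ∞ a)
    (hfa : ∀ z ∈ U, g z (gradient g f z) (gradient g f z) = a (f z)) {M : Set E} {c : ℝ}
    (hM : M = {z | z ∈ U ∧ f z = c}) (hac : 0 < a c) {p : E} (hp : p ∈ M) :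
    HasMeanCurvatureAt g M p (-(√(a c))⁻¹ • gradient g f p)
      ((laplacian g f p - deriv a c / 2) / √(a c)) := by
  have hMU : ∀ q ∈ M, q ∈ U ∧ f q = c := fun q hq => by rw [hM] at hq; exact hq
  obtain ⟨hpU, hpc⟩ := hMU p hp
  have hev : ∀ q ∈ M, ∀ᶠ q' in 𝓝 q, q' ∈ M ↔ f q' = c := by
    intro q hq
    filter_upwards [hg.isOpen.mem_nhds (hMU q hq).1] with q' hq'
    rw [hM]
    exact ⟨fun h => h.2, fun h => ⟨hq', h⟩⟩
  have hfc : ∀ q ∈ U, ContDiffAt ℝ ∞ f q := fun q hq => hf.contDiffAt (hg.isOpen.mem_nhds hq)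
  have hfd : ∀ q ∈ M, fderiv ℝ f q ≠ 0 := by
    intro q hq h0
    have h1 := hfa q (hMU q hq).1
    rw [hg.gradient_apply (hMU q hq).1, h0, (hMU q hq).2] at h1
    simp at h1
    exact hac.ne h1
  have htan : ∀ q ∈ M, ∀ v, v ∈ tangentSubspace M q ↔ fderiv ℝ f q v = 0 := fun q hq v =>
    mem_tangentSubspace_iff hq (hfc q (hMU q hq).1) (hfd q hq) (hev q hq)
  have hac' : 0 < a (f p) := by rwa [hpc]
  -- the coefficient of the normal field
  let b : ℝ → ℝ := fun x => -(√(a x))⁻¹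
  have hb : ContDiffAt ℝ ∞ b (f p) :=
    ((ha.contDiffAt.sqrt hac'.ne').inv (Real.sqrt_pos.2 hac').ne').neg
  have hb' : HasDerivAt b (deriv a c / (2 * √(a c)) / √(a c) ^ 2) c := by
    have h1 : HasDerivAt a (deriv a c) c := (ha.differentiable (by simp) c).hasDerivAt
    have := ((h1.sqrt hac.ne').inv (Real.sqrt_pos.2 hac).ne').neg
    refine this.congr_deriv ?_
    ring
  let B : E → ℝ := b ∘ f
  have hB : ContDiffAt ℝ ∞ B p := hb.comp p (hfc p hpU)
  have hV : ContDiffAt ℝ ∞ (gradient g f) p := hg.contDiffAt_gradient hpU (hfc p hpU)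
  let N : E → E := fun q => B q • gradient g f q
  have hN : ContDiffAt ℝ ∞ N p := hB.smul hV
  have hNd : DifferentiableAt ℝ N p := hN.differentiableAt (by simp)
  have hNN : ∀ q ∈ U, 0 < a (f q) → g q (N q) (N q) = 1 := by
    intro q hq hpos
    simp only [N, B, b, Function.comp_apply, map_smul, smul_apply, smul_eq_mul, hfa q hq]
    have := Real.sq_sqrt hpos.le
    have h0 := (Real.sqrt_pos.2 hpos).ne'
    field_simp
    linarith
  have hpos : ∀ᶠ q in 𝓝 p, 0 < a (f q) :=
    ((ha.continuous.continuousAt.comp (hfc p hpU).continuousAt).eventually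
      (lt_mem_nhds hac'))
  -- differentiate `|N|² = 1`
  have hortho : ∀ X, g p (nabla g N p X) (N p) = 0 := by
    intro X
    have h1 : (fun q => g q (N q) (N q)) =ᶠ[𝓝 p] fun _ => 1 := by
      filter_upwards [hpos, hg.isOpen.mem_nhds hpU] with q h1 h2 using hNN q h2 h1
    have h2 := hg.fderiv_metric hpU hNd hNd X
    rw [h1.fderiv_eq, hg.symm p hpU (N p)] at h2
    simp at h2
    linarith
  have hsq := Real.sq_sqrt hac.le
  have hs0 := (Real.sqrt_pos.2 hac).ne'
  -- so the trace of `∇N` on the tangent space of `M` is its trace on the whole space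
  have hrange : ∀ X, -nabla g N p X ∈ tangentSubspace M p := by
    intro X
    rw [htan p hp, ← hg.gradient_apply hpU, hg.symm p hpU, (g p).map_neg]
    have h1 := hortho X
    simp only [N, B, b, Function.comp_apply, map_smul, smul_eq_mul, hpc] at h1
    rcases mul_eq_zero.1 h1 with h | h
    · exact absurd h (neg_ne_zero.2 (inv_ne_zero hs0))
    · rw [neg_apply]
      exact neg_eq_zero.2 h
  have hNp : N p = -(√(a c))⁻¹ • gradient g f p := by
    simp only [N, B, b, Function.comp_apply, hpc]
  refine ⟨N, hN, hNp, ?_,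
    (-nabla g N p : E →L[ℝ] E).toLinearMap.restrict (fun X _ => by simpa using hrange X),
    fun X => by simp, ?_⟩
  · filter_upwards [self_mem_nhdsWithin] with q hq
    refine ⟨hNN q (hMU q hq).1 (by rw [(hMU q hq).2]; exact hac), fun v hv => ?_⟩
    have := (htan q hq v).1 hv
    simp only [N, map_smul, smul_apply, hg.gradient_apply (hMU q hq).1, this, smul_zero]
  · rw [LinearMap.trace_restrict_eq_of_forall_mem _ _ (fun X => by simpa using hrange X)]
    have h1 : ((-nabla g N p : E →L[ℝ] E) : E →ₗ[ℝ] E) = -(nabla g N p : E →ₗ[ℝ] E) := rfl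
    have h2 : HasFDerivAt B ((deriv a c / (2 * √(a c)) / √(a c) ^ 2) • fderiv ℝ f p) p := by
      rw [← hpc] at hb' ⊢
      exact hb'.comp_hasFDerivAt p ((hfc p hpU).differentiableAt (by simp)).hasFDerivAt
    rw [h1, map_neg, trace_nabla_smul (hB.differentiableAt (by simp))
      (hV.differentiableAt (by simp)), h2.fderiv, smul_apply,
      ← hg.gradient_apply hpU, hfa p hpU, hpc, laplacian]
    simp only [B, b, Function.comp_apply, hpc, smul_eq_mul]
    rw [hsq]
    field_simp
    ring

end Riemannian

open scoped ComplexConjugate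

/-! ### The Lorentz space `ℂ^{1,n}` -/

/-- The Hermitian form of signature `(1, n)`, antilinear in the first variable. -/
noncomputable def hform (n : ℕ) : (Fin (n + 1) → ℂ) →ₗ⋆[ℂ] (Fin (n + 1) → ℂ) →ₗ[ℂ] ℂ :=
  LinearMap.mk₂'ₛₗ (starRingEnd ℂ) (RingHom.id ℂ)
    (fun x y => -(conj (x 0) * y 0) + ∑ i : Fin n, conj (x i.succ) * y i.succ)
    (by intro x x' y; simp [add_mul, Finset.sum_add_distrib]; ring)
    (by intro c x y; simp [mul_add, Finset.mul_sum, mul_assoc])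
    (by intro x y y'; simp [mul_add, Finset.sum_add_distrib]; ring)
    (by intro c x y; simp [mul_add, Finset.mul_sum, mul_left_comm])

variable {n : ℕ}

theorem hform_apply (x y : Fin (n + 1) → ℂ) :
    hform n x y = -(conj (x 0) * y 0) + ∑ i : Fin n, conj (x i.succ) * y i.succ := rfl

theorem hform_conj (x y : Fin (n + 1) → ℂ) : conj (hform n x y) = hform n y x := by
  simp [hform_apply, mul_comm]

theorem hform_self_im (x : Fin (n + 1) → ℂ) : (hform n x x).im = 0 :=
  Complex.conj_eq_iff_im.1 (hform_conj x x)

theorem hform_re_comm (x y : Fin (n + 1) → ℂ) : (hform n x y).re = (hform n y x).re := by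
  rw [← hform_conj, Complex.conj_re]

theorem hform_smul_left (c : ℂ) (x y : Fin (n + 1) → ℂ) :
    hform n (c • x) y = conj c * hform n x y := by simp

theorem hform_smul_right (c : ℂ) (x y : Fin (n + 1) → ℂ) :
    hform n x (c • y) = c * hform n x y := by simp

theorem hform_add_left (x x' y : Fin (n + 1) → ℂ) :
    hform n (x + x') y = hform n x y + hform n x' y := by simp

theorem hform_add_right (x y y' : Fin (n + 1) → ℂ) :
    hform n x (y + y') = hform n x y + hform n x y' := by simp

theorem hform_sub_left (x x' y : Fin (n + 1) → ℂ) :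
    hform n (x - x') y = hform n x y - hform n x' y := by simp

theorem hform_sub_right (x y y' : Fin (n + 1) → ℂ) :
    hform n x (y - y') = hform n x y - hform n x y' := by simp

theorem hform_sum_left {ι : Type*} (s : Finset ι) (x : ι → Fin (n + 1) → ℂ) (y) :
    hform n (∑ i ∈ s, x i) y = ∑ i ∈ s, hform n (x i) y := by simp

theorem hform_sum_right {ι : Type*} (s : Finset ι) (x) (y : ι → Fin (n + 1) → ℂ) :
    hform n x (∑ i ∈ s, y i) = ∑ i ∈ s, hform n x (y i) := by simp

theorem hform_nondegenerate {x : Fin (n + 1) → ℂ} (h : ∀ y, hform n y x = 0) : x = 0 := by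
  ext i
  refine Fin.cases ?_ (fun i => ?_) i
  · have := h (Pi.single 0 1)
    simpa [hform_apply, Fin.succ_ne_zero] using this
  · have := h (Pi.single i.succ 1)
    rw [hform_apply, Finset.sum_eq_single i (fun j _ hj => by simp [hj])
      (by simp)] at this
    simpa [(Fin.succ_ne_zero i).symm] using this

/-- The pushforward of `y`, a tangent vector at `lift z`, to the tangent space at `z` of the ball,
under the projection of `ℂ^{1,n}` to its projective space. -/
noncomputable def proj (z : EuclideanSpace ℂ (Fin n)) :
    (Fin (n + 1) → ℂ) →ₗ[ℂ] EuclideanSpace ℂ (Fin n) where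
  toFun y := WithLp.toLp 2 fun i => y i.succ - y 0 * z i
  map_add' x y := by ext i; simp; ring
  map_smul' c x := by ext i; simp; ring

/-- The inclusion of `ℂⁿ` into `ℂ^{1,n}`. -/
def incl : EuclideanSpace ℂ (Fin n) →ₗ[ℂ] (Fin (n + 1) → ℂ) where
  toFun u := Fin.cons 0 fun i => u i
  map_add' x y := by ext i; refine Fin.cases ?_ (fun i => ?_) i <;> simp
  map_smul' c x := by ext i; refine Fin.cases ?_ (fun i => ?_) i <;> simp

@[simp] theorem lift_zero (z : EuclideanSpace ℂ (Fin n)) : lift z 0 = 1 := rfl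
@[simp] theorem lift_succ (z : EuclideanSpace ℂ (Fin n)) (i : Fin n) : lift z i.succ = z i := rfl
@[simp] theorem incl_zero (z : EuclideanSpace ℂ (Fin n)) : incl z 0 = 0 := rfl
@[simp] theorem incl_succ (z : EuclideanSpace ℂ (Fin n)) (i : Fin n) : incl z i.succ = z i := rfl
@[simp] theorem proj_apply (z : EuclideanSpace ℂ (Fin n)) (y : Fin (n + 1) → ℂ) (i : Fin n) :
    proj z y i = y i.succ - y 0 * z i := rfl

theorem incl_proj (z : EuclideanSpace ℂ (Fin n)) (y : Fin (n + 1) → ℂ) :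
    incl (proj z y) = y - y 0 • lift z := by
  ext i; refine Fin.cases ?_ (fun i => ?_) i <;> simp

@[simp] theorem proj_incl (z u : EuclideanSpace ℂ (Fin n)) : proj z (incl u) = u := by
  ext i; simp

@[simp] theorem proj_lift (z : EuclideanSpace ℂ (Fin n)) : proj z (lift z) = 0 := by
  ext i; simp

theorem hform_incl_incl (u v : EuclideanSpace ℂ (Fin n)) :
    hform n (incl u) (incl v) = inner ℂ u v := by
  simp [hform_apply, PiLp.inner_apply, mul_comm]

theorem hform_incl_lift (u z : EuclideanSpace ℂ (Fin n)) :
    hform n (incl u) (lift z) = inner ℂ u z := by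
  simp [hform_apply, PiLp.inner_apply, mul_comm]

theorem hform_lift_incl (u z : EuclideanSpace ℂ (Fin n)) :
    hform n (lift z) (incl u) = inner ℂ z u := by
  simp [hform_apply, PiLp.inner_apply, mul_comm]

theorem hform_lift_lift (z w : EuclideanSpace ℂ (Fin n)) :
    hform n (lift z) (lift w) = inner ℂ z w - 1 := by
  simp [hform_apply, PiLp.inner_apply, mul_comm]; ring

theorem hform_lift_self (z : EuclideanSpace ℂ (Fin n)) :
    hform n (lift z) (lift z) = ((-(1 - ‖z‖ ^ 2) : ℝ) : ℂ) := by
  rw [hform_lift_lift, inner_self_eq_norm_sq_to_K]; push_cast; simp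

/-- The last `n` coordinates of a vector of `ℂ^{1,n}`. -/
noncomputable def tail : (Fin (n + 1) → ℂ) →ₗ[ℂ] EuclideanSpace ℂ (Fin n) where
  toFun x := WithLp.toLp 2 fun i => x i.succ
  map_add' x y := by ext i; simp
  map_smul' c x := by ext i; simp

@[simp] theorem tail_apply (x : Fin (n + 1) → ℂ) (i : Fin n) : tail x i = x i.succ := rfl

theorem hform_lift (x : Fin (n + 1) → ℂ) (z : EuclideanSpace ℂ (Fin n)) :
    hform n x (lift z) = inner ℂ (tail x) z - conj (x 0) := by
  simp [hform_apply, PiLp.inner_apply, mul_comm]; ring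

theorem hform_incl (x : Fin (n + 1) → ℂ) (u : EuclideanSpace ℂ (Fin n)) :
    hform n x (incl u) = inner ℂ (tail x) u := by
  simp [hform_apply, PiLp.inner_apply, mul_comm]

/-! ### The Bergman metric -/

theorem mem_CH {z : EuclideanSpace ℂ (Fin n)} : z ∈ CH n ↔ 0 < 1 - ‖z‖ ^ 2 := by
  rw [CH, mem_ball_zero_iff, sub_pos, sq_lt_one_iff₀ (norm_nonneg z)]

theorem isOpen_CH : IsOpen (CH n) := Metric.isOpen_ball

theorem metric_apply (z u v : EuclideanSpace ℂ (Fin n)) :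
    metric n z u v = 4 * ((inner ℂ u v).re / (1 - ‖z‖ ^ 2)
      + (inner ℂ u z * inner ℂ z v).re / (1 - ‖z‖ ^ 2) ^ 2) := rfl

/-- The Bergman metric in terms of the Hermitian form. -/
theorem metric_proj {z : EuclideanSpace ℂ (Fin n)} (hz : z ∈ CH n) (x y : Fin (n + 1) → ℂ) :
    metric n z (proj z x) (proj z y) = 4 * ((hform n x y).re / (1 - ‖z‖ ^ 2)
      + (hform n x (lift z) * hform n (lift z) y).re / (1 - ‖z‖ ^ 2) ^ 2) := by
  have hs : (1 - ‖z‖ ^ 2) ≠ 0 := (mem_CH.1 hz).ne'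
  rw [metric_apply, ← hform_incl_incl, ← hform_incl_lift, ← hform_lift_incl, incl_proj, incl_proj]
  simp only [hform_sub_left, hform_sub_right, hform_smul_left, hform_smul_right, hform_lift_self]
  generalize 1 - ‖z‖ ^ 2 = s at *
  field_simp
  simp only [Complex.sub_re, Complex.mul_re, Complex.mul_im, Complex.sub_im,
    Complex.ofReal_re, Complex.ofReal_im, Complex.conj_re, Complex.conj_im]
  ring

theorem contDiff_norm_sq' : ContDiff ℝ ∞ fun z : EuclideanSpace ℂ (Fin n) => ‖z‖ ^ 2 := by
  have h : (fun z : EuclideanSpace ℂ (Fin n) => ‖z‖ ^ 2) = fun z => (inner ℂ z z).re := by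
    funext z
    rw [inner_self_eq_norm_sq_to_K]
    norm_cast
  rw [h]
  exact Complex.reCLM.contDiff.comp (contDiff_id.inner ℂ contDiff_id)

theorem isRiemannian_metric : IsRiemannian (metric n) (CH n) := by
  refine ⟨isOpen_CH, ?_, fun z _ u v => ?_, fun z hz v hv => ?_⟩
  · refine contDiffOn_clm_apply.2 fun u => contDiffOn_clm_apply.2 fun v => ?_
    simp only [metric_apply]
    have h0 : ContDiffOn ℝ ∞ (fun z : EuclideanSpace ℂ (Fin n) => 1 - ‖z‖ ^ 2) (CH n) :=
      (contDiff_const.sub contDiff_norm_sq').contDiffOn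
    have h1 : ∀ z ∈ CH n, 1 - ‖z‖ ^ 2 ≠ 0 := fun z hz => (mem_CH.1 hz).ne'
    have h2 : ContDiff ℝ ∞ fun z : EuclideanSpace ℂ (Fin n) => (inner ℂ u z * inner ℂ z v).re :=
      Complex.reCLM.contDiff.comp
        ((contDiff_const.inner ℂ contDiff_id).mul (contDiff_id.inner ℂ contDiff_const))
    exact contDiffOn_const.mul ((contDiffOn_const.div h0 h1).add
      (h2.contDiffOn.div (h0.pow 2) fun z hz => pow_ne_zero 2 (h1 z hz)))
  · rw [metric_apply, metric_apply, ← inner_conj_symm v u, ← inner_conj_symm v z,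
      ← inner_conj_symm z u]
    simp only [Complex.mul_re, Complex.conj_re, Complex.conj_im]
    ring
  · rw [metric_apply, ← inner_conj_symm v z]
    have hs := mem_CH.1 hz
    have h1 : 0 < (inner ℂ v v).re := by
      rw [inner_self_eq_norm_sq_to_K]
      have : 0 < ‖v‖ ^ 2 := by positivity
      exact_mod_cast this
    have h2 : 0 ≤ (conj (inner ℂ z v) * inner ℂ z v).re := by
      rw [mul_comm, Complex.mul_conj]
      exact_mod_cast Complex.normSq_nonneg _
    positivity

theorem hasFDerivAt_inner_right (a z : EuclideanSpace ℂ (Fin n)) :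
    HasFDerivAt (fun z => inner ℂ a z) ((innerSL ℂ a).restrictScalars ℝ) z :=
  ((innerSL ℂ a).restrictScalars ℝ).hasFDerivAt

theorem hasFDerivAt_hform (x : Fin (n + 1) → ℂ) (z : EuclideanSpace ℂ (Fin n)) :
    HasFDerivAt (fun z => hform n x (lift z)) ((innerSL ℂ (tail x)).restrictScalars ℝ) z := by
  simp only [hform_lift]
  exact (hasFDerivAt_inner_right _ z).sub_const _

theorem hasFDerivAt_one_sub_norm_sq (z : EuclideanSpace ℂ (Fin n)) :
    HasFDerivAt (fun z : EuclideanSpace ℂ (Fin n) => 1 - ‖z‖ ^ 2)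
      ((-2 : ℝ) • Complex.reCLM ∘L (innerSL ℂ z).restrictScalars ℝ) z := by
  have h1 := ((hasFDerivAt_id (𝕜 := ℝ) z).inner ℂ (hasFDerivAt_id z))
  have h2 := (Complex.reCLM.hasFDerivAt.comp z h1).const_sub 1
  have h : (fun z : EuclideanSpace ℂ (Fin n) => 1 - ‖z‖ ^ 2) =
      fun z => 1 - (inner ℂ z z).re := by
    funext z
    rw [inner_self_eq_norm_sq_to_K]
    norm_cast
  rw [h]
  refine h2.congr_fderiv ?_
  ext u
  simp [fderivInnerCLM]
  rw [← inner_conj_symm u z, Complex.conj_re]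
  ring

theorem fderiv_metric_apply {z : EuclideanSpace ℂ (Fin n)} (hz : z ∈ CH n)
    (X u v : EuclideanSpace ℂ (Fin n)) :
    fderiv ℝ (metric n) z X u v = 4 * (2 * (inner ℂ z X).re * (inner ℂ u v).re
        / (1 - ‖z‖ ^ 2) ^ 2
      + (inner ℂ u X * inner ℂ z v + inner ℂ u z * inner ℂ X v).re / (1 - ‖z‖ ^ 2) ^ 2
      + 4 * (inner ℂ z X).re * (inner ℂ u z * inner ℂ z v).re / (1 - ‖z‖ ^ 2) ^ 3) := by
  have hs := (mem_CH.1 hz).ne'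
  have h1 := (((isRiemannian_metric.differentiableAt hz).hasFDerivAt.clm_apply
    (hasFDerivAt_const u z)).clm_apply (hasFDerivAt_const v z))
  have h2 := hasFDerivAt_one_sub_norm_sq z
  have h3 := ((hasFDerivAt_const u z).inner ℂ (hasFDerivAt_id (𝕜 := ℝ) z)).mul
    ((hasFDerivAt_id (𝕜 := ℝ) z).inner ℂ (hasFDerivAt_const v z))
  have h4 := (((hasFDerivAt_const (inner ℂ u v).re z).mul ((hasDerivAt_inv hs).comp_hasFDerivAt z h2)).add
    ((Complex.reCLM.hasFDerivAt.comp z h3).mul ((hasDerivAt_inv (pow_ne_zero 2 hs)).comp_hasFDerivAt z (h2.pow 2)))).const_mul 4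
  have h5 := congrArg (fun L => L X) (h1.unique h4)
  simp [fderivInnerCLM] at h5
  rw [h5]
  simp
  field_simp
  ring

/-- The Christoffel operator of the Bergman metric. -/
theorem christoffel_metric {z : EuclideanSpace ℂ (Fin n)} (hz : z ∈ CH n)
    (v X : EuclideanSpace ℂ (Fin n)) :
    christoffel (metric n) z v X =
      ((1 - ‖z‖ ^ 2 : ℝ) : ℂ)⁻¹ • (inner ℂ z X • v + inner ℂ z v • X) := by
  have hs := (mem_CH.1 hz).ne'
  refine isRiemannian_metric.christoffel_eq hz fun w => ?_
  rw [fderiv_metric_apply hz, fderiv_metric_apply hz, fderiv_metric_apply hz, metric_apply]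
  simp only [inner_smul_left, inner_add_left]
  rw [← inner_conj_symm w X, ← inner_conj_symm v z, ← inner_conj_symm X z, ← inner_conj_symm X v]
  generalize 1 - ‖z‖ ^ 2 = s at *
  rw [← Complex.ofReal_inv]
  generalize inner ℂ z X = a
  generalize inner ℂ z v = b
  generalize inner ℂ z w = c
  generalize inner ℂ v w = p
  generalize inner ℂ X w = q
  generalize inner ℂ v X = r
  simp only [Complex.add_re, Complex.mul_re, Complex.mul_im, Complex.add_im, Complex.conj_ofReal,
    Complex.ofReal_re, Complex.ofReal_im, Complex.conj_re, Complex.conj_im]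
  field_simp
  ring

/-! ### Negative vectors and points of the ball -/

/-- The point of the ball that is spanned by a negative vector of `ℂ^{1,n}`. -/
noncomputable def pr (Z : Fin (n + 1) → ℂ) : EuclideanSpace ℂ (Fin n) :=
  WithLp.toLp 2 fun i => Z i.succ / Z 0

theorem pr_eq (Z : Fin (n + 1) → ℂ) : pr Z = (Z 0)⁻¹ • tail Z := by
  ext i; simp [pr, div_eq_inv_mul]

theorem lift_pr {Z : Fin (n + 1) → ℂ} (hZ : Z 0 ≠ 0) : lift (pr Z) = (Z 0)⁻¹ • Z := by
  ext i; refine Fin.cases ?_ (fun i => ?_) i <;> simp [pr, hZ, div_eq_inv_mul]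

theorem smul_lift_pr {Z : Fin (n + 1) → ℂ} (hZ : Z 0 ≠ 0) : Z 0 • lift (pr Z) = Z := by
  rw [lift_pr hZ, smul_inv_smul₀ hZ]

@[simp] theorem pr_lift (z : EuclideanSpace ℂ (Fin n)) : pr (lift z) = z := by
  ext i; simp [pr]

theorem pr_smul {c : ℂ} (hc : c ≠ 0) (Z : Fin (n + 1) → ℂ) : pr (c • Z) = pr Z := by
  ext i; simp [pr, mul_div_mul_left _ _ hc]

theorem ne_zero_of_hform_neg {Z : Fin (n + 1) → ℂ} (hZ : (hform n Z Z).re < 0) : Z 0 ≠ 0 := by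
  intro h0
  have h1 : hform n Z Z = inner ℂ (tail Z) (tail Z) := by
    simp only [hform_apply, PiLp.inner_apply, h0, RCLike.inner_apply, tail_apply, mul_comm]
    ring
  rw [h1, inner_self_eq_norm_sq_to_K] at hZ
  have : ((‖tail Z‖ : ℂ) ^ 2).re = ‖tail Z‖ ^ 2 := by norm_cast
  rw [show (RCLike.ofReal ‖tail Z‖ : ℂ) = (‖tail Z‖ : ℂ) from rfl, this] at hZ
  nlinarith [sq_nonneg ‖tail Z‖]

theorem hform_self_pr {Z : Fin (n + 1) → ℂ} (hZ : Z 0 ≠ 0) :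
    (hform n Z Z).re = -(Complex.normSq (Z 0) * (1 - ‖pr Z‖ ^ 2)) := by
  conv_lhs => rw [← smul_lift_pr hZ]
  rw [hform_smul_left, hform_smul_right, hform_lift_self, ← mul_assoc, mul_comm (conj _),
    Complex.mul_conj, ← Complex.ofReal_mul, Complex.ofReal_re]
  ring

theorem pr_mem_CH {Z : Fin (n + 1) → ℂ} (hZ : (hform n Z Z).re < 0) : pr Z ∈ CH n := by
  have h0 := ne_zero_of_hform_neg hZ
  rw [mem_CH]
  rw [hform_self_pr h0] at hZ
  have := Complex.normSq_pos.2 h0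
  by_contra h
  nlinarith

theorem hform_lift_neg {z : EuclideanSpace ℂ (Fin n)} (hz : z ∈ CH n) :
    (hform n (lift z) (lift z)).re < 0 := by
  rw [hform_lift_self, Complex.ofReal_re]
  linarith [mem_CH.1 hz]

theorem hasFDerivAt_pr {Z : Fin (n + 1) → ℂ} (hZ : Z 0 ≠ 0) :
    HasFDerivAt pr ((((Z 0)⁻¹ • proj (pr Z)).toContinuousLinearMap).restrictScalars ℝ) Z := by
  have h1 : HasFDerivAt (fun Z : Fin (n + 1) → ℂ => Z 0)
      ((ContinuousLinearMap.proj (R := ℂ) (φ := fun _ => ℂ) (0 : Fin (n + 1))).restrictScalars ℝ)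
      Z := ((ContinuousLinearMap.proj (R := ℂ) (φ := fun _ => ℂ)
        (0 : Fin (n + 1))).restrictScalars ℝ).hasFDerivAt
  have h2 : HasFDerivAt (fun Z : Fin (n + 1) → ℂ => tail Z)
      ((tail.toContinuousLinearMap).restrictScalars ℝ) Z :=
    ((tail.toContinuousLinearMap).restrictScalars ℝ).hasFDerivAt
  have h3 := ((hasFDerivAt_inv hZ).restrictScalars ℝ).comp Z h1
  have h4 := h3.smul h2
  have h5 : (pr : (Fin (n + 1) → ℂ) → _) = fun Z => (Z 0)⁻¹ • tail Z := by
    funext Z; exact pr_eq Z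
  rw [h5]
  refine h4.congr_fderiv ?_
  ext y i
  simp
  field_simp
  ring

theorem contDiffAt_pr {Z : Fin (n + 1) → ℂ} (hZ : Z 0 ≠ 0) : ContDiffAt ℝ ∞ pr Z := by
  have h5 : (pr : (Fin (n + 1) → ℂ) → _) = fun Z => (Z 0)⁻¹ • tail Z := by
    funext Z; exact pr_eq Z
  rw [h5]
  have h1 : ContDiff ℝ ∞ (fun Z : Fin (n + 1) → ℂ => Z 0) := contDiff_apply ℝ ℂ (0 : Fin (n + 1))
  have h2 : ContDiff ℝ ∞ (fun Z : Fin (n + 1) → ℂ => tail Z) :=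
    ((tail.toContinuousLinearMap).restrictScalars ℝ).contDiff
  exact (h1.contDiffAt.inv hZ).smul h2.contDiffAt

/-! ### Geodesics -/

/-- The curve `cosh(t/2) P + sinh(t/2) V` in `ℂ^{1,n}`. -/
noncomputable def hyp (P V : Fin (n + 1) → ℂ) (t : ℝ) : Fin (n + 1) → ℂ :=
  ((Real.cosh (t / 2) : ℝ) : ℂ) • P + ((Real.sinh (t / 2) : ℝ) : ℂ) • V

/-- `P` is a negative and `V` a positive unit vector orthogonal to it: they define a unit speed
geodesic. -/
structure IsFrame (P V : Fin (n + 1) → ℂ) : Prop where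
  neg : hform n P P = -1
  ortho : hform n P V = 0
  pos : hform n V V = 1

theorem hasDerivAt_hyp (P V : Fin (n + 1) → ℂ) (t : ℝ) :
    HasDerivAt (hyp P V) ((1 / 2 : ℂ) • hyp V P t) t := by
  have h0 : HasDerivAt (fun t : ℝ => t / 2) (1 / 2) t := (hasDerivAt_id t).div_const 2
  have h1 : HasDerivAt (fun t : ℝ => ((Real.cosh (t / 2) : ℝ) : ℂ))
      ((Real.sinh (t / 2) * (1 / 2) : ℝ) : ℂ) t := h0.cosh.ofReal_comp
  have h2 : HasDerivAt (fun t : ℝ => ((Real.sinh (t / 2) : ℝ) : ℂ))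
      ((Real.cosh (t / 2) * (1 / 2) : ℝ) : ℂ) t := h0.sinh.ofReal_comp
  refine ((h1.smul_const P).add (h2.smul_const V)).congr_deriv ?_
  rw [hyp]
  push_cast
  module

theorem contDiff_hyp (P V : Fin (n + 1) → ℂ) : ContDiff ℝ ∞ (hyp P V) := by
  unfold hyp
  have h0 : ContDiff ℝ ∞ fun t : ℝ => t / 2 := by fun_prop
  exact ((Complex.ofRealCLM.contDiff.comp h0.cosh).smul contDiff_const).add
    ((Complex.ofRealCLM.contDiff.comp h0.sinh).smul contDiff_const)

@[simp] theorem hyp_zero (P V : Fin (n + 1) → ℂ) : hyp P V 0 = P := by simp [hyp]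

namespace IsFrame

variable {P V : Fin (n + 1) → ℂ}

theorem ortho' (h : IsFrame P V) : hform n V P = 0 := by rw [← hform_conj, h.ortho, map_zero]

theorem hform_hyp (h : IsFrame P V) (t : ℝ) : hform n (hyp P V t) (hyp P V t) = -1 := by
  simp only [hyp, hform_add_left, hform_add_right, hform_smul_left, hform_smul_right, h.neg, h.pos,
    h.ortho, h.ortho', Complex.conj_ofReal]
  have : ((Real.cosh (t / 2) : ℝ) : ℂ) ^ 2 - ((Real.sinh (t / 2) : ℝ) : ℂ) ^ 2 = 1 := by
    exact_mod_cast Real.cosh_sq_sub_sinh_sq (t / 2)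
  linear_combination -this

theorem hform_hyp_swap (h : IsFrame P V) (t : ℝ) : hform n (hyp P V t) (hyp V P t) = 0 := by
  simp only [hyp, hform_add_left, hform_add_right, hform_smul_left, hform_smul_right, h.neg, h.pos,
    h.ortho, h.ortho', Complex.conj_ofReal]
  ring

theorem hform_hyp_swap_self (h : IsFrame P V) (t : ℝ) :
    hform n (hyp V P t) (hyp V P t) = 1 := by
  simp only [hyp, hform_add_left, hform_add_right, hform_smul_left, hform_smul_right, h.neg, h.pos,
    h.ortho, h.ortho', Complex.conj_ofReal]
  have : ((Real.cosh (t / 2) : ℝ) : ℂ) ^ 2 - ((Real.sinh (t / 2) : ℝ) : ℂ) ^ 2 = 1 := by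
    exact_mod_cast Real.cosh_sq_sub_sinh_sq (t / 2)
  linear_combination this

theorem hyp_neg (h : IsFrame P V) (t : ℝ) : (hform n (hyp P V t) (hyp P V t)).re < 0 := by
  rw [h.hform_hyp]; simp

theorem hyp_ne_zero (h : IsFrame P V) (t : ℝ) : hyp P V t 0 ≠ 0 :=
  ne_zero_of_hform_neg (h.hyp_neg t)

theorem hasDerivAt (h : IsFrame P V) (t : ℝ) :
    HasDerivAt (fun t => pr (hyp P V t))
      ((hyp P V t 0)⁻¹ • proj (pr (hyp P V t)) ((1 / 2 : ℂ) • hyp V P t)) t :=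
  (hasFDerivAt_pr (h.hyp_ne_zero t)).comp_hasDerivAt t (hasDerivAt_hyp P V t)

/-- The explicit geodesics of the ball. -/
theorem isGeodesic (h : IsFrame P V) :
    IsGeodesic (metric n) (CH n) fun t => pr (hyp P V t) := by
  refine ⟨fun t => pr_mem_CH (h.hyp_neg t), ?_, fun t => ?_⟩
  · exact contDiff_iff_contDiffAt.2 fun t =>
      (contDiffAt_pr (h.hyp_ne_zero t)).comp t (contDiff_hyp P V).contDiffAt
  · have hγ := h.hasDerivAt
    have h1 : deriv (fun t => pr (hyp P V t)) =
        fun t => (hyp P V t 0)⁻¹ • proj (pr (hyp P V t)) ((1 / 2 : ℂ) • hyp V P t) :=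
      funext fun t => (hγ t).deriv
    have h1' : deriv (fun t => pr (hyp P V t)) = fun t => (hyp P V t 0)⁻¹ •
        (tail ((1 / 2 : ℂ) • hyp V P t) - ((1 / 2 : ℂ) • hyp V P t) 0 • pr (hyp P V t)) := by
      rw [h1]
      funext t
      congr 1
    have hz := h.hyp_ne_zero t
    have hZ0 : ∀ P V : Fin (n + 1) → ℂ, HasDerivAt (fun t => hyp P V t 0)
        (((1 / 2 : ℂ) • hyp V P t) 0) t := fun P V => hasDerivAt_pi.1 (hasDerivAt_hyp P V t) 0
    have h2 : HasDerivAt (fun t => ((1 / 2 : ℂ) • hyp V P t)) ((1 / 4 : ℂ) • hyp P V t) t := by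
      refine ((hasDerivAt_hyp V P t).const_smul (1 / 2 : ℂ)).congr_deriv ?_
      module
    have h3 : HasDerivAt (fun t => tail ((1 / 2 : ℂ) • hyp V P t))
        (tail ((1 / 4 : ℂ) • hyp P V t)) t :=
      ((tail.toContinuousLinearMap).restrictScalars ℝ).hasFDerivAt.comp_hasDerivAt t h2
    have h4 := ((hZ0 P V).inv hz).smul (h3.sub ((hasDerivAt_pi.1 h2 0).smul (hγ t)))
    have h5 := (congrArg (fun f => deriv f t) h1').trans h4.deriv
    have hmem := pr_mem_CH (h.hyp_neg t)
    have hs : (1 - ‖pr (hyp P V t)‖ ^ 2) ≠ 0 := (mem_CH.1 hmem).ne'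
    have hinner : ∀ y : Fin (n + 1) → ℂ, inner ℂ (pr (hyp P V t)) (proj (pr (hyp P V t)) y) =
        conj (hyp P V t 0)⁻¹ * hform n (hyp P V t) y +
          y 0 * ((1 - ‖pr (hyp P V t)‖ ^ 2 : ℝ) : ℂ) := by
      intro y
      rw [← hform_lift_incl, incl_proj, hform_sub_right, hform_smul_right, hform_lift_self]
      conv_lhs => rw [lift_pr hz, hform_smul_left]
      push_cast
      ring
    have h6 : inner ℂ (pr (hyp P V t)) (deriv (fun t => pr (hyp P V t)) t) =
        (hyp P V t 0)⁻¹ * ((1 / 2 : ℂ) * hyp V P t 0)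
          * ((1 - ‖pr (hyp P V t)‖ ^ 2 : ℝ) : ℂ) := by
      rw [h1]
      simp only
      rw [inner_smul_right, hinner, hform_smul_right, h.hform_hyp_swap]
      simp
      ring
    rw [christoffel_metric hmem, h6, h5]
    have h7 : tail ((1 / 4 : ℂ) • hyp P V t) =
        ((1 / 4 : ℂ) * hyp P V t 0) • pr (hyp P V t) := by
      rw [pr_eq, map_smul, smul_smul, mul_assoc, mul_inv_cancel₀ hz, mul_one]
    have h8 := congrFun h1' t
    have h9 := congrFun h1 t
    rw [← h9, h7, h8]
    generalize ((1 - ‖pr (hyp P V t)‖ ^ 2 : ℝ)) = s at *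
    have hs' : (s : ℂ) ≠ 0 := by exact_mod_cast hs
    simp only [Pi.smul_apply, Pi.smul_apply', smul_eq_mul, Pi.sub_apply, Pi.inv_apply]
    generalize tail ((1 / 2 : ℂ) • hyp V P t) = a
    generalize pr (hyp P V t) = b
    generalize hyp P V t 0 = x at *
    generalize hyp V P t 0 = y at *
    ext i
    simp
    field_simp
    ring

theorem deriv_zero (h : IsFrame P V) :
    deriv (fun t => pr (hyp P V t)) 0 = (2 * P 0)⁻¹ • proj (pr P) V := by
  rw [(h.hasDerivAt 0).deriv, hyp_zero, hyp_zero, map_smul, smul_smul]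
  congr 1
  rw [mul_inv]
  ring

theorem metric_deriv (h : IsFrame P V) (t : ℝ) :
    metric n (pr (hyp P V t)) (deriv (fun t => pr (hyp P V t)) t)
      (deriv (fun t => pr (hyp P V t)) t) = 1 := by
  have hz := h.hyp_ne_zero t
  rw [(h.hasDerivAt t).deriv, ← map_smul, metric_proj (pr_mem_CH (h.hyp_neg t)), lift_pr hz]
  have h1 := hform_self_pr hz
  rw [h.hform_hyp] at h1
  simp only [hform_smul_left, hform_smul_right, h.hform_hyp_swap, h.hform_hyp_swap_self]
  have h2 : (hyp P V t 0)⁻¹ * ((1 / 2 : ℂ) * (conj (hyp P V t 0)⁻¹ * (conj (1 / 2 : ℂ) * 1))) =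
      (((Complex.normSq (hyp P V t 0))⁻¹ * (1 / 4) : ℝ) : ℂ) := by
    have h3 : conj (hyp P V t 0) ≠ 0 := by simpa using hz
    push_cast
    rw [Complex.normSq_eq_conj_mul_self]
    simp
    field_simp
    rw [map_ofNat]
    norm_num
  rw [h2, Complex.ofReal_re]
  have h3 := (Complex.normSq_pos.2 hz).ne'
  simp at h1
  have h4 : (1 - ‖pr (hyp P V t)‖ ^ 2) ≠ 0 := (mem_CH.1 (pr_mem_CH (h.hyp_neg t))).ne'
  generalize (1 - ‖pr (hyp P V t)‖ ^ 2) = s at *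
  simp
  field_simp
  linarith

end IsFrame

/-- The geodesic equation has unique solutions. -/
theorem geodesic_unique {γ γ' : ℝ → EuclideanSpace ℂ (Fin n)}
    (hγ : IsGeodesic (metric n) (CH n) γ) (hγ' : IsGeodesic (metric n) (CH n) γ') {t₀ : ℝ}
    (h0 : γ t₀ = γ' t₀) (h1 : deriv γ t₀ = deriv γ' t₀) : γ = γ' := by
  let E := EuclideanSpace ℂ (Fin n)
  -- the geodesic equation as a first order equation
  let v : E × E → E × E := fun p =>
    (p.2, -(((1 - ‖p.1‖ ^ 2 : ℝ) : ℂ)⁻¹ • ((2 * inner ℂ p.1 p.2) • p.2)))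
  have hv : ContDiffOn ℝ ∞ v (CH n ×ˢ Set.univ) := by
    have e0 : ContDiff ℝ ∞ fun p : E × E => (1 - ‖p.1‖ ^ 2 : ℝ) :=
      contDiff_const.sub (contDiff_norm_sq'.comp contDiff_fst)
    have e1 : ContDiffOn ℝ ∞ (fun p : E × E => ((1 - ‖p.1‖ ^ 2 : ℝ) : ℂ)⁻¹)
        (CH n ×ˢ Set.univ) := by
      refine (Complex.ofRealCLM.contDiff.comp e0).contDiffOn.inv fun p hp => ?_
      have := (mem_CH.1 hp.1).ne'
      simpa using Complex.ofReal_ne_zero.2 this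
    have e2 : ContDiff ℝ ∞ fun p : E × E => (2 * inner ℂ p.1 p.2) • p.2 :=
      (contDiff_const.mul (contDiff_fst.inner ℂ contDiff_snd)).smul contDiff_snd
    exact contDiff_snd.contDiffOn.prodMk (e1.smul e2.contDiffOn).neg
  have hsol : ∀ γ : ℝ → E, IsGeodesic (metric n) (CH n) γ → ∀ t,
      HasDerivAt (fun t => (γ t, deriv γ t)) (v (γ t, deriv γ t)) t := by
    intro γ hγ t
    have hd : HasDerivAt γ (deriv γ t) t :=
      (hγ.smooth.differentiable (by simp) t).hasDerivAt
    have hd2 : HasDerivAt (deriv γ) (deriv (deriv γ) t) t :=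
      ((contDiff_infty_iff_deriv.1 hγ.smooth).2.differentiable (by simp) t).hasDerivAt
    refine (hd.prodMk hd2).congr_deriv ?_
    have := hγ.eqn t
    rw [christoffel_metric (hγ.mem t)] at this
    simp only [v, Prod.mk.injEq, true_and]
    rw [eq_neg_of_add_eq_zero_left this]
    module
  -- on a compact interval a solution stays in a compact convex set, where the equation is
  -- Lipschitz
  have hbound : ∀ γ : ℝ → E, IsGeodesic (metric n) (CH n) γ → ∀ a b : ℝ,
      ∃ R < (1 : ℝ), ∃ B, ∀ t ∈ Set.Icc a b, ‖γ t‖ ≤ R ∧ ‖deriv γ t‖ ≤ B := by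
    intro γ hγ a b
    have hc1 : ContinuousOn (fun t => ‖γ t‖) (Set.Icc a b) :=
      hγ.smooth.continuous.norm.continuousOn
    have hc2 : ContinuousOn (fun t => ‖deriv γ t‖) (Set.Icc a b) :=
      (contDiff_infty_iff_deriv.1 hγ.smooth).2.continuous.norm.continuousOn
    rcases (Set.Icc a b).eq_empty_or_nonempty with he | hne
    · exact ⟨0, one_pos, 0, by simp [he]⟩
    · obtain ⟨t1, -, ht1⟩ := isCompact_Icc.exists_isMaxOn hne hc1
      obtain ⟨t2, -, ht2⟩ := isCompact_Icc.exists_isMaxOn hne hc2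
      exact ⟨‖γ t1‖, by simpa [CH] using hγ.mem t1, ‖deriv γ t2‖, fun t ht => ⟨ht1 ht, ht2 ht⟩⟩
  funext t
  let a := min t t₀ - 1
  let b := max t t₀ + 1
  obtain ⟨R, hR, B, hB⟩ := hbound γ hγ a b
  obtain ⟨R', hR', B', hB'⟩ := hbound γ' hγ' a b
  let s : Set (E × E) := Metric.closedBall 0 (max R R') ×ˢ Metric.closedBall 0 (max B B')
  have hsub : s ⊆ CH n ×ˢ Set.univ := by
    intro p hp
    refine ⟨?_, trivial⟩
    have := hp.1
    rw [mem_closedBall_zero_iff] at this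
    simpa [CH] using this.trans_lt (max_lt hR hR')
  obtain ⟨K, hK⟩ := (hv.mono hsub).exists_lipschitzOnWith (by simp)
    ((convex_closedBall _ _).prod (convex_closedBall _ _))
    ((isCompact_closedBall _ _).prod (isCompact_closedBall _ _))
  have hmem : ∀ t ∈ Set.Icc a b, (γ t, deriv γ t) ∈ s := fun t ht =>
    ⟨by simpa using Or.inl (hB t ht).1, by simpa using Or.inl (hB t ht).2⟩
  have hmem' : ∀ t ∈ Set.Icc a b, (γ' t, deriv γ' t) ∈ s := fun t ht =>
    ⟨by simpa using Or.inr (hB' t ht).1, by simpa using Or.inr (hB' t ht).2⟩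
  have ha : a < min t t₀ := sub_one_lt _
  have hb : max t t₀ < b := lt_add_one _
  have key := ODE_solution_unique_of_mem_Icc (v := fun _ => v) (s := fun _ => s) (K := K)
    (t₀ := t₀) (a := a) (b := b) (fun _ _ => hK)
    ⟨ha.trans_le (min_le_right _ _), (le_max_right _ _).trans_lt hb⟩
    (fun t _ => (hsol γ hγ t).continuousAt.continuousWithinAt) (fun t _ => hsol γ hγ t)
    (fun t ht => hmem t (Set.Ioo_subset_Icc_self ht))
    (fun t _ => (hsol γ' hγ' t).continuousAt.continuousWithinAt) (fun t _ => hsol γ' hγ' t)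
    (fun t ht => hmem' t (Set.Ioo_subset_Icc_self ht)) (by simp [h0, h1])
  exact congrArg Prod.fst (key ⟨(ha.trans_le (min_le_left _ _)).le,
    ((le_max_left _ _).trans_lt hb).le⟩)

/-- A geodesic with the initial data of the hyperbolic combination of a frame is that combination.
-/
theorem IsFrame.eq_of_deriv {P V : Fin (n + 1) → ℂ} (h : IsFrame P V)
    {γ : ℝ → EuclideanSpace ℂ (Fin n)} (hγ : IsGeodesic (metric n) (CH n) γ) (h0 : γ 0 = pr P)
    (h1 : deriv γ 0 = (2 * P 0)⁻¹ • proj (pr P) V) : γ = fun t => pr (hyp P V t) :=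
  geodesic_unique hγ h.isGeodesic (t₀ := 0) (by simp [h0]) (by rw [h1, h.deriv_zero])

/-! ### The action of the unitary group of the form -/

/-- The matrix `A` preserves the Hermitian form. -/
def Preserves (A : Mat n) : Prop :=
  ∀ x y, hform n (A.mulVec x) (A.mulVec y) = hform n x y

theorem act_eq (A : Mat n) (z : EuclideanSpace ℂ (Fin n)) : act A z = pr (A.mulVec (lift z)) := rfl

namespace Preserves

variable {A B : Mat n}

theorem one : Preserves (1 : Mat n) := fun x y => by simp

theorem mul (hA : Preserves A) (hB : Preserves B) : Preserves (A * B) := fun x y => by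
  rw [← Matrix.mulVec_mulVec, ← Matrix.mulVec_mulVec, hA, hB]

theorem hform_lift_neg (hA : Preserves A) {z : EuclideanSpace ℂ (Fin n)} (hz : z ∈ CH n) :
    (hform n (A.mulVec (lift z)) (A.mulVec (lift z))).re < 0 := by
  rw [hA]; exact ComplexHyperbolic.hform_lift_neg hz

theorem ne_zero (hA : Preserves A) {z : EuclideanSpace ℂ (Fin n)} (hz : z ∈ CH n) :
    A.mulVec (lift z) 0 ≠ 0 := ne_zero_of_hform_neg (hA.hform_lift_neg hz)

theorem act_mem (hA : Preserves A) {z : EuclideanSpace ℂ (Fin n)} (hz : z ∈ CH n) :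
    act A z ∈ CH n := pr_mem_CH (hA.hform_lift_neg hz)

theorem exists_inv (hA : Preserves A) : ∃ B : Mat n, Preserves B ∧ A * B = 1 ∧ B * A = 1 := by
  have hinj : Function.Injective A.mulVec := by
    intro x y hxy
    rw [← sub_eq_zero]
    refine hform_nondegenerate fun w => ?_
    rw [← hA, Matrix.mulVec_sub, hxy, sub_self, map_zero]
  have hu := Matrix.mulVec_injective_iff_isUnit.1 hinj
  obtain ⟨u, rfl⟩ := hu
  refine ⟨((u⁻¹ : (Mat n)ˣ) : Mat n), fun x y => ?_, u.mul_inv, u.inv_mul⟩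
  rw [← hA, Matrix.mulVec_mulVec, Matrix.mulVec_mulVec, u.mul_inv, Matrix.one_mulVec,
    Matrix.one_mulVec]

theorem act_mul (hB : Preserves B) {z : EuclideanSpace ℂ (Fin n)}
    (hz : z ∈ CH n) : act (A * B) z = act A (act B z) := by
  rw [act_eq, act_eq, act_eq, lift_pr (hB.ne_zero hz), Matrix.mulVec_smul,
    pr_smul (inv_ne_zero (hB.ne_zero hz)), Matrix.mulVec_mulVec]

theorem act_pr {Z : Fin (n + 1) → ℂ} (hZ : (hform n Z Z).re < 0) :
    act A (pr Z) = pr (A.mulVec Z) := by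
  rw [act_eq, lift_pr (ne_zero_of_hform_neg hZ), Matrix.mulVec_smul,
    pr_smul (inv_ne_zero (ne_zero_of_hform_neg hZ))]

theorem hasFDerivAt_act (hA : Preserves A) {z : EuclideanSpace ℂ (Fin n)} (hz : z ∈ CH n) :
    HasFDerivAt (act A) ((((A.mulVec (lift z) 0)⁻¹ • proj (act A z) ∘ₗ A.mulVecLin ∘ₗ
      incl).toContinuousLinearMap).restrictScalars ℝ) z := by
  have h1 : HasFDerivAt (fun z : EuclideanSpace ℂ (Fin n) => A.mulVec (lift z))
      (((A.mulVecLin ∘ₗ incl).toContinuousLinearMap).restrictScalars ℝ) z := by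
    have h2 : (fun z : EuclideanSpace ℂ (Fin n) => A.mulVec (lift z)) =
        fun z => (((A.mulVecLin ∘ₗ incl).toContinuousLinearMap).restrictScalars ℝ) z
          + A.mulVec (lift 0) := by
      funext z
      have : lift z = incl z + lift 0 := by
        ext i; refine Fin.cases ?_ (fun i => ?_) i <;> simp
      rw [this, Matrix.mulVec_add]
      rfl
    rw [h2]
    exact (ContinuousLinearMap.hasFDerivAt _).add_const _
  exact (hasFDerivAt_pr (hA.ne_zero hz)).comp z h1

theorem fderiv_act (hA : Preserves A) {z : EuclideanSpace ℂ (Fin n)} (hz : z ∈ CH n)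
    (u : EuclideanSpace ℂ (Fin n)) :
    fderiv ℝ (act A) z u = proj (act A z) ((A.mulVec (lift z) 0)⁻¹ • A.mulVec (incl u)) := by
  rw [(hA.hasFDerivAt_act hz).fderiv, map_smul]
  simp

theorem act_mem_isometries (hA : Preserves A) : act A ∈ isometries (metric n) (CH n) := by
  obtain ⟨B, hB, hAB, hBA⟩ := hA.exists_inv
  have hone : ∀ z : EuclideanSpace ℂ (Fin n), act (1 : Mat n) z = z := fun z => by
    rw [act_eq, Matrix.one_mulVec, pr_lift]
  refine ⟨⟨fun z hz => hA.act_mem hz, ?_, ?_⟩, ?_, ?_⟩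
  · intro z hz w hw h
    rw [← hone z, ← hone w, ← hBA, hA.act_mul hz, hA.act_mul hw, h]
  · intro z hz
    exact ⟨act B z, hB.act_mem hz, by rw [← hB.act_mul hz, hAB, hone]⟩
  · intro z hz
    refine ContDiffAt.contDiffWithinAt ?_
    have h1 : ContDiff ℝ ∞ (fun z : EuclideanSpace ℂ (Fin n) => A.mulVec (lift z)) := by
      have h2 : (fun z : EuclideanSpace ℂ (Fin n) => A.mulVec (lift z)) =
          fun z => (((A.mulVecLin ∘ₗ incl).toContinuousLinearMap).restrictScalars ℝ) z
            + A.mulVec (lift 0) := by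
        funext z
        have : lift z = incl z + lift 0 := by
          ext i; refine Fin.cases ?_ (fun i => ?_) i <;> simp
        rw [this, Matrix.mulVec_add]
        rfl
      rw [h2]
      exact (ContinuousLinearMap.contDiff _).add contDiff_const
    exact ContDiffAt.comp (g := pr) z (contDiffAt_pr (hA.ne_zero hz)) h1.contDiffAt
  · intro z hz u v
    have hne := hA.ne_zero hz
    have hcz := hA.act_mem hz
    have h0 := hform_self_pr hne
    rw [hA, hform_lift_self, Complex.ofReal_re, ← act_eq] at h0
    rw [hA.fderiv_act hz, hA.fderiv_act hz, metric_proj hcz, act_eq, lift_pr hne, ← act_eq]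
    conv_rhs => rw [← proj_incl z u, ← proj_incl z v, metric_proj hz]
    simp only [hform_smul_left, hform_smul_right, hA _ _]
    have hs := (mem_CH.1 hz).ne'
    have hs' := (mem_CH.1 hcz).ne'
    have hN := (Complex.normSq_pos.2 hne).ne'
    generalize A.mulVec (lift z) 0 = c at *
    have h1 : (1 - ‖z‖ ^ 2) = Complex.normSq c * (1 - ‖act A z‖ ^ 2) := by linarith
    have hcc : c⁻¹ * conj c⁻¹ = ((Complex.normSq c)⁻¹ : ℝ) := by
      rw [Complex.mul_conj, Complex.normSq_inv]
    have e1 : ∀ w, (c⁻¹ * (conj c⁻¹ * w)) = ((Complex.normSq c)⁻¹ : ℝ) * w := fun w => by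
      rw [← mul_assoc, hcc]
    have e2 : ∀ w w', c⁻¹ * (conj c⁻¹ * w) * (c⁻¹ * (conj c⁻¹ * w')) =
        (((Complex.normSq c)⁻¹ * (Complex.normSq c)⁻¹ : ℝ) : ℂ) * (w * w') := fun w w' => by
      rw [e1, e1]; push_cast; ring
    rw [e2, e1, Complex.re_ofReal_mul, Complex.re_ofReal_mul, h1]
    field_simp

end Preserves

/-! ### Moment functions -/

@[simp] theorem tail_lift (z : EuclideanSpace ℂ (Fin n)) : tail (lift z) = z := by
  ext i; simp

/-- The function `Re([x, Z] conj [y, Z]) / (-[Z, Z])` on the ball, with `Z = lift z`. It does not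
depend on the choice of the representative `Z` of the line of `z`, see `moment_pr`. -/
noncomputable def moment (x y : Fin (n + 1) → ℂ) (z : EuclideanSpace ℂ (Fin n)) : ℝ :=
  (hform n x (lift z) * conj (hform n y (lift z))).re / (1 - ‖z‖ ^ 2)

theorem moment_pr {Z : Fin (n + 1) → ℂ} (hZ : (hform n Z Z).re < 0) (x y : Fin (n + 1) → ℂ) :
    moment x y (pr Z) = (hform n x Z * conj (hform n y Z)).re / -(hform n Z Z).re := by
  have h0 := ne_zero_of_hform_neg hZ
  have hN := (Complex.normSq_pos.2 h0).ne'
  have hs := (mem_CH.1 (pr_mem_CH hZ)).ne'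
  rw [hform_self_pr h0, neg_neg, moment, lift_pr h0, hform_smul_right, hform_smul_right]
  have h1 : (Z 0)⁻¹ * hform n x Z * conj ((Z 0)⁻¹ * hform n y Z) =
      ((Complex.normSq (Z 0))⁻¹ : ℝ) * (hform n x Z * conj (hform n y Z)) := by
    rw [← Complex.normSq_inv, ← Complex.mul_conj, map_mul]
    ring
  rw [h1, Complex.re_ofReal_mul]
  field_simp

theorem contDiffAt_moment (x y : Fin (n + 1) → ℂ) {z : EuclideanSpace ℂ (Fin n)} (hz : z ∈ CH n) :
    ContDiffAt ℝ ∞ (moment x y) z := by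
  have h0 : ContDiff ℝ ∞ fun z : EuclideanSpace ℂ (Fin n) => 1 - ‖z‖ ^ 2 :=
    contDiff_const.sub contDiff_norm_sq'
  have h1 : ∀ x : Fin (n + 1) → ℂ, ContDiff ℝ ∞
      fun z : EuclideanSpace ℂ (Fin n) => hform n x (lift z) := fun x => by
    simp only [hform_lift]
    exact (contDiff_const.inner ℂ contDiff_id).sub contDiff_const
  have h2 : ContDiff ℝ ∞ fun z : EuclideanSpace ℂ (Fin n) =>
      (hform n x (lift z) * conj (hform n y (lift z))).re :=
    Complex.reCLM.contDiff.comp ((h1 x).mul (Complex.conjCLE.contDiff.comp (h1 y)))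
  exact h2.contDiffAt.div h0.contDiffAt (mem_CH.1 hz).ne'

theorem differentiableAt_moment (x y : Fin (n + 1) → ℂ) {z : EuclideanSpace ℂ (Fin n)}
    (hz : z ∈ CH n) : DifferentiableAt ℝ (moment x y) z :=
  (contDiffAt_moment x y hz).differentiableAt (by simp)

theorem fderiv_moment (x y : Fin (n + 1) → ℂ) {z : EuclideanSpace ℂ (Fin n)} (hz : z ∈ CH n)
    (u : EuclideanSpace ℂ (Fin n)) :
    fderiv ℝ (moment x y) z u =
      (hform n x (incl u) * conj (hform n y (lift z)) +
        hform n x (lift z) * conj (hform n y (incl u))).re / (1 - ‖z‖ ^ 2)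
      + 2 * (hform n x (lift z) * conj (hform n y (lift z))).re * (hform n (lift z) (incl u)).re
        / (1 - ‖z‖ ^ 2) ^ 2 := by
  have hs := (mem_CH.1 hz).ne'
  have h1 := (hasFDerivAt_hform x z).mul
    ((Complex.conjCLE : ℂ →L[ℝ] ℂ).hasFDerivAt.comp z (hasFDerivAt_hform y z))
  have h2 := Complex.reCLM.hasFDerivAt.comp z h1
  have h3 : HasFDerivAt (moment x y) _ z :=
    h2.mul ((hasDerivAt_inv hs).comp_hasFDerivAt z (hasFDerivAt_one_sub_norm_sq z))
  rw [h3.fderiv]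
  simp [hform_incl]
  field_simp
  ring

/-- The vector of `ℂ^{1,n}` that represents the gradient of a moment function. -/
noncomputable def momentVec (x y : Fin (n + 1) → ℂ) (z : EuclideanSpace ℂ (Fin n)) :
    Fin (n + 1) → ℂ :=
  hform n x (lift z) • y + hform n y (lift z) • x

theorem hform_momentVec_lift (x y : Fin (n + 1) → ℂ) {z : EuclideanSpace ℂ (Fin n)}
    (hz : z ∈ CH n) : hform n (momentVec x y z) (lift z) =
      ((2 * (1 - ‖z‖ ^ 2) * moment x y z : ℝ) : ℂ) := by
  have hs := (mem_CH.1 hz).ne'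
  rw [momentVec, hform_add_left, hform_smul_left, hform_smul_left, moment]
  apply Complex.ext
  · rw [Complex.ofReal_re]
    field_simp
    simp
    ring
  · rw [Complex.ofReal_im]
    simp
    ring

theorem gradient_moment (x y : Fin (n + 1) → ℂ) {z : EuclideanSpace ℂ (Fin n)} (hz : z ∈ CH n) :
    gradient (metric n) (moment x y) z = proj z ((1 / 4 : ℂ) • momentVec x y z) := by
  refine isRiemannian_metric.gradient_eq hz fun u => ?_
  have hs := (mem_CH.1 hz).ne'
  rw [fderiv_moment x y hz]
  conv_lhs => rw [← proj_incl z u]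
  rw [metric_proj hz, hform_smul_left, hform_smul_left, hform_momentVec_lift x y hz, moment,
    momentVec, hform_add_left, hform_smul_left, hform_smul_left]
  have h4 : conj (1 / 4 : ℂ) = ((1 / 4 : ℝ) : ℂ) := by
    rw [show (1 / 4 : ℂ) = ((1 / 4 : ℝ) : ℂ) by push_cast; ring, Complex.conj_ofReal]
  rw [h4, ← Complex.ofReal_mul, Complex.re_ofReal_mul, Complex.re_ofReal_mul]
  generalize 1 - ‖z‖ ^ 2 = s at *
  simp only [Complex.add_re, Complex.mul_re, Complex.conj_re, Complex.conj_im]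
  field_simp
  ring

/-- The inner product of the gradients of two moment functions. -/
theorem metric_gradient_moment (x y x' y' : Fin (n + 1) → ℂ) {z : EuclideanSpace ℂ (Fin n)}
    (hz : z ∈ CH n) :
    fderiv ℝ (moment x' y') z (gradient (metric n) (moment x y) z) =
      (hform n (momentVec x y z) (momentVec x' y' z)).re / (4 * (1 - ‖z‖ ^ 2))
        + moment x y z * moment x' y' z := by
  have hs := (mem_CH.1 hz).ne'
  rw [← isRiemannian_metric.gradient_apply hz, gradient_moment x' y' hz, gradient_moment x y hz,
    metric_proj hz, ← hform_conj (_ • momentVec x y z) (lift z)]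
  simp only [hform_smul_left, hform_smul_right, hform_momentVec_lift _ _ hz]
  have h4 : conj (1 / 4 : ℂ) = ((1 / 4 : ℝ) : ℂ) := by
    rw [show (1 / 4 : ℂ) = ((1 / 4 : ℝ) : ℂ) by push_cast; ring, Complex.conj_ofReal]
  rw [h4, show (1 / 4 : ℂ) = ((1 / 4 : ℝ) : ℂ) by push_cast; ring,
    ← hform_conj (momentVec x y z) (momentVec x' y' z)]
  simp only [Complex.conj_ofReal, ← Complex.ofReal_mul, Complex.re_ofReal_mul,
    Complex.ofReal_re, Complex.conj_re]
  generalize 1 - ‖z‖ ^ 2 = s at *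
  field_simp
  ring

/-- The real trace of a complex rank one map is twice the real part of its complex trace. -/
theorem trace_rankOne (a b : EuclideanSpace ℂ (Fin n)) :
    LinearMap.trace ℝ (EuclideanSpace ℂ (Fin n))
      ((((innerSL ℂ a).smulRight b).restrictScalars ℝ : EuclideanSpace ℂ (Fin n) →L[ℝ] _)) =
      2 * (inner ℂ a b).re := by
  have h : ((innerSL ℂ a).smulRight b).restrictScalars ℝ =
      (Complex.reCLM ∘L (innerSL ℂ a).restrictScalars ℝ).smulRight b +
      (Complex.imCLM ∘L (innerSL ℂ a).restrictScalars ℝ).smulRight (Complex.I • b) := by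
    ext u i
    simp
    conv_lhs => rw [← Complex.re_add_im (inner ℂ a u)]
    ring
  rw [h, ContinuousLinearMap.toLinearMap_add, map_add, trace_smulRight, trace_smulRight]
  simp
  ring

/-- The real trace of the multiplication by a complex number. -/
theorem trace_scalar (c : ℂ) :
    LinearMap.trace ℝ (EuclideanSpace ℂ (Fin n))
      ((c • ContinuousLinearMap.id ℂ (EuclideanSpace ℂ (Fin n))).restrictScalars ℝ :
        EuclideanSpace ℂ (Fin n) →L[ℝ] _) = 2 * n * c.re := by
  have h : (c • ContinuousLinearMap.id ℂ (EuclideanSpace ℂ (Fin n))).restrictScalars ℝ =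
      ∑ i, ((innerSL ℂ (EuclideanSpace.single i (1 : ℂ))).smulRight
        (EuclideanSpace.single i c)).restrictScalars ℝ := by
    ext u j
    simp [Finset.sum_apply, Pi.single_apply, EuclideanSpace.inner_single_left, mul_comm]
  rw [h]
  have h2 : (∑ i, ((innerSL ℂ (EuclideanSpace.single i (1 : ℂ))).smulRight
        (EuclideanSpace.single i c)).restrictScalars ℝ :
          EuclideanSpace ℂ (Fin n) →L[ℝ] EuclideanSpace ℂ (Fin n)).toLinearMap =
      ∑ i : Fin n, (((innerSL ℂ (EuclideanSpace.single i (1 : ℂ))).smulRight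
        (EuclideanSpace.single i c)).restrictScalars ℝ :
          EuclideanSpace ℂ (Fin n) →L[ℝ] EuclideanSpace ℂ (Fin n)).toLinearMap := by
    ext u
    simp
  rw [h2, map_sum, Finset.sum_congr rfl fun i _ => trace_rankOne _ _]
  simp only [EuclideanSpace.inner_single_left]
  simp
  ring

/-- The moment functions are eigenfunctions of the Laplacian, up to a constant. -/
theorem laplacian_moment (x y : Fin (n + 1) → ℂ) {z : EuclideanSpace ℂ (Fin n)} (hz : z ∈ CH n) :
    laplacian (metric n) (moment x y) z = (hform n x y).re + (n + 1) * moment x y z := by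
  have hs := (mem_CH.1 hz).ne'
  set V : EuclideanSpace ℂ (Fin n) := gradient (metric n) (moment x y) z with hV
  have hev : gradient (metric n) (moment x y) =ᶠ[𝓝 z]
      fun z => (1 / 4 : ℂ) • (hform n x (lift z) • (tail y - y 0 • z)
        + hform n y (lift z) • (tail x - x 0 • z)) := by
    filter_upwards [isOpen_CH.mem_nhds hz] with w hw
    rw [gradient_moment x y hw, momentVec]
    ext i
    simp
  have hd : ∀ y : Fin (n + 1) → ℂ, HasFDerivAt (fun z : EuclideanSpace ℂ (Fin n) => tail y - y 0 • z)
      (-(y 0 • ContinuousLinearMap.id ℂ (EuclideanSpace ℂ (Fin n))).restrictScalars ℝ) z :=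
    fun y => (ContinuousLinearMap.hasFDerivAt
      ((y 0 • ContinuousLinearMap.id ℂ (EuclideanSpace ℂ (Fin n))).restrictScalars ℝ)).const_sub _
  have h1 := (((hasFDerivAt_hform x z).smul (hd y)).add
    ((hasFDerivAt_hform y z).smul (hd x))).const_smul (1 / 4 : ℂ)
  -- the covariant derivative of the gradient is a sum of complex rank one maps and a complex
  -- scalar
  have hN : nabla (metric n) (gradient (metric n) (moment x y)) z =
      ((innerSL ℂ (tail x)).smulRight ((1 / 4 : ℂ) • proj z y)).restrictScalars ℝ +
      ((innerSL ℂ (tail y)).smulRight ((1 / 4 : ℂ) • proj z x)).restrictScalars ℝ +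
      ((innerSL ℂ z).smulRight (((1 - ‖z‖ ^ 2 : ℝ) : ℂ)⁻¹ • V)).restrictScalars ℝ +
      (((((1 - ‖z‖ ^ 2 : ℝ) : ℂ)⁻¹ * inner ℂ z V - (1 / 4 : ℂ) * (hform n x (lift z) * y 0 +
        hform n y (lift z) * x 0)) • ContinuousLinearMap.id ℂ
          (EuclideanSpace ℂ (Fin n))).restrictScalars ℝ) := by
    rw [nabla, hev.fderiv_eq]
    erw [h1.fderiv]
    ext u i
    simp only [add_apply, ← hV, christoffel_metric hz]
    simp
    ring
  rw [laplacian, hN]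
  simp only [ContinuousLinearMap.toLinearMap_add, map_add, trace_rankOne, trace_scalar,
    inner_smul_right]
  have e1 : ∀ x y : Fin (n + 1) → ℂ, inner ℂ (tail x) (proj z y) =
      hform n x y - y 0 * hform n x (lift z) := fun x y => by
    rw [← hform_incl, incl_proj, hform_sub_right, hform_smul_right]
  have e2 : inner ℂ z V = ((1 / 2 * (1 - ‖z‖ ^ 2) * moment x y z : ℝ) : ℂ)
      + (1 / 4 : ℂ) * (hform n x (lift z) * y 0 + hform n y (lift z) * x 0)
        * ((1 - ‖z‖ ^ 2 : ℝ) : ℂ) := by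
    rw [hV, gradient_moment x y hz, ← hform_lift_incl, incl_proj, hform_sub_right,
      hform_smul_right, hform_smul_right, hform_lift_self,
      ← hform_conj (momentVec x y z), hform_momentVec_lift x y hz, Complex.conj_ofReal]
    simp only [momentVec, Pi.smul_apply, Pi.add_apply, smul_eq_mul]
    push_cast
    ring
  have hs' : ((1 - ‖z‖ ^ 2 : ℝ) : ℂ) ≠ 0 := by exact_mod_cast hs
  have e3 : ((1 - ‖z‖ ^ 2 : ℝ) : ℂ)⁻¹ * inner ℂ z V = ((1 / 2 * moment x y z : ℝ) : ℂ)
      + (1 / 4 : ℂ) * (hform n x (lift z) * y 0 + hform n y (lift z) * x 0) := by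
    rw [e2]
    push_cast at hs' ⊢
    field_simp
  rw [e3, e1, e1, ← hform_conj x y]
  have h4 : (1 / 4 : ℂ) = ((1 / 4 : ℝ) : ℂ) := by push_cast; ring
  rw [h4]
  simp only [Complex.add_re, Complex.sub_re, Complex.ofReal_re, Complex.ofReal_im,
    Complex.conj_re, Complex.mul_re]
  ring

/-! ### The isoparametric function -/

/-- The orthogonal complement of a negative vector is positive definite. -/
theorem hform_pos_of_ortho {Z x : Fin (n + 1) → ℂ} (hZ : (hform n Z Z).re < 0)
    (h : hform n Z x = 0) (hx : x ≠ 0) : 0 < (hform n x x).re := by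
  have h0 := ne_zero_of_hform_neg hZ
  have hz := pr_mem_CH hZ
  have h1 : hform n (lift (pr Z)) x = 0 := by rw [lift_pr h0, hform_smul_left, h, mul_zero]
  generalize pr Z = z at *
  have h2 : x 0 = inner ℂ z (tail x) := by
    have := hform_lift x z
    rw [← hform_conj, h1, map_zero, ← inner_conj_symm] at this
    rw [← sub_eq_zero]
    have h3 := congrArg conj this
    simp only [map_sub, map_zero, Complex.conj_conj] at h3
    linear_combination h3
  have h3 : hform n x x = ((‖tail x‖ ^ 2 - ‖x 0‖ ^ 2 : ℝ) : ℂ) := by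
    have e1 : hform n x x = -(conj (x 0) * x 0) + inner ℂ (tail x) (tail x) := by
      simp only [hform_apply, PiLp.inner_apply, RCLike.inner_apply, tail_apply, mul_comm]
    rw [e1, inner_self_eq_norm_sq_to_K, mul_comm, Complex.mul_conj, Complex.normSq_eq_norm_sq]
    push_cast
    simp
    ring
  rw [h3, Complex.ofReal_re]
  have h4 : ‖x 0‖ ≤ ‖z‖ * ‖tail x‖ := by rw [h2]; exact norm_inner_le_norm _ _
  have hz1 : ‖z‖ < 1 := by simpa [CH] using hz
  have h5 : 0 < ‖tail x‖ := by
    rw [norm_pos_iff]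
    intro ht
    rw [ht, inner_zero_right] at h2
    refine hx (funext fun i => ?_)
    refine Fin.cases h2 (fun i => ?_) i
    exact congrArg (fun v => v.ofLp i) ht
  have h6 : ‖x 0‖ < ‖tail x‖ := h4.trans_lt (by nlinarith)
  nlinarith [norm_nonneg (x 0)]

/-- A nonzero null vector `ℓ` of `ℂ^{1,n}` and a real orthonormal family `ξ` orthogonal to it. -/
structure IsConfig {k : ℕ} (ℓ : Fin (n + 1) → ℂ) (ξ : Fin k → Fin (n + 1) → ℂ) : Prop where
  ne_zero : ℓ ≠ 0
  null : hform n ℓ ℓ = 0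
  ortho : ∀ j, hform n ℓ (ξ j) = 0
  orthonormal : ∀ i j, (hform n (ξ i) (ξ j)).re = if i = j then 1 else 0

/-- The isoparametric function `∑ G_j² / φ`, where `φ = moment ℓ ℓ` is the exponential of a
Busemann function at the point at infinity `ℓ`, and where `G_j = moment (ξ j) ℓ` is the height function
in the direction `ξ_j`. -/
noncomputable def isoFun {k : ℕ} (ℓ : Fin (n + 1) → ℂ) (ξ : Fin k → Fin (n + 1) → ℂ)
    (z : EuclideanSpace ℂ (Fin n)) : ℝ :=
  ∑ j, moment (ξ j) ℓ z ^ 2 / moment ℓ ℓ z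

namespace IsConfig

variable {k : ℕ} {ℓ : Fin (n + 1) → ℂ} {ξ : Fin k → Fin (n + 1) → ℂ}

theorem ortho' (h : IsConfig ℓ ξ) (j : Fin k) : hform n (ξ j) ℓ = 0 := by
  rw [← hform_conj, h.ortho, map_zero]

theorem hform_ne_zero (h : IsConfig ℓ ξ) {Z : Fin (n + 1) → ℂ} (hZ : (hform n Z Z).re < 0) :
    hform n ℓ Z ≠ 0 := by
  intro h0
  have := hform_pos_of_ortho hZ (by rw [← hform_conj, h0, map_zero]) h.ne_zero
  rw [h.null] at this
  simp at this

theorem moment_pos (h : IsConfig ℓ ξ) {z : EuclideanSpace ℂ (Fin n)} (hz : z ∈ CH n) :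
    0 < moment ℓ ℓ z := by
  have := Complex.normSq_pos.2 (h.hform_ne_zero (hform_lift_neg hz))
  rw [moment, Complex.mul_conj, Complex.ofReal_re]
  exact div_pos this (mem_CH.1 hz)

variable {z : EuclideanSpace ℂ (Fin n)}

theorem fderiv_busemann_gradient_busemann (h : IsConfig ℓ ξ) (hz : z ∈ CH n) :
    fderiv ℝ (moment ℓ ℓ) z (gradient (metric n) (moment ℓ ℓ) z) = moment ℓ ℓ z ^ 2 := by
  rw [metric_gradient_moment _ _ _ _ hz, momentVec]
  simp only [hform_add_left, hform_add_right, hform_smul_left, hform_smul_right, h.null]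
  simp
  ring

theorem fderiv_height_gradient_busemann (h : IsConfig ℓ ξ) (hz : z ∈ CH n) (j : Fin k) :
    fderiv ℝ (moment (ξ j) ℓ) z (gradient (metric n) (moment ℓ ℓ) z) =
      moment ℓ ℓ z * moment (ξ j) ℓ z := by
  rw [metric_gradient_moment _ _ _ _ hz, momentVec, momentVec]
  simp only [hform_add_left, hform_add_right, hform_smul_left, hform_smul_right, h.null, h.ortho]
  simp

theorem fderiv_busemann_gradient_height (h : IsConfig ℓ ξ) (hz : z ∈ CH n) (j : Fin k) :
    fderiv ℝ (moment ℓ ℓ) z (gradient (metric n) (moment (ξ j) ℓ) z) =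
      moment (ξ j) ℓ z * moment ℓ ℓ z := by
  rw [metric_gradient_moment _ _ _ _ hz, momentVec, momentVec]
  simp only [hform_add_left, hform_add_right, hform_smul_left, hform_smul_right, h.null, h.ortho']
  simp

theorem fderiv_height_gradient_height (h : IsConfig ℓ ξ) (hz : z ∈ CH n) (i j : Fin k) :
    fderiv ℝ (moment (ξ j) ℓ) z (gradient (metric n) (moment (ξ i) ℓ) z) =
      (if i = j then moment ℓ ℓ z / 4 else 0) + moment (ξ i) ℓ z * moment (ξ j) ℓ z := by
  have hs := (mem_CH.1 hz).ne'
  have hφ : moment ℓ ℓ z = Complex.normSq (hform n ℓ (lift z)) / (1 - ‖z‖ ^ 2) := by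
    rw [moment, Complex.mul_conj, Complex.ofReal_re]
  rw [metric_gradient_moment _ _ _ _ hz, momentVec, momentVec]
  simp only [hform_add_left, hform_add_right, hform_smul_left, hform_smul_right, h.null, h.ortho',
    h.ortho, mul_zero, zero_add]
  rw [← mul_assoc, mul_comm (hform n ℓ (lift z)), ← Complex.normSq_eq_conj_mul_self,
    Complex.re_ofReal_mul, h.orthonormal, hφ]
  split_ifs
  · field_simp
  · simp

theorem laplacian_busemann (h : IsConfig ℓ ξ) (hz : z ∈ CH n) :
    laplacian (metric n) (moment ℓ ℓ) z = (n + 1) * moment ℓ ℓ z := by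
  rw [laplacian_moment _ _ hz, h.null]; simp

theorem laplacian_height (h : IsConfig ℓ ξ) (hz : z ∈ CH n) (j : Fin k) :
    laplacian (metric n) (moment (ξ j) ℓ) z = (n + 1) * moment (ξ j) ℓ z := by
  rw [laplacian_moment _ _ hz, h.ortho']; simp

theorem contDiffAt_isoFun (h : IsConfig ℓ ξ) (hz : z ∈ CH n) :
    ContDiffAt ℝ ∞ (isoFun ℓ ξ) z := by
  unfold isoFun
  exact ContDiffAt.sum fun j _ => ((contDiffAt_moment _ _ hz).pow 2).div
    (contDiffAt_moment _ _ hz) (h.moment_pos hz).ne'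

theorem hasFDerivAt_isoFun (h : IsConfig ℓ ξ) (hz : z ∈ CH n) :
    HasFDerivAt (isoFun ℓ ξ) (∑ j, ((2 * moment (ξ j) ℓ z / moment ℓ ℓ z) •
      fderiv ℝ (moment (ξ j) ℓ) z + (-(moment (ξ j) ℓ z / moment ℓ ℓ z) ^ 2) •
      fderiv ℝ (moment ℓ ℓ) z)) z := by
  have h0 := (h.moment_pos hz).ne'
  have : isoFun ℓ ξ = fun z => ∑ j, moment (ξ j) ℓ z ^ 2 * (moment ℓ ℓ z)⁻¹ := by
    funext z; simp only [isoFun, div_eq_mul_inv]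
  rw [this]
  refine HasFDerivAt.fun_sum fun j _ => ?_
  refine (((differentiableAt_moment _ _ hz).hasFDerivAt.pow 2).mul
    ((hasDerivAt_inv h0).comp_hasFDerivAt z
      (differentiableAt_moment ℓ ℓ hz).hasFDerivAt)).congr_fderiv ?_
  ext u
  simp
  field_simp
  ring

theorem gradient_isoFun (h : IsConfig ℓ ξ) (hz : z ∈ CH n) :
    gradient (metric n) (isoFun ℓ ξ) z = ∑ j, ((2 * moment (ξ j) ℓ z / moment ℓ ℓ z) •
      gradient (metric n) (moment (ξ j) ℓ) z + (-(moment (ξ j) ℓ z / moment ℓ ℓ z) ^ 2) •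
      gradient (metric n) (moment ℓ ℓ) z) := by
  rw [gradient, (h.hasFDerivAt_isoFun hz).fderiv, map_sum]
  simp only [map_add, map_smul, gradient]

theorem sum_sq (h : IsConfig ℓ ξ) (hz : z ∈ CH n) :
    ∑ j, moment (ξ j) ℓ z ^ 2 = isoFun ℓ ξ z * moment ℓ ℓ z := by
  rw [isoFun, Finset.sum_mul]
  exact Finset.sum_congr rfl fun j _ => (div_mul_cancel₀ _ (h.moment_pos hz).ne').symm

theorem fderiv_height_gradient (h : IsConfig ℓ ξ) (hz : z ∈ CH n) (j : Fin k) :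
    fderiv ℝ (moment (ξ j) ℓ) z (gradient (metric n) (isoFun ℓ ξ) z) =
      moment (ξ j) ℓ z * (1 / 2 + isoFun ℓ ξ z) := by
  have h0 := (h.moment_pos hz).ne'
  have e1 : ∀ i, 2 * moment (ξ i) ℓ z / moment ℓ ℓ z * ((if i = j then moment ℓ ℓ z / 4 else 0)
      + moment (ξ i) ℓ z * moment (ξ j) ℓ z) + -(moment (ξ i) ℓ z / moment ℓ ℓ z) ^ 2 *
      (moment ℓ ℓ z * moment (ξ j) ℓ z) = (if i = j then moment (ξ j) ℓ z / 2 else 0)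
        + moment (ξ i) ℓ z ^ 2 / moment ℓ ℓ z * moment (ξ j) ℓ z := by
    intro i
    split_ifs with hij
    · subst hij; field_simp; ring
    · field_simp; ring
  rw [h.gradient_isoFun hz, map_sum]
  simp only [map_add, map_smul, h.fderiv_height_gradient_height hz,
    h.fderiv_height_gradient_busemann hz, smul_eq_mul, e1, Finset.sum_add_distrib,
    ← Finset.sum_mul, Finset.sum_ite_eq', Finset.mem_univ, if_true]
  rw [← isoFun]
  ring

theorem fderiv_busemann_gradient (h : IsConfig ℓ ξ) (hz : z ∈ CH n) :
    fderiv ℝ (moment ℓ ℓ) z (gradient (metric n) (isoFun ℓ ξ) z) =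
      isoFun ℓ ξ z * moment ℓ ℓ z := by
  have h0 := (h.moment_pos hz).ne'
  have e1 : ∀ i, 2 * moment (ξ i) ℓ z / moment ℓ ℓ z * (moment (ξ i) ℓ z * moment ℓ ℓ z)
      + -(moment (ξ i) ℓ z / moment ℓ ℓ z) ^ 2 * moment ℓ ℓ z ^ 2 =
        moment (ξ i) ℓ z ^ 2 := by
    intro i
    field_simp; ring
  rw [h.gradient_isoFun hz, map_sum]
  simp only [map_add, map_smul, h.fderiv_busemann_gradient_height hz,
    h.fderiv_busemann_gradient_busemann hz, smul_eq_mul, e1, h.sum_sq hz]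

/-- The function `F` satisfies `|∇F|² = F (1 + F)`. -/
theorem metric_gradient_isoFun (h : IsConfig ℓ ξ) (hz : z ∈ CH n) :
    metric n z (gradient (metric n) (isoFun ℓ ξ) z) (gradient (metric n) (isoFun ℓ ξ) z) =
      isoFun ℓ ξ z * (1 + isoFun ℓ ξ z) := by
  have h0 := (h.moment_pos hz).ne'
  rw [isRiemannian_metric.gradient_apply hz, (h.hasFDerivAt_isoFun hz).fderiv]
  simp only [sum_apply, add_apply, smul_apply, h.fderiv_height_gradient hz,
    h.fderiv_busemann_gradient hz, smul_eq_mul]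
  have e1 : ∀ i, 2 * moment (ξ i) ℓ z / moment ℓ ℓ z * (moment (ξ i) ℓ z *
      (1 / 2 + isoFun ℓ ξ z)) + -(moment (ξ i) ℓ z / moment ℓ ℓ z) ^ 2 *
      (isoFun ℓ ξ z * moment ℓ ℓ z) =
        moment (ξ i) ℓ z ^ 2 / moment ℓ ℓ z * (1 + isoFun ℓ ξ z) := by
    intro i
    field_simp; ring
  simp only [e1, ← Finset.sum_mul]
  rw [← isoFun]

/-- The Laplacian of `F` is an affine function of `F`. -/
theorem laplacian_isoFun (h : IsConfig ℓ ξ) (hz : z ∈ CH n) :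
    laplacian (metric n) (isoFun ℓ ξ) z = k / 2 + (n + 1) * isoFun ℓ ξ z := by
  have h0 := (h.moment_pos hz).ne'
  have hG : ∀ x y : Fin (n + 1) → ℂ,
      DifferentiableAt ℝ (gradient (metric n) (moment x y)) z := fun x y =>
    (isRiemannian_metric.contDiffAt_gradient hz (contDiffAt_moment x y hz)).differentiableAt
      (by simp)
  have hc : ∀ j, HasFDerivAt (fun z => 2 * moment (ξ j) ℓ z / moment ℓ ℓ z)
      ((2 / moment ℓ ℓ z) • fderiv ℝ (moment (ξ j) ℓ) z -
        (2 * moment (ξ j) ℓ z / moment ℓ ℓ z ^ 2) • fderiv ℝ (moment ℓ ℓ) z) z := by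
    intro j
    simp only [div_eq_mul_inv]
    refine (((differentiableAt_moment _ _ hz).hasFDerivAt.const_mul 2).mul
      ((hasDerivAt_inv h0).comp_hasFDerivAt z
        (differentiableAt_moment ℓ ℓ hz).hasFDerivAt)).congr_fderiv ?_
    ext u
    simp
    field_simp
    ring
  have hd : ∀ j, HasFDerivAt (fun z => -(moment (ξ j) ℓ z / moment ℓ ℓ z) ^ 2)
      ((-2 * moment (ξ j) ℓ z / moment ℓ ℓ z ^ 2) • fderiv ℝ (moment (ξ j) ℓ) z +
        (2 * moment (ξ j) ℓ z ^ 2 / moment ℓ ℓ z ^ 3) • fderiv ℝ (moment ℓ ℓ) z) z := by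
    intro j
    simp only [div_eq_mul_inv]
    refine ((((differentiableAt_moment _ _ hz).hasFDerivAt).mul
      ((hasDerivAt_inv h0).comp_hasFDerivAt z
        (differentiableAt_moment ℓ ℓ hz).hasFDerivAt)).pow 2).neg.congr_fderiv ?_
    ext u
    simp
    field_simp
  have hcG : ∀ j, DifferentiableAt ℝ (fun z => (2 * moment (ξ j) ℓ z / moment ℓ ℓ z) •
      gradient (metric n) (moment (ξ j) ℓ) z) z := fun j =>
    (hc j).differentiableAt.smul (hG _ _)
  have hdG : ∀ j, DifferentiableAt ℝ (fun z => (-(moment (ξ j) ℓ z / moment ℓ ℓ z) ^ 2) •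
      gradient (metric n) (moment ℓ ℓ) z) z := fun j =>
    (hd j).differentiableAt.smul (hG _ _)
  have hev : gradient (metric n) (isoFun ℓ ξ) =ᶠ[𝓝 z] fun z =>
      ∑ j, ((2 * moment (ξ j) ℓ z / moment ℓ ℓ z) • gradient (metric n) (moment (ξ j) ℓ) z +
        (-(moment (ξ j) ℓ z / moment ℓ ℓ z) ^ 2) • gradient (metric n) (moment ℓ ℓ) z) := by
    filter_upwards [isOpen_CH.mem_nhds hz] with w hw using h.gradient_isoFun hw
  have hN : nabla (metric n) (gradient (metric n) (isoFun ℓ ξ)) z = ∑ j,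
      (nabla (metric n) (fun z => (2 * moment (ξ j) ℓ z / moment ℓ ℓ z) •
        gradient (metric n) (moment (ξ j) ℓ) z) z +
      nabla (metric n) (fun z => (-(moment (ξ j) ℓ z / moment ℓ ℓ z) ^ 2) •
        gradient (metric n) (moment ℓ ℓ) z) z) := by
    let Γ : EuclideanSpace ℂ (Fin n) →+ (EuclideanSpace ℂ (Fin n) →L[ℝ] EuclideanSpace ℂ (Fin n)) :=
      AddMonoidHom.mk' (christoffel (metric n) z) (christoffel_add (metric n) z)
    have hΓ : ∀ v, christoffel (metric n) z v = Γ v := fun v => rfl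
    simp only [nabla]
    rw [hev.fderiv_eq, hev.eq_of_nhds, fderiv_fun_sum fun j _ => (hcG j).fun_add (hdG j)]
    simp only [hΓ, map_sum, map_add, ← Finset.sum_add_distrib]
    refine Finset.sum_congr rfl fun j _ => ?_
    rw [fderiv_fun_add (hcG j) (hdG j)]
    abel
  have hsum : (∑ j,
      (nabla (metric n) (fun z => (2 * moment (ξ j) ℓ z / moment ℓ ℓ z) •
        gradient (metric n) (moment (ξ j) ℓ) z) z +
      nabla (metric n) (fun z => (-(moment (ξ j) ℓ z / moment ℓ ℓ z) ^ 2) •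
        gradient (metric n) (moment ℓ ℓ) z) z)).toLinearMap = ∑ j,
      ((nabla (metric n) (fun z => (2 * moment (ξ j) ℓ z / moment ℓ ℓ z) •
        gradient (metric n) (moment (ξ j) ℓ) z) z).toLinearMap +
      (nabla (metric n) (fun z => (-(moment (ξ j) ℓ z / moment ℓ ℓ z) ^ 2) •
        gradient (metric n) (moment ℓ ℓ) z) z).toLinearMap) := by
    ext u
    simp
  rw [laplacian, hN, hsum, map_sum]
  have e1 : ∀ j, LinearMap.trace ℝ _
      ((nabla (metric n) (fun z => (2 * moment (ξ j) ℓ z / moment ℓ ℓ z) •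
        gradient (metric n) (moment (ξ j) ℓ) z) z).toLinearMap +
      (nabla (metric n) (fun z => (-(moment (ξ j) ℓ z / moment ℓ ℓ z) ^ 2) •
        gradient (metric n) (moment ℓ ℓ) z) z).toLinearMap) =
      1 / 2 + (n + 1) * (moment (ξ j) ℓ z ^ 2 / moment ℓ ℓ z) := by
    intro j
    rw [map_add, trace_nabla_smul (hc j).differentiableAt (hG _ _),
      trace_nabla_smul (hd j).differentiableAt (hG _ _), (hc j).fderiv, (hd j).fderiv,
      ← laplacian, ← laplacian, h.laplacian_busemann hz, h.laplacian_height hz]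
    simp only [sub_apply, add_apply, smul_apply, h.fderiv_height_gradient_height hz,
      h.fderiv_height_gradient_busemann hz, h.fderiv_busemann_gradient_height hz,
      h.fderiv_busemann_gradient_busemann hz, smul_eq_mul, if_true]
    field_simp
    ring
  simp only [e1, Finset.sum_add_distrib, ← Finset.mul_sum]
  rw [← isoFun]
  simp
  ring

end IsConfig

/-! ### The focal submanifold and its tubes -/

/-- The focal submanifold: the zero set of the isoparametric function. -/
def focalSet {k : ℕ} (ℓ : Fin (n + 1) → ℂ) (ξ : Fin k → Fin (n + 1) → ℂ) :
    Set (EuclideanSpace ℂ (Fin n)) :=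
  {z | z ∈ CH n ∧ ∀ j, moment (ξ j) ℓ z = 0}

namespace IsConfig

variable {k : ℕ} {ℓ : Fin (n + 1) → ℂ} {ξ : Fin k → Fin (n + 1) → ℂ}
  {p : EuclideanSpace ℂ (Fin n)}

theorem re_eq_zero (hp : p ∈ focalSet ℓ ξ) (j : Fin k) :
    (hform n (ξ j) (lift p) * conj (hform n ℓ (lift p))).re = 0 := by
  have := hp.2 j
  rw [moment] at this
  exact (div_eq_zero_iff.1 this).resolve_right (mem_CH.1 hp.1).ne'

/-- The common kernel of the differentials of the height functions is tangent to the focal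
submanifold. If the representative `P` of `p` satisfies `[ℓ, P] = 1`, then the equations of the
focal submanifold are the real linear equations `Re [ξ_j, P] = 0`, so that a tangent vector is
realized by an affine line `P + t V`. -/
theorem mem_tangent_focalSet (h : IsConfig ℓ ξ) (hp : p ∈ focalSet ℓ ξ)
    {v : EuclideanSpace ℂ (Fin n)} (hv : ∀ j, fderiv ℝ (moment (ξ j) ℓ) p v = 0) :
    v ∈ tangentSubspace (focalSet ℓ ξ) p := by
  have hL := h.hform_ne_zero (hform_lift_neg hp.1)
  have hs := (mem_CH.1 hp.1).ne'
  have h2 : ∀ j, (hform n (ξ j) (incl v) * conj (hform n ℓ (lift p)) +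
        hform n (ξ j) (lift p) * conj (hform n ℓ (incl v))).re = 0 := by
    intro j
    have := hv j
    rw [fderiv_moment _ _ hp.1, re_eq_zero hp j] at this
    simp only [mul_zero, zero_mul, zero_div, add_zero] at this
    exact (div_eq_zero_iff.1 this).resolve_right hs
  have h1 := re_eq_zero hp
  set L := hform n ℓ (lift p) with hLdef
  let P : Fin (n + 1) → ℂ := L⁻¹ • lift p
  let V : Fin (n + 1) → ℂ := L⁻¹ • (incl v - (hform n ℓ (incl v) * L⁻¹) • lift p)
  have hP0 : P 0 = L⁻¹ := by simp [P]
  have hprP : pr P = p := by simp only [P]; rw [pr_smul (inv_ne_zero hL), pr_lift]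
  have hℓP : hform n ℓ P = 1 := by
    simp only [P, hform_smul_right, ← hLdef, inv_mul_cancel₀ hL]
  have hℓV : hform n ℓ V = 0 := by
    simp only [V, hform_smul_right, hform_sub_right, ← hLdef]
    field_simp
    ring
  have hw : ∀ j, (hform n (ξ j) (lift p) * L⁻¹).re = 0 := by
    intro j
    rw [Complex.inv_def, ← mul_assoc, Complex.mul_re, h1 j, Complex.ofReal_im]
    ring
  have hξP : ∀ j, (hform n (ξ j) P).re = 0 := by
    intro j
    simp only [P, hform_smul_right]
    rw [mul_comm, hw]
  have hξV : ∀ j, (hform n (ξ j) V).re = 0 := by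
    intro j
    have e1 : hform n (ξ j) (lift p) = hform n (ξ j) (lift p) * L⁻¹ * L := by field_simp
    have e2 := h2 j
    have e3 := hw j
    rw [e1] at e2
    simp only [V, hform_smul_right, hform_sub_right]
    generalize hform n (ξ j) (lift p) * L⁻¹ = w at *
    have e4 : L⁻¹ * (hform n (ξ j) (incl v) - hform n ℓ (incl v) * L⁻¹ * hform n (ξ j) (lift p)) =
        ((Complex.normSq L)⁻¹ : ℝ) *
          (conj L * hform n (ξ j) (incl v) - conj L * hform n ℓ (incl v) * w) := by
      have e5 : L⁻¹ * (hform n (ξ j) (incl v) - hform n ℓ (incl v) * L⁻¹ * (w * L)) =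
          L⁻¹ * (hform n (ξ j) (incl v) - hform n ℓ (incl v) * w) := by
        field_simp
      rw [e1, e5, Complex.inv_def]
      ring
    rw [e4, Complex.re_ofReal_mul]
    simp only [Complex.add_re, Complex.sub_re, Complex.mul_re, Complex.mul_im, Complex.conj_re,
      Complex.conj_im, e3] at e2 ⊢
    refine mul_eq_zero_of_right _ ?_
    linarith
  have hneg : (hform n P P).re < 0 := by
    simp only [P, hform_smul_left, hform_smul_right, hform_lift_self]
    rw [← mul_assoc, Complex.mul_conj, Complex.re_ofReal_mul, Complex.ofReal_re]
    have := Complex.normSq_pos.2 (inv_ne_zero hL)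
    have := mem_CH.1 hp.1
    nlinarith
  have hline : ∀ t, HasDerivAt (fun t : ℝ => P + (t : ℂ) • V) V t := fun t => by
    have := ((Complex.ofRealCLM.hasDerivAt (x := t)).smul_const V).const_add P
    simpa using this
  have hsm : ContDiff ℝ ∞ (fun t : ℝ => P + (t : ℂ) • V) :=
    contDiff_const.add (Complex.ofRealCLM.contDiff.smul contDiff_const)
  have h00 : P + ((0 : ℝ) : ℂ) • V = P := by simp
  have hPne : P 0 ≠ 0 := ne_zero_of_hform_neg hneg
  refine Submodule.subset_span ⟨fun t => pr (P + (t : ℂ) • V), ?_, ?_, ?_, ?_⟩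
  · refine ContDiffAt.comp (g := pr) 0 (contDiffAt_pr ?_) hsm.contDiffAt
    rwa [h00]
  · have hcont : ContinuousAt (fun t : ℝ => (hform n (P + (t : ℂ) • V) (P + (t : ℂ) • V)).re) 0 := by
      simp only [hform_add_left, hform_add_right, hform_smul_left, hform_smul_right,
        Complex.conj_ofReal]
      fun_prop
    have hev := hcont.eventually_lt_const (u := 0)
      (by simp only [h00]; exact hneg)
    filter_upwards [hev] with t ht
    refine ⟨pr_mem_CH ht, fun j => ?_⟩
    rw [moment_pr ht]
    simp only [hform_add_right, hform_smul_right, hℓP, hℓV, mul_zero, add_zero, map_one, mul_one,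
      Complex.add_re, Complex.re_ofReal_mul, hξP, hξV, zero_div]
  · simp only [h00, hprP]
  · have h3 : HasFDerivAt pr _ (P + ((0 : ℝ) : ℂ) • V) := hasFDerivAt_pr (by rwa [h00])
    have h4 := (h3.comp_hasDerivAt 0 (hline 0)).deriv
    refine Eq.trans h4 ?_
    rw [h00, hprP, hP0]
    simp only [V]
    simp [hL]

theorem fderiv_eq_zero_of_mem_tangent (hp : p ∈ focalSet ℓ ξ)
    {v : EuclideanSpace ℂ (Fin n)} (hv : v ∈ tangentSubspace (focalSet ℓ ξ) p) (j : Fin k) :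
    fderiv ℝ (moment (ξ j) ℓ) p v = 0 :=
  tangentSubspace_le (differentiableAt_moment _ _ hp.1) (c := 0)
    (Filter.Eventually.of_forall fun _ hq => hq.2 j) hv

/-- At the focal submanifold, the gradients of the height functions are orthogonal to each other
and have the same length. -/
theorem fderiv_height_normal (h : IsConfig ℓ ξ) (hp : p ∈ focalSet ℓ ξ) (c : Fin k → ℝ)
    (i : Fin k) : fderiv ℝ (moment (ξ i) ℓ) p
      (∑ j, c j • gradient (metric n) (moment (ξ j) ℓ) p) = c i * (moment ℓ ℓ p / 4) := by
  rw [map_sum]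
  simp [h.fderiv_height_gradient_height hp.1, hp.2]

theorem metric_normal (h : IsConfig ℓ ξ) (hp : p ∈ focalSet ℓ ξ) (c : Fin k → ℝ) :
    metric n p (∑ j, c j • gradient (metric n) (moment (ξ j) ℓ) p)
      (∑ j, c j • gradient (metric n) (moment (ξ j) ℓ) p) =
        (∑ j, c j ^ 2) * (moment ℓ ℓ p / 4) := by
  conv_lhs => enter [1]; rw [map_sum]
  rw [sum_apply, Finset.sum_mul]
  refine Finset.sum_congr rfl fun j _ => ?_
  rw [map_smul, smul_apply, isRiemannian_metric.gradient_apply hp.1, h.fderiv_height_normal hp,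
    smul_eq_mul]
  ring

/-- The unit normal vectors of the focal submanifold. -/
theorem isUnitNormal_iff (h : IsConfig ℓ ξ) (hp : p ∈ focalSet ℓ ξ)
    {η : EuclideanSpace ℂ (Fin n)} :
    IsUnitNormal (metric n) (focalSet ℓ ξ) p η ↔ ∃ c : Fin k → ℝ,
      (∑ j, c j ^ 2) * (moment ℓ ℓ p / 4) = 1 ∧
        η = ∑ j, c j • gradient (metric n) (moment (ξ j) ℓ) p := by
  constructor
  · rintro ⟨h1, h2⟩
    have hφ := (h.moment_pos hp.1).ne'
    let c : Fin k → ℝ := fun j => fderiv ℝ (moment (ξ j) ℓ) p η / (moment ℓ ℓ p / 4)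
    let ν := ∑ j, c j • gradient (metric n) (moment (ξ j) ℓ) p
    have hd : ∀ j, fderiv ℝ (moment (ξ j) ℓ) p (η - ν) = 0 := by
      intro j
      rw [map_sub, h.fderiv_height_normal hp]
      simp only [c]
      field_simp
      ring
    have h3 := h2 _ (h.mem_tangent_focalSet hp hd)
    have h4 : metric n p ν (η - ν) = 0 := by
      simp only [ν]
      rw [map_sum, sum_apply]
      refine Finset.sum_eq_zero fun j _ => ?_
      rw [map_smul, smul_apply, isRiemannian_metric.gradient_apply hp.1]
      exact mul_eq_zero_of_right _ (hd j)
    have h5 : η - ν = 0 := by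
      by_contra hne
      have := isRiemannian_metric.pos p hp.1 _ hne
      rw [(metric n p).map_sub, sub_apply, h3, h4, sub_zero] at this
      exact lt_irrefl _ this
    have h6 : η = ν := sub_eq_zero.1 h5
    refine ⟨c, ?_, h6⟩
    rw [← h.metric_normal hp, ← h1, h6]
  · rintro ⟨c, hc, rfl⟩
    refine ⟨by rw [h.metric_normal hp, hc], fun v hv => ?_⟩
    rw [map_sum, sum_apply]
    refine Finset.sum_eq_zero fun j _ => ?_
    rw [map_smul, smul_apply, isRiemannian_metric.gradient_apply hp.1,
      fderiv_eq_zero_of_mem_tangent hp hv, smul_zero]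

/-- The frame that describes the normal geodesic of the focal submanifold at `p` with the initial
velocity `∑ c_j ∇G_j`. -/
theorem exists_normal_frame (h : IsConfig ℓ ξ) (hp : p ∈ focalSet ℓ ξ) {c : Fin k → ℝ}
    (hc : (∑ j, c j ^ 2) * (moment ℓ ℓ p / 4) = 1) :
    ∃ (q : ℝ) (V : Fin (n + 1) → ℂ), 0 < q ∧ q ^ 2 = 1 - ‖p‖ ^ 2 ∧
      V = ((2 * q : ℝ) : ℂ)⁻¹ • ∑ j, (c j : ℂ) • momentVec (ξ j) ℓ p ∧
      IsFrame ((q : ℂ)⁻¹ • lift p) V ∧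
      ∑ j, c j • gradient (metric n) (moment (ξ j) ℓ) p =
        (2 * ((q : ℂ)⁻¹ • lift p) 0)⁻¹ • proj (pr ((q : ℂ)⁻¹ • lift p)) V := by
  have hs := mem_CH.1 hp.1
  have hm := h.metric_normal hp c
  have hgrad : ∑ j, c j • gradient (metric n) (moment (ξ j) ℓ) p =
      proj p ((1 / 4 : ℂ) • ∑ j, (c j : ℂ) • momentVec (ξ j) ℓ p) := by
    rw [map_smul, map_sum, Finset.smul_sum]
    refine Finset.sum_congr rfl fun j _ => ?_
    rw [gradient_moment _ _ hp.1, map_smul, map_smul, smul_comm, Complex.coe_smul]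
  set Q : Fin (n + 1) → ℂ := ∑ j, (c j : ℂ) • momentVec (ξ j) ℓ p with hQ
  have hQL : hform n Q (lift p) = 0 := by
    rw [hQ, hform_sum_left]
    refine Finset.sum_eq_zero fun j _ => ?_
    rw [hform_smul_left, hform_momentVec_lift _ _ hp.1, hp.2]
    simp
  have hLQ : hform n (lift p) Q = 0 := by rw [← hform_conj, hQL, map_zero]
  rw [hgrad, metric_proj hp.1, hc] at hm
  simp only [hform_smul_left, hform_smul_right, hLQ, mul_zero, Complex.zero_re, zero_div,
    add_zero] at hm
  have h4 : conj (1 / 4 : ℂ) = ((1 / 4 : ℝ) : ℂ) := by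
    rw [show (1 / 4 : ℂ) = ((1 / 4 : ℝ) : ℂ) by push_cast; ring, Complex.conj_ofReal]
  rw [h4, show (1 / 4 : ℂ) = ((1 / 4 : ℝ) : ℂ) by push_cast; ring, Complex.re_ofReal_mul,
    Complex.re_ofReal_mul] at hm
  have hLL := hform_lift_self p
  rw [hgrad]
  generalize 1 - ‖p‖ ^ 2 = s at *
  obtain ⟨q, hq, rfl⟩ : ∃ q : ℝ, 0 < q ∧ q ^ 2 = s := ⟨√s, Real.sqrt_pos.2 hs, Real.sq_sqrt hs.le⟩
  have hq' : (q : ℂ) ≠ 0 := by exact_mod_cast hq.ne'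
  have hQQ : hform n Q Q = ((4 * q ^ 2 : ℝ) : ℂ) := by
    apply Complex.ext
    · rw [Complex.ofReal_re]
      field_simp at hm
      linarith
    · rw [Complex.ofReal_im, hform_self_im]
  refine ⟨q, _, hq, rfl, rfl, ⟨?_, ?_, ?_⟩, ?_⟩
  · simp only [hform_smul_left, hform_smul_right, hLL, map_inv₀, Complex.conj_ofReal]
    push_cast
    field_simp
  · simp only [hform_smul_left, hform_smul_right, hLQ, mul_zero]
  · simp only [hform_smul_left, hform_smul_right, hQQ, map_inv₀, Complex.conj_ofReal]
    push_cast
    field_simp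
    norm_num
  · rw [pr_smul (inv_ne_zero hq'), pr_lift]
    simp only [map_smul, smul_smul, Pi.smul_apply, lift_zero, smul_eq_mul, mul_one]
    congr 1
    push_cast
    field_simp
    norm_num

/-- The exponential of the Busemann function and the height functions along a normal geodesic. -/
theorem moment_normal_frame (h : IsConfig ℓ ξ) (hp : p ∈ focalSet ℓ ξ) {c : Fin k → ℝ} {q : ℝ}
    (hq : 0 < q) (hqs : q ^ 2 = 1 - ‖p‖ ^ 2) {V : Fin (n + 1) → ℂ}
    (hV : V = ((2 * q : ℝ) : ℂ)⁻¹ • ∑ j, (c j : ℂ) • momentVec (ξ j) ℓ p)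
    (hF : IsFrame ((q : ℂ)⁻¹ • lift p) V) (t : ℝ) :
    moment ℓ ℓ (pr (hyp ((q : ℂ)⁻¹ • lift p) V t)) = Real.cosh (t / 2) ^ 2 * moment ℓ ℓ p ∧
    ∀ i, moment (ξ i) ℓ (pr (hyp ((q : ℂ)⁻¹ • lift p) V t)) =
      Real.sinh (t / 2) * Real.cosh (t / 2) * (c i / 2) * moment ℓ ℓ p := by
  have hφ : moment ℓ ℓ p = Complex.normSq (hform n ℓ (lift p)) / q ^ 2 := by
    rw [moment, Complex.mul_conj, Complex.ofReal_re, hqs]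
  have hq' : (q : ℂ) ≠ 0 := by exact_mod_cast hq.ne'
  have hℓV : hform n ℓ V = 0 := by
    rw [hV, hform_smul_right, hform_sum_right]
    have e1 : ∀ j, hform n ℓ ((c j : ℂ) • momentVec (ξ j) ℓ p) = 0 := by
      intro j
      rw [hform_smul_right, momentVec, hform_add_right, hform_smul_right, hform_smul_right, h.null,
        h.ortho]
      simp
    simp only [e1, Finset.sum_const_zero, mul_zero]
  have hξV : ∀ i, hform n (ξ i) V = ((2 * q : ℝ) : ℂ)⁻¹ *
      (hform n ℓ (lift p) * ∑ j, (c j : ℂ) * hform n (ξ i) (ξ j)) := by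
    intro i
    have e1 : ∀ j, hform n (ξ i) ((c j : ℂ) • momentVec (ξ j) ℓ p) =
        hform n ℓ (lift p) * ((c j : ℂ) * hform n (ξ i) (ξ j)) := by
      intro j
      rw [hform_smul_right, momentVec, hform_add_right, hform_smul_right, hform_smul_right,
        h.ortho']
      ring
    rw [hV, hform_smul_right, hform_sum_right]
    simp only [e1]
    rw [← Finset.mul_sum]
  have hre : ∀ i, (∑ j, (c j : ℂ) * hform n (ξ i) (ξ j)).re = c i := by
    intro i
    rw [Complex.re_sum]
    simp [h.orthonormal]
  have hℓ : hform n ℓ (hyp ((q : ℂ)⁻¹ • lift p) V t) =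
      ((Real.cosh (t / 2) * q⁻¹ : ℝ) : ℂ) * hform n ℓ (lift p) := by
    simp only [hyp, hform_add_right, hform_smul_right, hℓV]
    push_cast
    ring
  have hneg := hF.hyp_neg t
  constructor
  · rw [moment_pr hneg, hF.hform_hyp, hℓ, Complex.mul_conj, Complex.ofReal_re, map_mul,
      Complex.normSq_ofReal, hφ]
    simp
    field_simp
  · intro i
    have e0 := re_eq_zero hp i
    have e1 := hre i
    rw [moment_pr hneg, hF.hform_hyp, hℓ, hφ]
    simp only [hyp, hform_add_right, hform_smul_right, hξV]
    generalize ∑ j, (c j : ℂ) * hform n (ξ i) (ξ j) = S at *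
    generalize hform n (ξ i) (lift p) = a at *
    generalize hform n ℓ (lift p) = L at *
    have e2 : (((Real.cosh (t / 2) : ℝ) : ℂ) * ((q : ℂ)⁻¹ * a) + ((Real.sinh (t / 2) : ℝ) : ℂ) *
        (((2 * q : ℝ) : ℂ)⁻¹ * (L * S))) * conj (((Real.cosh (t / 2) * q⁻¹ : ℝ) : ℂ) * L) =
        ((Real.cosh (t / 2) ^ 2 * (q ^ 2)⁻¹ : ℝ) : ℂ) * (a * conj L) +
        ((Real.sinh (t / 2) * Real.cosh (t / 2) * (2 * q ^ 2)⁻¹ * Complex.normSq L : ℝ) : ℂ)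
          * S := by
      rw [map_mul, Complex.conj_ofReal]
      simp only [Complex.ofReal_mul, Complex.normSq_eq_conj_mul_self]
      push_cast
      field_simp
    rw [e2, Complex.add_re, Complex.re_ofReal_mul, Complex.re_ofReal_mul, e0, e1]
    simp only [Complex.neg_re, Complex.one_re, neg_neg]
    field_simp
    ring

/-- The isoparametric function along the normal geodesics of the focal submanifold. -/
theorem isoFun_normal_frame (h : IsConfig ℓ ξ) (hp : p ∈ focalSet ℓ ξ) {c : Fin k → ℝ}
    (hc : (∑ j, c j ^ 2) * (moment ℓ ℓ p / 4) = 1) {q : ℝ}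
    (hq : 0 < q) (hqs : q ^ 2 = 1 - ‖p‖ ^ 2) {V : Fin (n + 1) → ℂ}
    (hV : V = ((2 * q : ℝ) : ℂ)⁻¹ • ∑ j, (c j : ℂ) • momentVec (ξ j) ℓ p)
    (hF : IsFrame ((q : ℂ)⁻¹ • lift p) V) (t : ℝ) :
    isoFun ℓ ξ (pr (hyp ((q : ℂ)⁻¹ • lift p) V t)) = Real.sinh (t / 2) ^ 2 := by
  obtain ⟨h1, h2⟩ := h.moment_normal_frame hp hq hqs hV hF t
  have hφ := (h.moment_pos hp.1).ne'
  have hcosh := (Real.cosh_pos (t / 2)).ne'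
  rw [isoFun]
  simp only [h1, h2]
  have e1 : ∀ j, (Real.sinh (t / 2) * Real.cosh (t / 2) * (c j / 2) * moment ℓ ℓ p) ^ 2 /
      (Real.cosh (t / 2) ^ 2 * moment ℓ ℓ p) =
        c j ^ 2 * (moment ℓ ℓ p / 4) * Real.sinh (t / 2) ^ 2 := by
    intro j
    field_simp
    ring
  simp only [e1, ← Finset.sum_mul]
  rw [hc, one_mul]

/-- A unit speed normal geodesic of the focal submanifold. -/
theorem normal_geodesic (h : IsConfig ℓ ξ) {γ : ℝ → EuclideanSpace ℂ (Fin n)}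
    (hγ : IsGeodesic (metric n) (CH n) γ) (h0 : γ 0 ∈ focalSet ℓ ξ)
    (h1 : IsUnitNormal (metric n) (focalSet ℓ ξ) (γ 0) (deriv γ 0)) :
    (∀ t, isoFun ℓ ξ (γ t) = Real.sinh (t / 2) ^ 2) ∧
      ∀ t, metric n (γ t) (deriv γ t) (deriv γ t) = 1 := by
  obtain ⟨c, hc, hη⟩ := (h.isUnitNormal_iff h0).1 h1
  obtain ⟨q, V, hq, hqs, hV, hF, hd⟩ := h.exists_normal_frame h0 hc
  have hq' : (q : ℂ) ≠ 0 := by exact_mod_cast hq.ne'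
  have hγe := hF.eq_of_deriv hγ (by rw [pr_smul (inv_ne_zero hq'), pr_lift]) (hη.trans hd)
  constructor
  · intro t
    rw [congrFun hγe t]
    exact h.isoFun_normal_frame h0 hc hq hqs hV hF t
  · intro t
    rw [hγe]
    exact hF.metric_deriv t

end IsConfig

namespace IsConfig

variable {k : ℕ} {ℓ : Fin (n + 1) → ℂ} {ξ : Fin k → Fin (n + 1) → ℂ}
  {p z : EuclideanSpace ℂ (Fin n)}

/-- The normal geodesic of the focal submanifold with a given initial velocity. -/
theorem exists_normal_geodesic (h : IsConfig ℓ ξ) (hp : p ∈ focalSet ℓ ξ) {c : Fin k → ℝ}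
    (hc : (∑ j, c j ^ 2) * (moment ℓ ℓ p / 4) = 1) :
    ∃ γ, IsGeodesic (metric n) (CH n) γ ∧ γ 0 = p ∧
      deriv γ 0 = ∑ j, c j • gradient (metric n) (moment (ξ j) ℓ) p := by
  obtain ⟨q, V, hq, hqs, hV, hF, hd⟩ := h.exists_normal_frame hp hc
  have hq' : (q : ℂ) ≠ 0 := by exact_mod_cast hq.ne'
  exact ⟨_, hF.isGeodesic, by simp [pr_smul (inv_ne_zero hq')], by rw [hF.deriv_zero, hd]⟩

/-- Every point at which the isoparametric function takes the value `sinh² (r / 2)` is reached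
after time `r` by a normal geodesic of the focal submanifold. -/
theorem exists_normal_geodesic_through (h : IsConfig ℓ ξ) (hz : z ∈ CH n) {r : ℝ} (hr : 0 < r)
    (hf : isoFun ℓ ξ z = Real.sinh (r / 2) ^ 2) :
    ∃ γ, IsGeodesic (metric n) (CH n) γ ∧ γ 0 ∈ focalSet ℓ ξ ∧
      IsUnitNormal (metric n) (focalSet ℓ ξ) (γ 0) (deriv γ 0) ∧ γ r = z := by
  have hL := h.hform_ne_zero (hform_lift_neg hz)
  set L := hform n ℓ (lift z) with hLdef
  let Z : Fin (n + 1) → ℂ := L⁻¹ • lift z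
  have hℓZ : hform n ℓ Z = 1 := by simp only [Z, hform_smul_right, ← hLdef, inv_mul_cancel₀ hL]
  have hprZ : pr Z = z := by simp only [Z]; rw [pr_smul (inv_ne_zero hL), pr_lift]
  have hZneg : (hform n Z Z).re < 0 := by
    simp only [Z, hform_smul_left, hform_smul_right, hform_lift_self]
    rw [← mul_assoc, Complex.mul_conj, Complex.re_ofReal_mul, Complex.ofReal_re]
    have := Complex.normSq_pos.2 (inv_ne_zero hL)
    have := mem_CH.1 hz
    nlinarith
  -- the foot `P` of the perpendicular from `Z`: subtracting `w` makes `[ξ_j, P]` imaginary, and `b`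
  -- is chosen so that `Z - P` is a combination of the vectors `[ξ_j, P] ℓ + [ℓ, P] ξ_j`, which
  -- represent the gradients of the height functions at `P`
  let t : Fin k → ℝ := fun j => (hform n (ξ j) Z).re
  let w : Fin (n + 1) → ℂ := ∑ j, (t j : ℂ) • ξ j
  let a : Fin k → ℂ := fun j => hform n (ξ j) Z - hform n (ξ j) w
  let b : ℂ := ∑ j, (t j : ℂ) * a j
  let P : Fin (n + 1) → ℂ := Z - b • ℓ - w
  have hℓw : hform n ℓ w = 0 := by
    simp only [w, hform_sum_right, hform_smul_right, h.ortho, mul_zero, Finset.sum_const_zero]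
  have hwℓ : hform n w ℓ = 0 := by rw [← hform_conj, hℓw, map_zero]
  have hZℓ : hform n Z ℓ = 1 := by rw [← hform_conj, hℓZ, map_one]
  have hξw : ∀ j, (hform n (ξ j) w).re = t j := by
    intro j
    simp only [w, hform_sum_right, hform_smul_right, Complex.re_sum, Complex.re_ofReal_mul,
      h.orthonormal]
    simp
  have hww : (hform n w w).re = ∑ j, t j ^ 2 := by
    conv_lhs => enter [1, 1]; simp only [w]
    simp only [hform_sum_left, hform_smul_left, Complex.re_sum, Complex.conj_ofReal,
      Complex.re_ofReal_mul, hξw, pow_two]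
  have hwZ : (hform n w Z).re = ∑ j, t j ^ 2 := by
    simp only [w, hform_sum_left, hform_smul_left, Complex.re_sum, Complex.conj_ofReal,
      Complex.re_ofReal_mul, pow_two, t]
  have ha : ∀ j, (a j).re = 0 := fun j => by simp only [a, Complex.sub_re, hξw]; simp [t]
  have hb : b.re = 0 := by simp [b, Complex.re_sum, ha]
  have hℓP : hform n ℓ P = 1 := by
    simp only [P, hform_sub_right, hform_smul_right, h.null, hℓw, hℓZ]; ring
  have hξP : ∀ j, hform n (ξ j) P = a j := by
    intro j
    simp only [P, hform_sub_right, hform_smul_right, h.ortho', a]; ring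
  have hN : ∑ j, t j ^ 2 = -(hform n Z Z).re * Real.sinh (r / 2) ^ 2 := by
    rw [← hf, isoFun, ← hprZ]
    simp only [moment_pr hZneg, hℓZ, map_one, mul_one, Complex.one_re]
    rw [Finset.mul_sum]
    refine Finset.sum_congr rfl fun j _ => ?_
    have := hZneg.ne
    simp only [t]
    field_simp
  have hPP : (hform n P P).re = (hform n Z Z).re * Real.cosh (r / 2) ^ 2 := by
    have hZw := hform_re_comm Z w
    simp only [P, hform_sub_left, hform_sub_right, hform_smul_left, hform_smul_right, h.null, hℓw,
      hℓZ, hZℓ, hwℓ, Complex.sub_re, mul_zero, mul_one, sub_zero,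
      Complex.conj_re, hb, hww, hZw, hwZ, hN, Real.cosh_sq]
    ring
  have hcosh := Real.cosh_pos (r / 2)
  have hPneg : (hform n P P).re < 0 := by
    rw [hPP]; exact mul_neg_of_neg_of_pos hZneg (by positivity)
  have hP0 := ne_zero_of_hform_neg hPneg
  have hpf : pr P ∈ focalSet ℓ ξ := by
    refine ⟨pr_mem_CH hPneg, fun j => ?_⟩
    rw [moment_pr hPneg, hℓP, hξP]
    simp [ha]
  have hsinh : 0 < Real.sinh (r / 2) := Real.sinh_pos_iff.2 (by linarith)
  have hφ : moment ℓ ℓ (pr P) = (-(hform n P P).re)⁻¹ := by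
    rw [moment_pr hPneg, hℓP]; simp
  -- the initial velocity at `P`, normalized by `[P, P] = cosh² (r / 2) [Z, Z]`
  let c : Fin k → ℝ := fun j => 2 * Real.cosh (r / 2) / Real.sinh (r / 2) * t j
  have hc : (∑ j, c j ^ 2) * (moment ℓ ℓ (pr P) / 4) = 1 := by
    simp only [c, mul_pow]
    rw [← Finset.mul_sum, hN, hφ, hPP]
    have := hZneg.ne
    field_simp
    norm_num
  obtain ⟨q, V, hq, -, hV, hF, hd⟩ := h.exists_normal_frame hpf hc
  have hq' : (q : ℂ) ≠ 0 := by exact_mod_cast hq.ne'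
  have hpr0 : pr ((q : ℂ)⁻¹ • lift (pr P)) = pr P := by rw [pr_smul (inv_ne_zero hq'), pr_lift]
  refine ⟨_, hF.isGeodesic, ?_, ?_, ?_⟩
  · simpa [hpr0] using hpf
  · have e0 : pr (hyp ((q : ℂ)⁻¹ • lift (pr P)) V 0) = pr P := by simp [hpr0]
    simp only [e0]
    rw [hF.deriv_zero, ← hd]
    exact (h.isUnitNormal_iff hpf).2 ⟨c, hc, rfl⟩
  · have hsum : ∑ j, (c j : ℂ) • momentVec (ξ j) ℓ (pr P) =
        ((2 * Real.cosh (r / 2) / Real.sinh (r / 2) : ℝ) * (P 0)⁻¹ : ℂ) • (Z - P) := by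
      have e1 : Z - P = ∑ j, (t j : ℂ) • (a j • ℓ + ξ j) := by
        simp only [P, b, w, smul_add, Finset.sum_add_distrib, smul_smul, Finset.sum_smul]
        abel
      rw [e1, Finset.smul_sum]
      refine Finset.sum_congr rfl fun j _ => ?_
      rw [momentVec, lift_pr hP0, hform_smul_right, hform_smul_right, hξP, hℓP]
      simp only [c, smul_smul, smul_add]
      congr 1 <;> congr 1 <;> push_cast <;> ring
    have hs' : (Real.sinh (r / 2) : ℂ) ≠ 0 := by exact_mod_cast hsinh.ne'
    have hc' : (Real.cosh (r / 2) : ℂ) ≠ 0 := by exact_mod_cast hcosh.ne'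
    have e2 : hyp ((q : ℂ)⁻¹ • lift (pr P)) V r =
        ((Real.cosh (r / 2) : ℂ) * (q : ℂ)⁻¹ * (P 0)⁻¹) • Z := by
      rw [hV, hsum, hyp, lift_pr hP0]
      simp only [smul_smul]
      have e3 : (Real.sinh (r / 2) : ℂ) * (((2 * q : ℝ) : ℂ)⁻¹ *
          ((2 * Real.cosh (r / 2) / Real.sinh (r / 2) : ℝ) * (P 0)⁻¹)) =
            (Real.cosh (r / 2) : ℂ) * (q : ℂ)⁻¹ * (P 0)⁻¹ := by
        simp only [Complex.ofReal_mul, Complex.ofReal_div, Complex.ofReal_ofNat]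
        field_simp
      rw [e3, ← mul_assoc, ← smul_add, add_sub_cancel]
    rw [e2, pr_smul (mul_ne_zero (mul_ne_zero hc' (inv_ne_zero hq')) (inv_ne_zero hP0)), hprZ]

/-- The tubes around the focal submanifold are the level sets of the isoparametric function. -/
theorem tube_eq (h : IsConfig ℓ ξ) {r : ℝ} (hr : 0 < r) :
    tube (metric n) (CH n) (focalSet ℓ ξ) r =
      {z | z ∈ CH n ∧ isoFun ℓ ξ z = Real.sinh (r / 2) ^ 2} := by
  ext z
  constructor
  · rintro ⟨γ, hγ, h0, h1, rfl⟩
    exact ⟨hγ.mem r, (h.normal_geodesic hγ h0 h1).1 r⟩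
  · rintro ⟨hz, hf⟩
    obtain ⟨γ, hγ, h0, h1, h2⟩ := h.exists_normal_geodesic_through hz hr hf
    exact ⟨γ, hγ, h0, h1, h2⟩

theorem exists_unit_normal_geodesic (h : IsConfig ℓ ξ) (hk : 0 < k) (hp : p ∈ focalSet ℓ ξ) :
    ∃ γ, IsGeodesic (metric n) (CH n) γ ∧ γ 0 = p ∧
      IsUnitNormal (metric n) (focalSet ℓ ξ) (γ 0) (deriv γ 0) := by
  have hφ := h.moment_pos hp.1
  let c : Fin k → ℝ := Pi.single ⟨0, hk⟩ (2 / √(moment ℓ ℓ p))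
  have hc : (∑ j, c j ^ 2) * (moment ℓ ℓ p / 4) = 1 := by
    rw [Finset.sum_eq_single ⟨0, hk⟩ (fun j _ hj => by simp [c, hj]) (by simp)]
    simp only [c, Pi.single_eq_same, div_pow, Real.sq_sqrt hφ.le]
    field_simp
    norm_num
  obtain ⟨γ, hγ, h0, h1⟩ := h.exists_normal_geodesic hp hc
  exact ⟨γ, hγ, h0, by rw [h0, h1]; exact (h.isUnitNormal_iff hp).2 ⟨c, hc, rfl⟩⟩

theorem fderiv_isoFun_ne_zero (h : IsConfig ℓ ξ) (hz : z ∈ CH n) (hf : 0 < isoFun ℓ ξ z) :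
    fderiv ℝ (isoFun ℓ ξ) z ≠ 0 := by
  intro h0
  have := h.metric_gradient_isoFun hz
  rw [isRiemannian_metric.gradient_apply hz, h0] at this
  simp only [zero_apply] at this
  nlinarith

theorem isIsoparametricHypersurface_tube (h : IsConfig ℓ ξ) (hk : 0 < k)
    (hp : p ∈ focalSet ℓ ξ) {r : ℝ} (hr : 0 < r) :
    IsIsoparametricHypersurface (metric n) (CH n)
      (tube (metric n) (CH n) (focalSet ℓ ξ) r) := by
  have hsinh : 0 < Real.sinh (r / 2) := Real.sinh_pos_iff.2 (by linarith)
  obtain ⟨γ, hγ, rfl, h1⟩ := h.exists_unit_normal_geodesic hk hp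
  have hγf := (h.normal_geodesic hγ hp h1).1
  have hpos : ∀ z ∈ tube (metric n) (CH n) (focalSet ℓ ξ) r,
      z ∈ CH n ∧ isoFun ℓ ξ z = Real.sinh (r / 2) ^ 2 ∧ fderiv ℝ (isoFun ℓ ξ) z ≠ 0 := by
    intro z hz
    rw [h.tube_eq hr] at hz
    exact ⟨hz.1, hz.2, h.fderiv_isoFun_ne_zero hz.1 (by rw [hz.2]; positivity)⟩
  refine ⟨⟨⟨γ r, γ, hγ, hp, h1, rfl⟩, fun z hz => (hpos z hz).1, fun z hz => ?_⟩,
    isoFun ℓ ξ, ⟨?_, ⟨γ 0, hγ.mem 0, γ r, hγ.mem r, ?_⟩, ?_⟩, _, h.tube_eq hr,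
    fun z hz => (hpos z hz).2.2⟩
  · obtain ⟨hz1, hz2, hz3⟩ := hpos z hz
    refine ⟨fun w => isoFun ℓ ξ w - Real.sinh (r / 2) ^ 2,
      (h.contDiffAt_isoFun hz1).sub contDiffAt_const, ?_, ?_⟩
    · rwa [fderiv_sub_const]
    · filter_upwards [isOpen_CH.mem_nhds hz1] with q hq
      rw [h.tube_eq hr, sub_eq_zero]
      exact ⟨fun hq' => hq'.2, fun hq' => ⟨hq, hq'⟩⟩
  · exact fun z hz => (h.contDiffAt_isoFun hz).contDiffWithinAt
  · rw [hγf, hγf]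
    simpa using (pow_pos hsinh 2).ne
  · refine ⟨fun x => x * (1 + x), fun x => k / 2 + (n + 1) * x, by fun_prop, by fun_prop,
      fun z hz => ⟨h.metric_gradient_isoFun hz, h.laplacian_isoFun hz⟩⟩

/-- The velocity of a normal geodesic is the normalized gradient of the isoparametric function:
by the equality case of the Cauchy-Schwarz inequality. -/
theorem deriv_normal_geodesic (h : IsConfig ℓ ξ) {γ : ℝ → EuclideanSpace ℂ (Fin n)}
    (hγ : IsGeodesic (metric n) (CH n) γ) (h0 : γ 0 ∈ focalSet ℓ ξ)
    (h1 : IsUnitNormal (metric n) (focalSet ℓ ξ) (γ 0) (deriv γ 0)) {t : ℝ} (ht : t ≠ 0) :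
    deriv γ t = (Real.sinh (t / 2) * Real.cosh (t / 2))⁻¹ •
      gradient (metric n) (isoFun ℓ ξ) (γ t) := by
  obtain ⟨hf, hu⟩ := h.normal_geodesic hγ h0 h1
  have hz := hγ.mem t
  have hcosh := (Real.cosh_pos (t / 2)).ne'
  have hsinh : Real.sinh (t / 2) ≠ 0 := by
    rw [Ne, Real.sinh_eq_zero]; exact div_ne_zero ht two_ne_zero
  have hdγ : HasDerivAt γ (deriv γ t) t :=
    (hγ.smooth.contDiffAt.differentiableAt (by simp)).hasDerivAt
  have hd : fderiv ℝ (isoFun ℓ ξ) (γ t) (deriv γ t) = Real.sinh (t / 2) * Real.cosh (t / 2) := by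
    have e1 := (((h.contDiffAt_isoFun hz).differentiableAt
      (by simp)).hasFDerivAt.comp_hasDerivAt t hdγ).deriv
    rw [← e1]
    have e2 : isoFun ℓ ξ ∘ γ = fun t => Real.sinh (t / 2) ^ 2 := funext hf
    have e3 := ((((hasDerivAt_id t).div_const 2).sinh).pow 2).deriv
    rw [e2]
    simp only [id] at e3
    refine Eq.trans e3 ?_
    simp
    ring
  have hg := h.metric_gradient_isoFun hz
  rw [hf t] at hg
  set G := gradient (metric n) (isoFun ℓ ξ) (γ t) with hG
  have e4 : metric n (γ t) G (deriv γ t) = Real.sinh (t / 2) * Real.cosh (t / 2) := by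
    rw [hG, isRiemannian_metric.gradient_apply hz, hd]
  have e5 : metric n (γ t) (deriv γ t) G = Real.sinh (t / 2) * Real.cosh (t / 2) := by
    rw [isRiemannian_metric.symm _ hz, e4]
  rw [← sub_eq_zero]
  by_contra hne
  have := isRiemannian_metric.pos _ hz _ hne
  simp only [map_sub, map_smul, sub_apply, smul_apply, smul_eq_mul, hu, e4, e5, hg] at this
  have e6 : Real.cosh (t / 2) ^ 2 = Real.sinh (t / 2) ^ 2 + 1 := Real.cosh_sq _
  field_simp at this
  nlinarith

/-- The mean curvature of a level set of `F` is a function of `|∇F|²` and `ΔF`. -/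
theorem hasMeanCurvatureAt_tube (h : IsConfig ℓ ξ) {r : ℝ} (hr : 0 < r)
    {γ : ℝ → EuclideanSpace ℂ (Fin n)}
    (hγ : IsGeodesic (metric n) (CH n) γ) (h0 : γ 0 ∈ focalSet ℓ ξ)
    (h1 : IsUnitNormal (metric n) (focalSet ℓ ξ) (γ 0) (deriv γ 0)) :
    HasMeanCurvatureAt (metric n) (tube (metric n) (CH n) (focalSet ℓ ξ) r) (γ r) (-deriv γ r)
      (((k : ℝ) - 1 + 2 * n * Real.sinh (r / 2) ^ 2) /
        (2 * Real.sinh (r / 2) * Real.cosh (r / 2))) := by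
  have hsinh : 0 < Real.sinh (r / 2) := Real.sinh_pos_iff.2 (by linarith)
  have hcosh := Real.cosh_pos (r / 2)
  have hmem : γ r ∈ tube (metric n) (CH n) (focalSet ℓ ξ) r := ⟨γ, hγ, h0, h1, rfl⟩
  have e1 : Real.sinh (r / 2) ^ 2 * (1 + Real.sinh (r / 2) ^ 2) =
      (Real.sinh (r / 2) * Real.cosh (r / 2)) ^ 2 := by
    rw [mul_pow, Real.cosh_sq]; ring
  have e2 : √(Real.sinh (r / 2) ^ 2 * (1 + Real.sinh (r / 2) ^ 2)) =
      Real.sinh (r / 2) * Real.cosh (r / 2) := by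
    rw [e1, Real.sqrt_sq (by positivity)]
  have e3 : deriv (fun x : ℝ => x * (1 + x)) (Real.sinh (r / 2) ^ 2) =
      1 + 2 * Real.sinh (r / 2) ^ 2 := by
    have := ((hasDerivAt_id (Real.sinh (r / 2) ^ 2)).mul
      ((hasDerivAt_id (Real.sinh (r / 2) ^ 2)).const_add 1)).deriv
    refine Eq.trans this ?_
    simp only [id]
    ring
  have := (isRiemannian_metric (n := n)).hasMeanCurvatureAt_level (f := isoFun ℓ ξ)
    (a := fun x => x * (1 + x)) (fun z hz => (h.contDiffAt_isoFun hz).contDiffWithinAt)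
    (by fun_prop) (fun z hz => h.metric_gradient_isoFun hz) (h.tube_eq hr)
    (by show 0 < Real.sinh (r / 2) ^ 2 * (1 + Real.sinh (r / 2) ^ 2); positivity) hmem
  simp only [e2, e3, h.laplacian_isoFun (hγ.mem r), (h.normal_geodesic hγ h0 h1).1 r] at this
  rw [h.deriv_normal_geodesic hγ h0 h1 hr.ne', ← neg_smul]
  convert this using 1
  field_simp
  ring

end IsConfig

/-! ### Transitivity, and isometries that fix a point -/

/-- Two vectors of the same length are exchanged by a complex reflection, unless they are
equal or their difference is orthogonal to them. -/
theorem exists_preserves_mulVec_eq {x y : Fin (n + 1) → ℂ} (h : hform n x x = hform n y y)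
    (hxy : hform n (x - y) x ≠ 0) :
    ∃ A : Mat n, Preserves A ∧ A.mulVec x = y ∧
      ∀ z, hform n x z = hform n y z → A.mulVec z = z := by
  set v := x - y with hv
  set c := (hform n v x)⁻¹ with hc
  have hA : ∀ z, (LinearMap.toMatrix' (LinearMap.id - (c • hform n v).smulRight v)).mulVec z =
      z - (c * hform n v z) • v := by
    intro z
    rw [LinearMap.toMatrix'_mulVec]
    simp
  have hvv : hform n v v = hform n v x + conj (hform n v x) := by
    rw [hform_conj]
    simp only [hv, hform_sub_left, hform_sub_right, h]
    ring
  refine ⟨LinearMap.toMatrix' (LinearMap.id - (c • hform n v).smulRight v), fun z w => ?_, ?_,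
    fun z hz => ?_⟩
  · rw [hA, hA]
    simp only [hform_sub_left, hform_sub_right, hform_smul_left, hform_smul_right, hvv, map_mul]
    rw [hform_conj v z, hc, map_inv₀]
    have : conj (hform n v x) ≠ 0 := by simpa using hxy
    field_simp
    ring
  · rw [hA, hc, inv_mul_cancel₀ hxy, one_smul, hv, sub_sub_cancel]
  · rw [hA, hv, hform_sub_left, hz, sub_self, mul_zero, zero_smul, sub_zero]

/-- Every point of the ball can be moved to the centre. -/
theorem exists_act_eq_zero {o : EuclideanSpace ℂ (Fin n)} (ho : o ∈ CH n) :
    ∃ A : Mat n, Preserves A ∧ act A o = 0 := by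
  rcases eq_or_ne o 0 with rfl | hne
  · exact ⟨1, Preserves.one, by rw [act_eq, Matrix.one_mulVec, pr_lift]⟩
  have hs := mem_CH.1 ho
  obtain ⟨q, hq, hqs⟩ : ∃ q : ℝ, 0 < q ∧ q ^ 2 = 1 - ‖o‖ ^ 2 :=
    ⟨_, Real.sqrt_pos.2 hs, Real.sq_sqrt hs.le⟩
  have hq' : (q : ℂ) ≠ 0 := by exact_mod_cast hq.ne'
  have hq1 : q ≠ 1 := by
    rintro rfl
    have := norm_pos_iff.2 hne
    nlinarith
  have h00 : hform n (lift (0 : EuclideanSpace ℂ (Fin n))) (lift 0) = -1 := by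
    rw [hform_lift_self]; simp
  have hoo : hform n ((q : ℂ)⁻¹ • lift o) ((q : ℂ)⁻¹ • lift o) = -1 := by
    rw [hform_smul_left, hform_smul_right, hform_lift_self, ← hqs, map_inv₀, Complex.conj_ofReal]
    push_cast
    field_simp
  have h0o : hform n (lift 0) (lift o) = -1 := by
    rw [hform_lift_lift]; simp
  obtain ⟨A, hA, hAo, -⟩ := exists_preserves_mulVec_eq (x := (q : ℂ)⁻¹ • lift o)
    (y := lift 0) (by rw [hoo, h00]) (by
      rw [hform_sub_left, hoo, hform_smul_right, h0o]
      intro h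
      have h2 : (q : ℂ)⁻¹ = 1 := by linear_combination h
      rw [inv_eq_one] at h2
      exact hq1 (by exact_mod_cast h2))
  refine ⟨A, hA, ?_⟩
  have := Preserves.act_pr (A := A) (Z := (q : ℂ)⁻¹ • lift o) (by rw [hoo]; simp)
  rwa [hAo, pr_lift, pr_smul (inv_ne_zero hq'), pr_lift] at this

theorem isFrame_zero {v : EuclideanSpace ℂ (Fin n)} (hv : ‖v‖ = 1) :
    IsFrame (lift (0 : EuclideanSpace ℂ (Fin n))) (incl v) where
  neg := by rw [hform_lift_self]; simp
  ortho := by rw [hform_lift_incl]; simp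
  pos := by rw [hform_incl_incl, inner_self_eq_norm_sq_to_K, hv]; simp

/-- The geodesics through the centre of the ball are straight lines. -/
theorem pr_hyp_zero (v : EuclideanSpace ℂ (Fin n)) (t : ℝ) :
    pr (hyp (lift (0 : EuclideanSpace ℂ (Fin n))) (incl v) t) = Real.tanh (t / 2) • v := by
  have : (Real.cosh (t / 2) : ℂ) ≠ 0 := by exact_mod_cast (Real.cosh_pos (t / 2)).ne'
  ext i
  simp only [pr, hyp, Pi.add_apply, Pi.smul_apply, incl_zero, incl_succ, lift_zero, lift_succ,
    smul_eq_mul, PiLp.smul_apply, Complex.real_smul, Real.tanh_eq_sinh_div_cosh,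
    Complex.ofReal_div, PiLp.zero_apply, mul_zero, add_zero, mul_one, zero_add]
  field_simp

theorem zero_mem_CH : (0 : EuclideanSpace ℂ (Fin n)) ∈ CH n := by rw [mem_CH]; simp

theorem metric_zero (u v : EuclideanSpace ℂ (Fin n)) : metric n 0 u v = 4 * (inner ℂ u v).re := by
  rw [metric_apply]; simp

/-- An isometry that fixes the centre of the ball is linear, since it maps the radial geodesics to
radial geodesics. -/
theorem isometry_eq_fderiv {F : EuclideanSpace ℂ (Fin n) → EuclideanSpace ℂ (Fin n)}
    (hF : F ∈ isometries (metric n) (CH n)) (hF0 : F 0 = 0) {z : EuclideanSpace ℂ (Fin n)}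
    (hz : z ∈ CH n) : F z = fderiv ℝ F 0 z := by
  rcases eq_or_ne z 0 with rfl | hne
  · rw [hF0, map_zero]
  have hzpos := norm_pos_iff.2 hne
  set v : EuclideanSpace ℂ (Fin n) := ‖z‖⁻¹ • z with hv
  have hv1 : ‖v‖ = 1 := by
    rw [hv, norm_smul, norm_inv, norm_norm, inv_mul_cancel₀ hzpos.ne']
  have hz1 : ‖z‖ < 1 := by simpa [CH] using hz
  obtain ⟨t, ht⟩ : ∃ t, Real.tanh (t / 2) = ‖z‖ :=
    ⟨2 * Real.artanh ‖z‖, by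
      rw [mul_div_cancel_left₀ _ two_ne_zero, Real.tanh_artanh ⟨by linarith, hz1⟩]⟩
  have hre : ∀ u : EuclideanSpace ℂ (Fin n), ‖u‖ ^ 2 = (inner ℂ u u).re := fun u => by
    rw [inner_self_eq_norm_sq_to_K]; norm_cast
  have hLv : ‖fderiv ℝ F 0 v‖ = 1 := by
    have := hF.2.2 0 zero_mem_CH v v
    rw [hF0, metric_zero, metric_zero, ← hre, ← hre, hv1] at this
    rw [← sq_eq_sq₀ (norm_nonneg _) zero_le_one]
    linarith
  have hfr := isFrame_zero hv1
  have hγ := (isRiemannian_metric (n := n)).isGeodesic_comp hF hfr.isGeodesic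
  have hdz : deriv (fun t => pr (hyp (lift (0 : EuclideanSpace ℂ (Fin n))) (incl v) t)) 0 =
      (1 / 2 : ℝ) • v := by
    rw [hfr.deriv_zero, pr_lift, proj_incl, lift_zero, ← Complex.coe_smul]
    congr 1
    push_cast
    ring
  have hdF : DifferentiableAt ℝ F 0 :=
    (hF.2.1.contDiffAt (isOpen_CH.mem_nhds zero_mem_CH)).differentiableAt (by simp)
  have hd : HasDerivAt (fun t => pr (hyp (lift (0 : EuclideanSpace ℂ (Fin n))) (incl v) t))
      ((1 / 2 : ℝ) • v) 0 := by
    rw [← hdz]; exact (hfr.hasDerivAt 0).differentiableAt.hasDerivAt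
  have h3 := (isFrame_zero hLv).eq_of_deriv hγ (by simp [hF0]) (by
    have h4 : HasFDerivAt F (fderiv ℝ F 0)
        (pr (hyp (lift (0 : EuclideanSpace ℂ (Fin n))) (incl v) 0)) := by
      simpa using hdF.hasFDerivAt
    refine (h4.comp_hasDerivAt 0 hd).deriv.trans ?_
    rw [map_smul, pr_lift, proj_incl, lift_zero, ← Complex.coe_smul]
    congr 1
    push_cast
    ring)
  have h5 := congrFun h3 t
  simp only [Function.comp_apply] at h5
  rw [pr_hyp_zero, pr_hyp_zero, ht, ← map_smul, hv, smul_smul, mul_inv_cancel₀ hzpos.ne',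
    one_smul] at h5
  exact h5

/-- An isometry `L` that fixes the centre of the ball is linear and preserves the metric at all
points, so it preserves the real part and the absolute value of the Hermitian product. Then `⟪L u,
L (i u)⟫ = ± i |u|²`, which is the equality case of the Cauchy-Schwarz inequality. -/
theorem isometry_fderiv_I_zero {F : EuclideanSpace ℂ (Fin n) → EuclideanSpace ℂ (Fin n)}
    (hF : F ∈ isometries (metric n) (CH n)) (hF0 : F 0 = 0) (u : EuclideanSpace ℂ (Fin n)) :
    fderiv ℝ F 0 (Complex.I • u) = Complex.I • fderiv ℝ F 0 u ∨
      fderiv ℝ F 0 (Complex.I • u) = -(Complex.I • fderiv ℝ F 0 u) := by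
  set L := fderiv ℝ F 0 with hL
  have hre : ∀ u v, (inner ℂ (L u) (L v)).re = (inner ℂ u v).re := by
    intro u v
    have := hF.2.2 0 zero_mem_CH u v
    rw [hF0, metric_zero, metric_zero] at this
    linarith
  have hn : ∀ u : EuclideanSpace ℂ (Fin n), (inner ℂ u u).re = ‖u‖ ^ 2 := fun u => by
    rw [inner_self_eq_norm_sq_to_K]; norm_cast
  have hnorm : ∀ u, ‖L u‖ ^ 2 = ‖u‖ ^ 2 := fun u => by rw [← hn, ← hn, hre]
  -- the metric at the other points of the ball sees the absolute value of the Hermitian product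
  have habs : ∀ z ∈ CH n, ∀ u, Complex.normSq (inner ℂ (L u) (L z)) =
      Complex.normSq (inner ℂ u z) := by
    intro z hz u
    have hev : F =ᶠ[𝓝 z] L := by
      filter_upwards [isOpen_CH.mem_nhds hz] with w hw using isometry_eq_fderiv hF hF0 hw
    have h1 := hF.2.2 z hz u u
    have hs := (mem_CH.1 hz).ne'
    have hc : ∀ x y : EuclideanSpace ℂ (Fin n), (inner ℂ x y * inner ℂ y x).re =
        Complex.normSq (inner ℂ x y) := fun x y => by
      rw [← inner_conj_symm y x, Complex.mul_conj, Complex.ofReal_re]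
    rw [hev.fderiv_eq, hev.self_of_nhds, L.fderiv, metric_apply, metric_apply, hnorm, hre, hc,
      hc] at h1
    field_simp at h1
    linarith
  have habs' : ∀ z u, Complex.normSq (inner ℂ (L u) (L z)) = Complex.normSq (inner ℂ u z) := by
    intro z u
    obtain ⟨c, hc, hcz⟩ : ∃ c : ℝ, 0 < c ∧ c • z ∈ CH n := by
      refine ⟨(1 + ‖z‖)⁻¹, by positivity, ?_⟩
      have : 0 < 1 + ‖z‖ := by positivity
      simp only [CH, mem_ball_zero_iff, norm_smul, norm_inv, Real.norm_eq_abs, abs_of_pos this]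
      rw [inv_mul_lt_iff₀ this]
      linarith
    have := habs _ hcz u
    rw [map_smul, ← Complex.coe_smul c z, ← Complex.coe_smul c (L z), inner_smul_right,
      inner_smul_right, map_mul, map_mul] at this
    have hc0 : Complex.normSq (c : ℂ) ≠ 0 := by simpa using hc.ne'
    exact mul_left_cancel₀ hc0 this
  set x := L u
  set y := L (Complex.I • u)
  have e1 : (inner ℂ x y).re = 0 := by
    have h0 : (inner ℂ u u).im = 0 := inner_self_im (𝕜 := ℂ) u
    rw [hre, inner_smul_right, Complex.mul_re, Complex.I_re, h0]
    ring
  have e2 : (inner ℂ x y).im ^ 2 = (‖u‖ ^ 2) ^ 2 := by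
    have := habs' (Complex.I • u) u
    rw [inner_smul_right, map_mul, Complex.normSq_I, one_mul, inner_self_eq_norm_sq_to_K,
      Complex.normSq_apply, e1] at this
    have h3 : Complex.normSq ((‖u‖ : ℂ) ^ 2) = (‖u‖ ^ 2) ^ 2 := by
      rw [← Complex.ofReal_pow, Complex.normSq_ofReal, pow_two (‖u‖ ^ 2)]
    rw [← h3]
    refine Eq.trans ?_ this
    ring
  have e3 : ‖x‖ ^ 2 = ‖u‖ ^ 2 := hnorm u
  have e4 : ‖y‖ ^ 2 = ‖u‖ ^ 2 := by rw [hnorm, norm_smul]; simp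
  have e6 : (inner ℂ y x).im = -(inner ℂ x y).im := by
    rw [← inner_conj_symm y x, Complex.conj_im]
  have e5 : ∀ w : EuclideanSpace ℂ (Fin n), ‖w‖ ^ 2 = 0 → w = 0 := fun w hw => by simpa using hw
  rcases sq_eq_sq_iff_eq_or_eq_neg.1 e2 with h | h
  · left
    rw [← sub_eq_zero]
    apply e5
    rw [@norm_sub_sq ℂ, norm_smul, e4, Complex.norm_I, one_mul, e3, inner_smul_right]
    simp [e6, h]
    ring
  · right
    rw [← sub_eq_zero, sub_neg_eq_add]
    apply e5
    rw [@norm_add_sq ℂ, norm_smul, e4, Complex.norm_I, one_mul, e3, inner_smul_right]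
    simp [e6, h]
    ring

theorem Preserves.fderiv_act_smul {A : Mat n} (hA : Preserves A) {z : EuclideanSpace ℂ (Fin n)}
    (hz : z ∈ CH n) (c : ℂ) (u : EuclideanSpace ℂ (Fin n)) :
    fderiv ℝ (act A) z (c • u) = c • fderiv ℝ (act A) z u := by
  rw [hA.fderiv_act hz, hA.fderiv_act hz, LinearMap.map_smul incl, Matrix.mulVec_smul, smul_comm,
    LinearMap.map_smul (proj _) c]

/-- The differential of an isometry at a fixed point commutes or anticommutes with the complex
structure. -/
theorem isometry_fderiv_I {F : EuclideanSpace ℂ (Fin n) → EuclideanSpace ℂ (Fin n)}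
    (hF : F ∈ isometries (metric n) (CH n)) {o : EuclideanSpace ℂ (Fin n)} (ho : o ∈ CH n)
    (hFo : F o = o) (u : EuclideanSpace ℂ (Fin n)) :
    fderiv ℝ F o (Complex.I • u) = Complex.I • fderiv ℝ F o u ∨
      fderiv ℝ F o (Complex.I • u) = -(Complex.I • fderiv ℝ F o u) := by
  obtain ⟨A, hA, hAo⟩ := exists_act_eq_zero ho
  obtain ⟨B, hB, hAB, hBA⟩ := hA.exists_inv
  have hB0 : act B 0 = o := by
    rw [← hAo, ← hA.act_mul ho, hBA, act_eq, Matrix.one_mulVec, pr_lift]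
  have hG := isometries_comp isOpen_CH hA.act_mem_isometries
    (isometries_comp isOpen_CH hF hB.act_mem_isometries)
  have hG0 : (act A ∘ F ∘ act B) 0 = 0 := by simp [hB0, hFo, hAo]
  have hdA : DifferentiableAt ℝ (act A) o := (hA.hasFDerivAt_act ho).differentiableAt
  have hdB : DifferentiableAt ℝ (act B) 0 := (hB.hasFDerivAt_act zero_mem_CH).differentiableAt
  have hdF : DifferentiableAt ℝ F o :=
    (hF.2.1.contDiffAt (isOpen_CH.mem_nhds ho)).differentiableAt (by simp)
  have hd : ∀ v, fderiv ℝ (act A ∘ F ∘ act B) 0 v =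
      fderiv ℝ (act A) o (fderiv ℝ F o (fderiv ℝ (act B) 0 v)) := by
    intro v
    have h1 : HasFDerivAt (act B) (fderiv ℝ (act B) 0) 0 := hdB.hasFDerivAt
    have h2 : HasFDerivAt F (fderiv ℝ F o) (act B 0) := by rw [hB0]; exact hdF.hasFDerivAt
    have h3 : HasFDerivAt (act A) (fderiv ℝ (act A) o) ((F ∘ act B) 0) := by
      rw [Function.comp_apply, hB0, hFo]; exact hdA.hasFDerivAt
    rw [(h3.comp 0 (h2.comp 0 h1)).fderiv]
    rfl
  obtain ⟨v, rfl⟩ : ∃ v, fderiv ℝ (act B) 0 v = u :=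
    isRiemannian_metric.isometry_surjective hB.act_mem_isometries zero_mem_CH u
  have hinj := isRiemannian_metric.isometry_injective hA.act_mem_isometries ho
  rcases isometry_fderiv_I_zero hG hG0 v with h | h
  · left
    apply hinj
    rw [hA.fderiv_act_smul ho, ← hB.fderiv_act_smul zero_mem_CH, ← hd, ← hd, h]
  · right
    apply hinj
    rw [map_neg, hA.fderiv_act_smul ho, ← hB.fderiv_act_smul zero_mem_CH, ← hd, ← hd, h]

/-! ### Homogeneous tubes have constant Kähler angle -/

theorem metric_I_smul (z u v : EuclideanSpace ℂ (Fin n)) :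
    metric n z (Complex.I • u) (Complex.I • v) = metric n z u v := by
  rw [metric_apply, metric_apply]
  simp only [inner_smul_left, inner_smul_right, Complex.conj_I]
  have e1 : -Complex.I * (Complex.I * inner ℂ u v) = inner ℂ u v := by
    linear_combination -inner ℂ u v * Complex.I_mul_I
  have e2 : -Complex.I * inner ℂ u z * (Complex.I * inner ℂ z v) = inner ℂ u z * inner ℂ z v := by
    linear_combination -inner ℂ u z * inner ℂ z v * Complex.I_mul_I
  rw [mul_left_comm Complex.I, e1, e2]

/-- The normal space at `p` of the focal submanifold. -/
noncomputable def normalSpace {k : ℕ} (ℓ : Fin (n + 1) → ℂ) (ξ : Fin k → Fin (n + 1) → ℂ)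
    (p : EuclideanSpace ℂ (Fin n)) : Submodule ℝ (EuclideanSpace ℂ (Fin n)) :=
  Submodule.span ℝ (Set.range fun j => gradient (metric n) (moment (ξ j) ℓ) p)

theorem mem_normalSpace {k : ℕ} {ℓ : Fin (n + 1) → ℂ} {ξ : Fin k → Fin (n + 1) → ℂ}
    {p v : EuclideanSpace ℂ (Fin n)} : v ∈ normalSpace ℓ ξ p ↔
      ∃ c : Fin k → ℝ, ∑ j, c j • gradient (metric n) (moment (ξ j) ℓ) p = v :=
  Submodule.mem_span_range_iff_exists_fun ℝ

namespace IsConfig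

variable {k : ℕ} {ℓ : Fin (n + 1) → ℂ} {ξ : Fin k → Fin (n + 1) → ℂ}
  {p v : EuclideanSpace ℂ (Fin n)}

theorem isUnitNormal_iff_mem (h : IsConfig ℓ ξ) (hp : p ∈ focalSet ℓ ξ) :
    IsUnitNormal (metric n) (focalSet ℓ ξ) p v ↔ v ∈ normalSpace ℓ ξ p ∧ metric n p v v = 1 := by
  rw [h.isUnitNormal_iff hp, mem_normalSpace]
  constructor
  · rintro ⟨c, hc, rfl⟩
    exact ⟨⟨c, rfl⟩, by rw [h.metric_normal hp, hc]⟩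
  · rintro ⟨⟨c, rfl⟩, h1⟩
    exact ⟨c, by rw [← h1, h.metric_normal hp], rfl⟩

/-- The orthogonal projection to the normal space. -/
theorem exists_projection (h : IsConfig ℓ ξ) (hp : p ∈ focalSet ℓ ξ)
    (v : EuclideanSpace ℂ (Fin n)) :
    ∃ F ∈ normalSpace ℓ ξ p, ∀ η ∈ normalSpace ℓ ξ p, metric n p (v - F) η = 0 := by
  have hφ := (h.moment_pos hp.1).ne'
  refine ⟨_, mem_normalSpace.2
    ⟨fun j => fderiv ℝ (moment (ξ j) ℓ) p v / (moment ℓ ℓ p / 4), rfl⟩, fun η hη => ?_⟩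
  obtain ⟨c, rfl⟩ := mem_normalSpace.1 hη
  rw [isRiemannian_metric.symm _ hp.1, map_sum, sum_apply]
  refine Finset.sum_eq_zero fun j _ => ?_
  rw [map_smul, smul_apply, isRiemannian_metric.gradient_apply hp.1, map_sub,
    h.fderiv_height_normal hp, smul_eq_mul]
  field_simp
  ring

/-- The Kähler angle of a vector exists: the projection of `J v` is not longer than `v`. -/
theorem exists_isKahlerAngle (h : IsConfig ℓ ξ) (hp : p ∈ focalSet ℓ ξ) (hv : v ≠ 0) :
    ∃ φ, IsKahlerAngle p (normalSpace ℓ ξ p) v φ := by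
  obtain ⟨F, hF, hFn⟩ := h.exists_projection hp (Complex.I • v)
  have hvv := isRiemannian_metric.pos p hp.1 v hv
  have hnn : ∀ u, 0 ≤ metric n p u u := fun u => by
    rcases eq_or_ne u 0 with rfl | hu
    · simp
    · exact (isRiemannian_metric.pos p hp.1 u hu).le
  have h1 := hnn (Complex.I • v - F)
  have h2 := hFn F hF
  rw [map_sub, hFn F hF, sub_zero, (metric n p).map_sub, sub_apply, metric_I_smul] at h1
  rw [(metric n p).map_sub, sub_apply, sub_eq_zero] at h2
  rw [isRiemannian_metric.symm p hp.1 F, h2] at h1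
  have hq0 : 0 ≤ metric n p F F / metric n p v v := div_nonneg (hnn F) hvv.le
  refine ⟨Real.arccos √(metric n p F F / metric n p v v),
    ⟨Real.arccos_nonneg _, Real.arccos_le_pi_div_two.2 (Real.sqrt_nonneg _)⟩, F, hF, hFn, ?_⟩
  rw [Real.cos_arccos (by linarith [Real.sqrt_nonneg (metric n p F F / metric n p v v)]),
    Real.sq_sqrt hq0, div_mul_cancel₀ _ hvv.ne']
  rw [Real.sqrt_le_one, div_le_one hvv]
  linarith

/-- An isometry that preserves a tube and maps one of its points to another one maps the normal
geodesic through the first point to the normal geodesic through the second one. -/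
theorem isometry_comp_normal_geodesic (h : IsConfig ℓ ξ) {r : ℝ} (hr : 0 < r)
    {F : EuclideanSpace ℂ (Fin n) → EuclideanSpace ℂ (Fin n)}
    (hF : F ∈ isometries (metric n) (CH n))
    (hFM : F '' tube (metric n) (CH n) (focalSet ℓ ξ) r =
      tube (metric n) (CH n) (focalSet ℓ ξ) r)
    {γ σ : ℝ → EuclideanSpace ℂ (Fin n)}
    (hγ : IsGeodesic (metric n) (CH n) γ) (hγ0 : γ 0 ∈ focalSet ℓ ξ)
    (hγ1 : IsUnitNormal (metric n) (focalSet ℓ ξ) (γ 0) (deriv γ 0))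
    (hσ : IsGeodesic (metric n) (CH n) σ) (hσ0 : σ 0 ∈ focalSet ℓ ξ)
    (hσ1 : IsUnitNormal (metric n) (focalSet ℓ ξ) (σ 0) (deriv σ 0))
    (hFr : F (γ r) = σ r) : F ∘ γ = σ := by
  set M := tube (metric n) (CH n) (focalSet ℓ ξ) r with hMdef
  have hMeq : M = {z | z ∈ CH n ∧ isoFun ℓ ξ z = Real.sinh (r / 2) ^ 2} := h.tube_eq hr
  have hsinh : 0 < Real.sinh (r / 2) := Real.sinh_pos_iff.2 (by linarith)
  have hcosh := Real.cosh_pos (r / 2)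
  obtain ⟨hγf, hγu⟩ := h.normal_geodesic hγ hγ0 hγ1
  obtain ⟨hσf, hσu⟩ := h.normal_geodesic hσ hσ0 hσ1
  have hp := hγ.mem r
  have hq := hσ.mem r
  have hpM : γ r ∈ M := ⟨γ, hγ, hγ0, hγ1, rfl⟩
  have hdF : DifferentiableAt ℝ F (γ r) :=
    (hF.2.1.contDiffAt (isOpen_CH.mem_nhds hp)).differentiableAt (by simp)
  have hdq : DifferentiableAt ℝ (isoFun ℓ ξ) (σ r) :=
    (h.contDiffAt_isoFun hq).differentiableAt (by simp)
  -- the differential of `F` maps the tangent space of the tube, which is orthogonal to the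
  -- velocity of the normal geodesic, to the tangent space
  have hker : ∀ u, metric n (γ r) (deriv γ r) u = 0 →
      metric n (σ r) (deriv σ r) (fderiv ℝ F (γ r) u) = 0 := by
    intro u hu
    rw [h.deriv_normal_geodesic hγ hγ0 hγ1 hr.ne', map_smul, smul_apply,
      isRiemannian_metric.gradient_apply hp, smul_eq_zero, or_iff_right (by positivity)] at hu
    have h1 : u ∈ tangentSubspace M (γ r) := by
      refine (mem_tangentSubspace_iff hpM (h.contDiffAt_isoFun hp)
        (h.fderiv_isoFun_ne_zero hp (by rw [hγf]; positivity)) (c := Real.sinh (r / 2) ^ 2)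
        ?_).2 hu
      filter_upwards [isOpen_CH.mem_nhds hp] with z hz
      rw [hMeq]
      exact ⟨fun h => h.2, fun h => ⟨hz, h⟩⟩
    have hdq' : DifferentiableAt ℝ (isoFun ℓ ξ) (F (γ r)) := by rwa [hFr]
    have h2 := tangentSubspace_le (h := isoFun ℓ ξ ∘ F) (hdq'.comp _ hdF)
      (c := Real.sinh (r / 2) ^ 2) (Filter.Eventually.of_forall fun z hz => by
        have : F z ∈ M := by rw [← hFM]; exact ⟨z, hz, rfl⟩
        rw [hMeq] at this
        exact this.2) h1
    rw [fderiv_comp _ hdq' hdF, ContinuousLinearMap.comp_apply, hFr] at h2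
    rw [h.deriv_normal_geodesic hσ hσ0 hσ1 hr.ne', map_smul, smul_apply,
      isRiemannian_metric.gradient_apply hq, h2, smul_zero]
  have hmet := hF.2.2 (γ r) hp
  rw [hFr] at hmet
  set X := fderiv ℝ F (γ r) (deriv γ r) with hX
  set Y := deriv σ r with hY
  have hXX : metric n (σ r) X X = 1 := by rw [hX, hmet, hγu]
  have hYY : metric n (σ r) Y Y = 1 := hσu r
  have hXY := isRiemannian_metric.symm _ hq X Y
  -- so the image of the unit normal vector is a unit normal vector
  have hsq : metric n (σ r) Y X ^ 2 = 1 := by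
    obtain ⟨u, hu⟩ := isRiemannian_metric.isometry_surjective hF hp (Y - metric n (σ r) Y X • X)
    have h1 : metric n (γ r) (deriv γ r) u = 0 := by
      rw [← hmet, hu, ← hX, map_sub, map_smul, hXX, hXY]
      simp
    have h2 := hker u h1
    rw [hu, map_sub, map_smul, hYY, smul_eq_mul] at h2
    linarith
  have hFγ := (isRiemannian_metric (n := n)).isGeodesic_comp hF hγ
  have hdγ : HasDerivAt γ (deriv γ r) r :=
    (hγ.smooth.contDiffAt.differentiableAt (by simp)).hasDerivAt
  have hdσ : HasDerivAt σ Y r := (hσ.smooth.contDiffAt.differentiableAt (by simp)).hasDerivAt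
  have hd1 : deriv (F ∘ γ) r = X := (hdF.hasFDerivAt.comp_hasDerivAt r hdγ).deriv
  have hzero : ∀ w, metric n (σ r) w w = 0 → w = 0 := fun w hw => by
    by_contra hne
    exact (isRiemannian_metric.pos _ hq w hne).ne' hw
  rcases sq_eq_sq_iff_eq_or_eq_neg.1 (hsq.trans (one_pow 2).symm) with h1 | h1
  · refine geodesic_unique hFγ hσ (t₀ := r) hFr ?_
    rw [hd1, ← hY, ← sub_eq_zero]
    apply hzero
    simp only [map_sub, sub_apply, hXX, hYY, hXY, h1]
    ring
  · exfalso
    -- if `F` reversed the normal geodesic, then it would map the point `γ (-r)` of the tube to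
    -- `σ (3 r)`, which is not in the tube
    have h2 : F ∘ γ = fun t => σ ((-1) * t + 2 * r) := by
      refine geodesic_unique hFγ (hσ.reparam (-1) (2 * r)) (t₀ := r) ?_ ?_
      · rw [Function.comp_apply, hFr]; congr 1; ring
      · have h3 : HasDerivAt (fun t : ℝ => (-1) * t + 2 * r) (-1) r := by
          simpa using ((hasDerivAt_id r).const_mul (-1)).add_const (2 * r)
        have h4 : HasDerivAt σ Y ((-1) * r + 2 * r) := by
          rwa [show (-1) * r + 2 * r = r by ring]
        have h5 : deriv (fun t => σ ((-1) * t + 2 * r)) r = (-1 : ℝ) • Y := (h4.scomp r h3).deriv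
        rw [hd1, h5, ← sub_eq_zero]
        apply hzero
        simp only [neg_smul, one_smul, sub_neg_eq_add, map_add, add_apply, hXX, hYY, hXY, h1]
        ring
    have h3 : γ (-r) ∈ M := by
      rw [hMeq]
      refine ⟨hγ.mem _, ?_⟩
      rw [hγf, neg_div, Real.sinh_neg, neg_sq]
    have h4 : F (γ (-r)) ∈ M := by rw [← hFM]; exact ⟨_, h3, rfl⟩
    have h5 := congrFun h2 (-r)
    rw [Function.comp_apply] at h5
    rw [h5, hMeq] at h4
    have h6 := h4.2
    rw [hσf] at h6
    have h7 : Real.sinh (r / 2) < Real.sinh (((-1) * -r + 2 * r) / 2) :=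
      Real.sinh_lt_sinh.2 (by linarith)
    nlinarith

/-- If the tubes are homogeneous, then the normal space has constant Kähler angle: the isometries
that move the normal geodesics at `p` to each other fix `p`, they preserve the normal space, and
their differentials commute or anticommute with `J`. -/
theorem hasConstantKahlerAngle_of_isHomogeneous (h : IsConfig ℓ ξ) {r : ℝ} (hr : 0 < r)
    (hp : p ∈ focalSet ℓ ξ) (hM : IsHomogeneous (isometries (metric n) (CH n))
      (tube (metric n) (CH n) (focalSet ℓ ξ) r)) :
    HasConstantKahlerAngle p (normalSpace ℓ ξ p) := by
  have hexg : ∀ v, IsUnitNormal (metric n) (focalSet ℓ ξ) p v →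
      ∃ γ, IsGeodesic (metric n) (CH n) γ ∧ γ 0 = p ∧ deriv γ 0 = v := by
    intro v hv
    obtain ⟨c, hc, rfl⟩ := (h.isUnitNormal_iff hp).1 hv
    exact h.exists_normal_geodesic hp hc
  have hscale : ∀ v ∈ normalSpace ℓ ξ p, v ≠ 0 → ∃ c : ℝ, c ≠ 0 ∧
      IsUnitNormal (metric n) (focalSet ℓ ξ) p (c • v) := by
    intro v hv hne
    have hpos := isRiemannian_metric.pos p hp.1 v hne
    refine ⟨(√(metric n p v v))⁻¹, inv_ne_zero (Real.sqrt_pos.2 hpos).ne',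
      (h.isUnitNormal_iff_mem hp).2 ⟨Submodule.smul_mem _ _ hv, ?_⟩⟩
    simp only [map_smul, smul_apply, smul_eq_mul]
    rw [← mul_assoc, ← mul_inv, Real.mul_self_sqrt hpos.le, inv_mul_cancel₀ hpos.ne']
  by_cases htriv : ∀ v ∈ normalSpace ℓ ξ p, v = 0
  · exact ⟨0, fun v hv hne => absurd (htriv v hv) hne⟩
  push Not at htriv
  obtain ⟨u, hu, hune⟩ := htriv
  obtain ⟨φ, hφ⟩ := h.exists_isKahlerAngle hp hune
  refine ⟨φ, fun v hv hvne => ?_⟩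
  obtain ⟨a, ha, hua⟩ := hscale u hu hune
  obtain ⟨b, hb, hvb⟩ := hscale v hv hvne
  obtain ⟨γ, hγ, hγ0, hγ1⟩ := hexg _ hua
  obtain ⟨σ, hσ, hσ0, hσ1⟩ := hexg _ hvb
  obtain ⟨F, hF, hFM, hFr⟩ := hM (γ r) ⟨γ, hγ, by rwa [hγ0], by rwa [hγ0, hγ1], rfl⟩
    (σ r) ⟨σ, hσ, by rwa [hσ0], by rwa [hσ0, hσ1], rfl⟩
  have hFγ := h.isometry_comp_normal_geodesic hr hF hFM hγ (by rwa [hγ0]) (by rwa [hγ0, hγ1]) hσ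
    (by rwa [hσ0]) (by rwa [hσ0, hσ1]) hFr
  have hFp : F p = p := by
    have := congrFun hFγ 0
    rwa [Function.comp_apply, hγ0, hσ0] at this
  have hdF : DifferentiableAt ℝ F p :=
    (hF.2.1.contDiffAt (isOpen_CH.mem_nhds hp.1)).differentiableAt (by simp)
  have hderiv : ∀ {τ : ℝ → EuclideanSpace ℂ (Fin n)} {w}, IsGeodesic (metric n) (CH n) τ →
      τ 0 = p → deriv τ 0 = w → deriv (F ∘ τ) 0 = fderiv ℝ F p w := by
    intro τ w hτ hτ0 hτ1
    have h1 : HasDerivAt τ w 0 := by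
      rw [← hτ1]; exact (hτ.smooth.contDiffAt.differentiableAt (by simp)).hasDerivAt
    have h2 : HasFDerivAt F (fderiv ℝ F p) (τ 0) := by rw [hτ0]; exact hdF.hasFDerivAt
    exact (h2.comp_hasDerivAt 0 h1).deriv
  have hmet := hF.2.2 p hp.1
  rw [hFp] at hmet
  set L := fderiv ℝ F p with hL
  have hLu : L (a • u) = b • v := by rw [← hderiv hγ hγ0 hγ1, hFγ, hσ1]
  -- the differential of `F` preserves the normal space, since `F` maps the normal geodesics at
  -- `p` to normal geodesics at `p`
  have hmap : ∀ w ∈ normalSpace ℓ ξ p, L w ∈ normalSpace ℓ ξ p := by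
    intro w hw
    rcases eq_or_ne w 0 with rfl | hwne
    · simp
    obtain ⟨c, hc, hwc⟩ := hscale w hw hwne
    obtain ⟨τ, hτ, hτ0, hτ1⟩ := hexg _ hwc
    have hτM : F (τ r) ∈ tube (metric n) (CH n) (focalSet ℓ ξ) r := by
      rw [← hFM]; exact ⟨_, ⟨τ, hτ, by rwa [hτ0], by rwa [hτ0, hτ1], rfl⟩, rfl⟩
    obtain ⟨ρ, hρ, hρ0, hρ1, hρr⟩ := hτM
    have hFτ := h.isometry_comp_normal_geodesic hr hF hFM hτ (by rwa [hτ0]) (by rwa [hτ0, hτ1]) hρ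
      hρ0 hρ1 hρr.symm
    have hρp : ρ 0 = p := by
      rw [← hFτ, Function.comp_apply, hτ0, hFp]
    rw [hρp, ← hFτ, hderiv hτ hτ0 hτ1] at hρ1
    have h3 := ((h.isUnitNormal_iff_mem hp).1 hρ1).1
    rw [map_smul] at h3
    exact (Submodule.smul_mem_iff _ hc).1 h3
  have hsurj : ∀ w ∈ normalSpace ℓ ξ p, ∃ w' ∈ normalSpace ℓ ξ p, L w' = w := by
    have hinj : Function.Injective (LinearMap.restrict
        (L : EuclideanSpace ℂ (Fin n) →ₗ[ℝ] EuclideanSpace ℂ (Fin n)) hmap) := by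
      intro x y hxy
      exact Subtype.ext (isRiemannian_metric.isometry_injective hF hp.1 (congrArg Subtype.val hxy))
    intro w hw
    obtain ⟨w', hw'⟩ := LinearMap.injective_iff_surjective.1 hinj ⟨w, hw⟩
    exact ⟨w', w'.2, congrArg Subtype.val hw'⟩
  obtain ⟨hφ0, P, hP, hPn, hPP⟩ := hφ
  -- `v = (a / b) L u`, so that `J v = ± (a / b) L (J u)`
  have hv' : v = (b⁻¹ * a) • L u := by
    rw [map_smul] at hLu
    rw [mul_smul, hLu, inv_smul_smul₀ hb]
  obtain ⟨ε, hε, hJ⟩ : ∃ ε : ℝ, ε ^ 2 = 1 ∧ Complex.I • L u = ε • L (Complex.I • u) := by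
    rcases isometry_fderiv_I hF hp.1 hFp u with h1 | h1
    · exact ⟨1, by norm_num, by rw [one_smul, h1]⟩
    · exact ⟨-1, by norm_num, by rw [h1, neg_smul, one_smul, neg_neg]⟩
  refine ⟨hφ0, ((b⁻¹ * a) * ε) • L P, Submodule.smul_mem _ _ (hmap P hP), fun η hη => ?_, ?_⟩
  · obtain ⟨η', hη', rfl⟩ := hsurj η hη
    rw [hv', smul_comm, hJ, smul_smul, ← smul_sub, ← map_sub, map_smul, smul_apply, hmet,
      hPn η' hη', smul_zero]
  · rw [hv']
    simp only [map_smul, smul_apply, smul_eq_mul]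
    rw [hmet, hmet, hPP]
    linear_combination (b⁻¹ * a) ^ 2 * (Real.cos φ ^ 2 * metric n p u u) * hε

end IsConfig

/-! ### Witt's theorem and the isotropy group -/

/-- Orthogonal transformations that commute with a skew-symmetric transformation `Ω` such that
`|Ω z|² = κ |z|²` act transitively on the vectors of the same length. The transformation is the
Householder reflection for the Hermitian form `z ⬝ w + i κ⁻¹ᐟ² (Ω z ⬝ w)`; if `κ = 0`, then
`Ω = 0` and `κ⁻¹ = 0`, and it is the Euclidean reflection. -/
theorem exists_orthogonal_commuting {k : ℕ} (Ω : (Fin k → ℝ) →ₗ[ℝ] Fin k → ℝ)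
    (hΩ : ∀ z w, Ω z ⬝ᵥ w = -(z ⬝ᵥ Ω w)) {κ : ℝ} (hκ : ∀ z, Ω z ⬝ᵥ Ω z = κ * (z ⬝ᵥ z))
    {x y : Fin k → ℝ} (hxy : x ⬝ᵥ x = y ⬝ᵥ y) :
    ∃ T : (Fin k → ℝ) →ₗ[ℝ] Fin k → ℝ, (∀ z w, T z ⬝ᵥ T w = z ⬝ᵥ w) ∧
      (∀ z w, T z ⬝ᵥ Ω (T w) = z ⬝ᵥ Ω w) ∧ T x = y := by
  rcases eq_or_ne x y with rfl | hne
  · exact ⟨LinearMap.id, fun _ _ => rfl, fun _ _ => rfl, rfl⟩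
  have hκ' : ∀ z w, Ω z ⬝ᵥ Ω w = κ * (z ⬝ᵥ w) := by
    intro z w
    have h1 := hκ (z + w)
    simp only [map_add, add_dotProduct, dotProduct_add, hκ] at h1
    rw [dotProduct_comm w z, dotProduct_comm (Ω w)] at h1
    linarith
  set v := x - y with hv
  set α := v ⬝ᵥ x with hα
  set β := Ω v ⬝ᵥ x with hβ
  have hvv : v ⬝ᵥ v = 2 * α := by
    rw [hα, hv]
    simp only [sub_dotProduct, dotProduct_sub, dotProduct_comm y x]
    linarith
  have hα0 : α ≠ 0 := by
    intro h0
    rw [h0, mul_zero, dotProduct_self_eq_zero] at hvv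
    exact hne (sub_eq_zero.1 hvv)
  have hκ0 : 0 ≤ κ := by
    have h1 := hκ v
    have h2 : 0 ≤ Ω v ⬝ᵥ Ω v := by
      simpa using dotProduct_star_self_nonneg (Ω v)
    have h3 : 0 ≤ v ⬝ᵥ v := by simpa using dotProduct_star_self_nonneg v
    have h4 : 0 < v ⬝ᵥ v := lt_of_le_of_ne h3 (by rw [hvv]; exact (mul_ne_zero two_ne_zero hα0).symm)
    by_contra hlt
    push Not at hlt
    nlinarith
  have hμΩ : ∀ z, κ⁻¹ * κ * (Ω v ⬝ᵥ z) = Ω v ⬝ᵥ z := by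
    intro z
    rcases eq_or_ne κ 0 with h0 | h0
    · have : Ω v = 0 := by
        rw [← dotProduct_self_eq_zero, hκ, h0, zero_mul]
      rw [this, zero_dotProduct, mul_zero]
    · rw [inv_mul_cancel₀ h0, one_mul]
  have hμ : κ⁻¹ * (κ⁻¹ * κ) = κ⁻¹ := by
    rcases eq_or_ne κ 0 with h0 | h0
    · simp [h0]
    · rw [inv_mul_cancel₀ h0, mul_one]
  have hμ0 : 0 ≤ κ⁻¹ := inv_nonneg.2 hκ0
  have hΩv : Ω v ⬝ᵥ v = 0 := by
    have := hΩ v v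
    rw [dotProduct_comm v] at this
    linarith
  have hμβ : κ⁻¹ * κ * β = β := hμΩ x
  generalize κ⁻¹ = μ at *
  set N := α ^ 2 + μ * β ^ 2 with hN
  have hN0 : N ≠ 0 := by
    have : 0 < α ^ 2 := by positivity
    have : 0 ≤ μ * β ^ 2 := by positivity
    rw [hN]; positivity
  -- the real part, and the imaginary part divided by `κ ^ (1/2)`, of the quotient of the
  -- Hermitian products of `v` with `z` and with `x`
  let p : (Fin k → ℝ) → ℝ := fun z => (α * (v ⬝ᵥ z) + μ * β * (Ω v ⬝ᵥ z)) / N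
  let q : (Fin k → ℝ) → ℝ := fun z => (α * μ * (Ω v ⬝ᵥ z) - μ * β * (v ⬝ᵥ z)) / N
  let T : (Fin k → ℝ) →ₗ[ℝ] Fin k → ℝ :=
    { toFun := fun z => z - p z • v - q z • Ω v
      map_add' := fun z w => by
        have h1 : p (z + w) = p z + p w := by simp only [p, dotProduct_add]; ring
        have h2 : q (z + w) = q z + q w := by simp only [q, dotProduct_add]; ring
        rw [h1, h2]
        module
      map_smul' := fun c z => by
        have h1 : p (c • z) = c * p z := by simp only [p, dotProduct_smul, smul_eq_mul]; ring
        have h2 : q (c • z) = c * q z := by simp only [q, dotProduct_smul, smul_eq_mul]; ring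
        rw [h1, h2, RingHom.id_apply]
        module }
  have hT : ∀ z, T z = z - p z • v - q z • Ω v := fun _ => rfl
  have horth : ∀ z w, T z ⬝ᵥ T w = z ⬝ᵥ w := by
    intro z w
    rw [hT, hT]
    simp only [sub_dotProduct, dotProduct_sub, smul_dotProduct, dotProduct_smul, smul_eq_mul,
      hΩv, hκ, hvv, dotProduct_comm v (Ω v), dotProduct_comm z v, dotProduct_comm z (Ω v), p, q]
    have e1 := hμΩ z
    have e2 := hμΩ w
    generalize v ⬝ᵥ z = a at *
    generalize v ⬝ᵥ w = b at *
    generalize Ω v ⬝ᵥ z = c at *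
    generalize Ω v ⬝ᵥ w = d at *
    field_simp
    rw [hN]
    have e3 : μ * κ * μ = μ := by linear_combination hμ
    linear_combination (2 * α * (α * c - β * a) * (α * d - β * b)) * e3
  have hcomm : ∀ z, Ω (T z) = T (Ω z) := by
    intro z
    have hΩΩ : Ω (Ω v) = -(κ • v) := by
      refine dotProduct_eq _ _ fun w => ?_
      rw [hΩ, hκ', neg_dotProduct, smul_dotProduct, smul_eq_mul]
    have e1 : κ * q z = -p (Ω z) := by
      simp only [p, q, hκ', ← neg_eq_iff_eq_neg.2 (hΩ v z)]
      rw [← neg_div, mul_div_assoc']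
      congr 1
      linear_combination α * hμΩ z
    have e2 : q (Ω z) = p z + α * (v ⬝ᵥ z) / N * (μ * κ - 1) := by
      simp only [p, q, hκ', ← neg_eq_iff_eq_neg.2 (hΩ v z)]
      field_simp
      ring
    have e3 : (μ * κ) • Ω v = Ω v := by
      refine dotProduct_eq _ _ fun w => ?_
      rw [smul_dotProduct, smul_eq_mul, hμΩ]
    have e4 : q (Ω z) • Ω v = p z • Ω v := by
      rw [e2, add_smul, mul_smul, sub_smul, e3, one_smul, sub_self, smul_zero, add_zero]
    rw [hT, hT, map_sub, map_sub, map_smul, map_smul, hΩΩ, smul_neg, smul_smul, mul_comm (q z), e1,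
      e4]
    module
  refine ⟨T, horth, fun z w => by rw [hcomm, horth], ?_⟩
  have e1 : p x = 1 := by
    simp only [p, ← hα, ← hβ]
    rw [div_eq_one_iff_eq hN0, hN]
    ring
  have e2 : q x = 0 := by
    simp only [q, ← hα, ← hβ]
    rw [div_eq_zero_iff]
    left
    ring
  rw [hT, e1, e2, one_smul, zero_smul, sub_zero, hv, sub_sub_cancel]

/-- Witt's theorem for families with the same Gram matrix that are orthogonal to two vectors `ℓ`
and `m` which span a Lorentzian plane. -/
theorem exists_preserves_family {ι : Type*} {ℓ m : Fin (n + 1) → ℂ}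
    (hneg : (hform n (ℓ + m) (ℓ + m)).re < 0) {x y : ι → Fin (n + 1) → ℂ}
    (hxℓ : ∀ i, hform n ℓ (x i) = 0) (hxm : ∀ i, hform n m (x i) = 0)
    (hyℓ : ∀ i, hform n ℓ (y i) = 0) (hym : ∀ i, hform n m (y i) = 0)
    (hxy : ∀ i j, hform n (x i) (x j) = hform n (y i) (y j)) (s : Finset ι) :
    ∃ A : Mat n, Preserves A ∧ A.mulVec ℓ = ℓ ∧ A.mulVec m = m ∧ ∀ i ∈ s, A.mulVec (x i) = y i := by
  classical
  induction s using Finset.induction_on with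
  | empty => exact ⟨1, Preserves.one, by simp, by simp, by simp⟩
  | insert a s _ ih =>
    obtain ⟨A, hA, hAℓ, hAm, hAs⟩ := ih
    rcases eq_or_ne (A.mulVec (x a)) (y a) with heq | hne
    · refine ⟨A, hA, hAℓ, hAm, fun i hi => ?_⟩
      rcases Finset.mem_insert.1 hi with rfl | hi
      exacts [heq, hAs i hi]
    have hℓ : hform n ℓ (A.mulVec (x a)) = 0 := by
      have := hA ℓ (x a)
      rwa [hAℓ, hxℓ] at this
    have hm : hform n m (A.mulVec (x a)) = 0 := by
      have := hA m (x a)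
      rwa [hAm, hxm] at this
    have haa : hform n (A.mulVec (x a)) (A.mulVec (x a)) = hform n (y a) (y a) := by
      rw [hA, hxy]
    have hpos := hform_pos_of_ortho hneg (x := A.mulVec (x a) - y a)
      (by simp only [hform_add_left, hform_sub_right, hℓ, hm, hyℓ, hym]; ring) (sub_ne_zero.2 hne)
    obtain ⟨R, hR, hRx, hRz⟩ := exists_preserves_mulVec_eq haa (by
      intro h0
      have h1 : (hform n (A.mulVec (x a) - y a) (y a)).re =
          -(hform n (A.mulVec (x a) - y a) (A.mulVec (x a))).re := by
        simp only [hform_sub_left, haa, Complex.sub_re]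
        rw [hform_re_comm (y a) (A.mulVec (x a))]
        ring
      rw [hform_sub_right, Complex.sub_re, h1, h0] at hpos
      simp at hpos)
    have hflip : ∀ u w : Fin (n + 1) → ℂ, hform n u w = 0 → hform n w u = 0 := fun u w h => by
      rw [← hform_conj, h, map_zero]
    -- the reflection `R` corrects the image of `x a`; it fixes `ℓ`, `m` and the earlier `y i`,
    -- which have the same product with `A (x a)` and `y a`
    refine ⟨R * A, hR.mul hA, ?_, ?_, fun i hi => ?_⟩
    · rw [← Matrix.mulVec_mulVec, hAℓ, hRz _ (by rw [hflip _ _ hℓ, hflip _ _ (hyℓ a)])]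
    · rw [← Matrix.mulVec_mulVec, hAm, hRz _ (by rw [hflip _ _ hm, hflip _ _ (hym a)])]
    · rw [← Matrix.mulVec_mulVec]
      rcases Finset.mem_insert.1 hi with rfl | hi
      · exact hRx
      · rw [hAs i hi, hRz _ (by rw [← hAs i hi, hA, hxy, hAs i hi])]

theorem preserves_iff {A : Mat n} : Preserves A ↔ A.conjTranspose * form n * A = form n := by
  have hf : ∀ x y : Fin (n + 1) → ℂ, hform n x y = star x ⬝ᵥ (form n).mulVec y := by
    intro x y
    rw [hform_apply, form, dotProduct, Fin.sum_univ_succ]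
    simp [Matrix.mulVec_diagonal]
  have hA : ∀ x y, hform n (A.mulVec x) (A.mulVec y) =
      star x ⬝ᵥ (A.conjTranspose * form n * A).mulVec y := by
    intro x y
    rw [hf, Matrix.star_mulVec, ← Matrix.dotProduct_mulVec, Matrix.mulVec_mulVec,
      Matrix.mulVec_mulVec, mul_assoc]
  constructor
  · intro h
    ext i j
    have h1 := h (Pi.single i 1) (Pi.single j 1)
    rw [hA, hf] at h1
    simpa using h1
  · intro h x y
    rw [hA, h, hf]

theorem Preserves.of_mem_SU {A : (Mat n)ˣ} (hA : A ∈ SU n) : Preserves (A : Mat n) :=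
  preserves_iff.2 hA.1

/-- Every linear isometry of `ℂ^{1,n}` acts on the ball like an element of `SU(1,n)`. -/
theorem Preserves.exists_mem_SU {A : Mat n} (hA : Preserves A) :
    ∃ B ∈ SU n, act (B : Mat n) = act A := by
  have h1 := preserves_iff.1 hA
  have hf : (form n).det ≠ 0 := by
    rw [form, Matrix.det_diagonal, Fin.prod_univ_succ]
    simp
  have hd : conj A.det * A.det = 1 := by
    have h2 := congrArg Matrix.det h1
    rw [Matrix.det_mul, Matrix.det_mul, Matrix.det_conjTranspose] at h2
    have h3 : (conj A.det * A.det - 1) * (form n).det = 0 := by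
      have : star A.det = conj A.det := rfl
      rw [this] at h2
      linear_combination h2
    exact sub_eq_zero.1 ((mul_eq_zero.1 h3).resolve_right hf)
  have hd0 : A.det ≠ 0 := by
    intro h0
    rw [h0, mul_zero] at hd
    exact zero_ne_one hd
  -- multiplying `A` by an `(n + 1)`-th root of the inverse of its determinant does not change the
  -- action on the ball and makes the determinant one
  obtain ⟨c, hc⟩ := IsAlgClosed.exists_pow_nat_eq (A.det)⁻¹ (Nat.succ_pos n)
  have hc1 : conj c * c = 1 := by
    have h2 : ‖c‖ ^ (n + 1) = 1 := by
      have h3 : ‖A.det‖ = 1 := by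
        rw [mul_comm, Complex.mul_conj, ← Complex.ofReal_one, Complex.ofReal_inj,
          Complex.normSq_eq_norm_sq] at hd
        exact (pow_eq_one_iff_of_nonneg (norm_nonneg _) two_ne_zero).1 hd
      rw [← norm_pow, hc, norm_inv, h3, inv_one]
    have h4 : ‖c‖ = 1 := (pow_eq_one_iff_of_nonneg (norm_nonneg c) (Nat.succ_ne_zero n)).1 h2
    rw [mul_comm, Complex.mul_conj, Complex.normSq_eq_norm_sq, h4]
    simp
  have hc0 : c ≠ 0 := by
    rintro rfl
    rw [mul_zero] at hc1
    exact zero_ne_one hc1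
  have hdet : (c • A).det = 1 := by
    rw [Matrix.det_smul, Fintype.card_fin, hc, inv_mul_cancel₀ hd0]
  have hu : IsUnit (c • A) := (Matrix.isUnit_iff_isUnit_det _).2 (by rw [hdet]; exact isUnit_one)
  refine ⟨hu.unit, ⟨?_, hdet⟩, ?_⟩
  · show (c • A).conjTranspose * form n * (c • A) = form n
    rw [Matrix.conjTranspose_smul, smul_mul_assoc, smul_mul_assoc, mul_smul_comm, h1, smul_smul]
    have : star c * c = 1 := hc1
    rw [this, one_smul]
  · funext z
    show act (c • A) z = act A z
    rw [act_eq, Matrix.smul_mulVec, pr_smul hc0, act_eq]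

/-! ### Constant Kähler angle implies homogeneity -/

/-- The image of a unit normal vector under an isometry that preserves the submanifold. -/
theorem IsUnitNormal.fderiv_isometry {E : Type*} [NormedAddCommGroup E] [NormedSpace ℝ E]
    {g : E → E →L[ℝ] E →L[ℝ] ℝ} {U W : Set E} (hU : IsOpen U) (hWU : W ⊆ U) {F G : E → E}
    (hF : F ∈ isometries g U) (hG : G ∈ isometries g U) (hFG : ∀ z ∈ U, F (G z) = z)
    (hGF : ∀ z ∈ U, G (F z) = z) (hGW : ∀ z ∈ W, G z ∈ W) {p η : E} (hp : p ∈ W)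
    (hη : IsUnitNormal g W p η) : IsUnitNormal g W (F p) (fderiv ℝ F p η) := by
  have hpU := hWU hp
  have hFpU : F p ∈ U := hF.1.mapsTo hpU
  have hcd : ∀ {H : E → E}, H ∈ isometries g U → ∀ z ∈ U, ContDiffAt ℝ ∞ H z := fun hH z hz =>
    hH.2.1.contDiffAt (hU.mem_nhds hz)
  refine ⟨by rw [hF.2.2 p hpU, hη.1], fun v hv => ?_⟩
  have h1 : fderiv ℝ G (F p) v ∈ tangentSubspace W p := by
    have h2 : tangentSubspace W (F p) ≤
        (tangentSubspace W p).comap (fderiv ℝ G (F p) : E →ₗ[ℝ] E) := by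
      refine Submodule.span_le.2 ?_
      rintro v ⟨c, hc, hcW, hc0, rfl⟩
      refine Submodule.subset_span ⟨G ∘ c, ?_, hcW.mono fun t ht => hGW _ ht, ?_, ?_⟩
      · exact ContDiffAt.comp 0 (by rw [hc0]; exact hcd hG _ hFpU) hc
      · rw [Function.comp_apply, hc0, hGF p hpU]
      · have h3 : HasFDerivAt G (fderiv ℝ G (F p)) (c 0) := by
          rw [hc0]; exact ((hcd hG _ hFpU).differentiableAt (by simp)).hasFDerivAt
        exact (h3.comp_hasDerivAt 0 (hc.differentiableAt (by simp)).hasDerivAt).deriv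
    exact h2 hv
  have h4 : fderiv ℝ F p (fderiv ℝ G (F p) v) = v := by
    have h5 : HasFDerivAt F (fderiv ℝ F p) (G (F p)) := by
      rw [hGF p hpU]; exact ((hcd hF p hpU).differentiableAt (by simp)).hasFDerivAt
    have h6 := h5.comp (F p) ((hcd hG _ hFpU).differentiableAt (by simp)).hasFDerivAt
    have h7 : F ∘ G =ᶠ[𝓝 (F p)] id := by
      filter_upwards [hU.mem_nhds hFpU] with z hz using hFG z hz
    have h8 := h6.fderiv
    rw [h7.fderiv_eq, fderiv_id] at h8
    exact (congrArg (fun L : E →L[ℝ] E => L v) h8).symm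
  rw [← h4, hF.2.2 p hpU]
  exact hη.2 _ h1

/-- The moment functions are equivariant. -/
theorem moment_act {A : Mat n} (hA : Preserves A) {z : EuclideanSpace ℂ (Fin n)} (hz : z ∈ CH n)
    (x y : Fin (n + 1) → ℂ) : moment (A.mulVec x) (A.mulVec y) (act A z) = moment x y z := by
  have hneg := hform_lift_neg hz
  rw [act_eq, moment_pr (hA.hform_lift_neg hz), hA, hA, hA, ← moment_pr hneg, pr_lift]

/-- The linear isometries of `ℂ^{1,n}` that preserve the isoparametric function. -/
def PreservesIsoFun {k : ℕ} (ℓ : Fin (n + 1) → ℂ) (ξ : Fin k → Fin (n + 1) → ℂ) (A : Mat n) :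
    Prop :=
  Preserves A ∧ ∀ z ∈ CH n, isoFun ℓ ξ (act A z) = isoFun ℓ ξ z

theorem act_one (z : EuclideanSpace ℂ (Fin n)) : act (1 : Mat n) z = z := by
  rw [act_eq, Matrix.one_mulVec, pr_lift]

namespace PreservesIsoFun

variable {k : ℕ} {ℓ : Fin (n + 1) → ℂ} {ξ : Fin k → Fin (n + 1) → ℂ} {A B : Mat n}

theorem mul (hA : PreservesIsoFun ℓ ξ A) (hB : PreservesIsoFun ℓ ξ B) :
    PreservesIsoFun ℓ ξ (A * B) :=
  ⟨hA.1.mul hB.1, fun z hz => by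
    rw [hB.1.act_mul hz, hA.2 _ (hB.1.act_mem hz), hB.2 z hz]⟩

theorem exists_inv (hA : PreservesIsoFun ℓ ξ A) : ∃ B, PreservesIsoFun ℓ ξ B ∧
    (∀ z ∈ CH n, act A (act B z) = z) ∧ ∀ z ∈ CH n, act B (act A z) = z := by
  obtain ⟨B, hB, hAB, hBA⟩ := hA.1.exists_inv
  have h1 : ∀ z ∈ CH n, act A (act B z) = z := fun z hz => by
    rw [← hB.act_mul hz, hAB, act_one]
  refine ⟨B, ⟨hB, fun z hz => ?_⟩, h1, fun z hz => by rw [← hA.1.act_mul hz, hBA, act_one]⟩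
  rw [← hA.2 _ (hB.act_mem hz), h1 z hz]

end PreservesIsoFun

namespace IsConfig

variable {k : ℕ} {ℓ m : Fin (n + 1) → ℂ} {ξ : Fin k → Fin (n + 1) → ℂ}
  {o p z : EuclideanSpace ℂ (Fin n)}

theorem isoFun_eq_zero_iff (h : IsConfig ℓ ξ) (hz : z ∈ CH n) :
    isoFun ℓ ξ z = 0 ↔ z ∈ focalSet ℓ ξ := by
  have hφ := h.moment_pos hz
  rw [isoFun, Finset.sum_eq_zero_iff_of_nonneg (fun j _ => by positivity)]
  simp [focalSet, hz, hφ.ne']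

theorem act_mem_focalSet (h : IsConfig ℓ ξ) {A : Mat n} (hA : PreservesIsoFun ℓ ξ A)
    (hz : z ∈ focalSet ℓ ξ) : act A z ∈ focalSet ℓ ξ := by
  rw [← h.isoFun_eq_zero_iff (hA.1.act_mem hz.1), hA.2 z hz.1, h.isoFun_eq_zero_iff hz.1]
  exact hz

theorem act_image_tube (h : IsConfig ℓ ξ) {A : Mat n} (hA : PreservesIsoFun ℓ ξ A) {r : ℝ}
    (hr : 0 < r) : act A '' tube (metric n) (CH n) (focalSet ℓ ξ) r =
      tube (metric n) (CH n) (focalSet ℓ ξ) r := by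
  obtain ⟨B, hB, hAB, -⟩ := hA.exists_inv
  rw [h.tube_eq hr]
  apply Set.Subset.antisymm
  · rintro _ ⟨z, ⟨hz, hf⟩, rfl⟩
    exact ⟨hA.1.act_mem hz, by rw [hA.2 z hz, hf]⟩
  · rintro z ⟨hz, hf⟩
    exact ⟨act B z, ⟨hB.1.act_mem hz, by rw [hB.2 z hz, hf]⟩, hAB z hz⟩

/-- Transformations that rescale `ℓ` and move the `ξ_j` by imaginary multiples of `ℓ`. -/
theorem preservesIsoFun_of_adapted (h : IsConfig ℓ ξ) {A : Mat n} (hA : Preserves A) {c : ℝ}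
    (hc : c ≠ 0) (hAℓ : A.mulVec ℓ = (c : ℂ) • ℓ)
    (hAξ : ∀ j, ∃ s : ℝ, A.mulVec (ξ j) = ξ j + (s * Complex.I) • ℓ) :
    PreservesIsoFun ℓ ξ A := by
  refine ⟨hA, fun z hz => ?_⟩
  have hw := hA.act_mem hz
  have hs := (mem_CH.1 hw).ne'
  have h1 : moment ℓ ℓ z = c ^ 2 * moment ℓ ℓ (act A z) := by
    rw [← moment_act hA hz, hAℓ, moment, moment]
    simp only [hform_smul_left, map_mul, Complex.conj_ofReal]
    rw [mul_mul_mul_comm, ← Complex.ofReal_mul, Complex.re_ofReal_mul]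
    field_simp
  have h2 : ∀ j, moment (ξ j) ℓ z = c * moment (ξ j) ℓ (act A z) := by
    intro j
    obtain ⟨s, hs'⟩ := hAξ j
    rw [← moment_act hA hz, hs', hAℓ, moment, moment]
    simp only [hform_add_left, hform_smul_left, map_mul, Complex.conj_ofReal, Complex.conj_I]
    generalize hform n ℓ (lift (act A z)) = L
    generalize hform n (ξ j) (lift (act A z)) = a
    simp only [Complex.add_re, Complex.add_im, Complex.mul_re, Complex.mul_im, Complex.ofReal_re,
      Complex.ofReal_im, Complex.neg_re, Complex.neg_im, Complex.I_re, Complex.I_im,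
      Complex.conj_re, Complex.conj_im]
    field_simp
    ring
  have hφ := (h.moment_pos hw).ne'
  simp only [isoFun, h1, h2]
  refine Finset.sum_congr rfl fun j _ => ?_
  field_simp

/-- Transformations that fix `ℓ` and act on the span of the `ξ_j` by an orthogonal
transformation. -/
theorem preservesIsoFun_of_orthogonal {A : Mat n} (hA : Preserves A)
    (hAℓ : A.mulVec ℓ = ℓ) (T : (Fin k → ℝ) →ₗ[ℝ] Fin k → ℝ) (hT : ∀ x y, T x ⬝ᵥ T y = x ⬝ᵥ y)
    (hAT : ∀ x : Fin k → ℝ, A.mulVec (∑ j, (x j : ℂ) • ξ j) = ∑ j, (T x j : ℂ) • ξ j) :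
    PreservesIsoFun ℓ ξ A := by
  refine ⟨hA, fun z hz => ?_⟩
  have hsum : ∀ (x : Fin k → ℝ) w, moment (∑ j, (x j : ℂ) • ξ j) ℓ w =
      x ⬝ᵥ fun j => moment (ξ j) ℓ w := by
    intro x w
    simp only [moment, hform_sum_left, hform_smul_left, Complex.conj_ofReal, Finset.sum_mul,
      Complex.re_sum, mul_assoc, Complex.re_ofReal_mul, Finset.sum_div, mul_div_assoc]
    rfl
  have h1 : moment ℓ ℓ (act A z) = moment ℓ ℓ z := by
    rw [← moment_act hA hz ℓ ℓ, hAℓ]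
  set G : Fin k → ℝ := fun j => moment (ξ j) ℓ z with hG
  set G' : Fin k → ℝ := fun j => moment (ξ j) ℓ (act A z) with hG'
  have h2 : ∀ x, T x ⬝ᵥ G' = x ⬝ᵥ G := by
    intro x
    rw [hG, hG', ← hsum, ← hsum, ← moment_act hA hz _ ℓ, hAT, hAℓ]
  have hinj : Function.Injective T := by
    rw [← LinearMap.ker_eq_bot, LinearMap.ker_eq_bot']
    intro x hx
    rw [← dotProduct_self_eq_zero, ← hT, hx, zero_dotProduct]
  have h3 : G' = T G := by
    rw [← sub_eq_zero, ← dotProduct_self_eq_zero]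
    obtain ⟨x, hx⟩ := LinearMap.injective_iff_surjective.1 hinj (G' - T G)
    rw [← hx, hx, dotProduct_sub, ← hx, h2, hT, sub_self]
  have h4 : ∀ x : Fin k → ℝ, ∑ j, x j ^ 2 = x ⬝ᵥ x := fun x => by simp [dotProduct, pow_two]
  have h5 : ∑ j, G' j ^ 2 = ∑ j, G j ^ 2 := by rw [h4, h4, h3, hT]
  simp only [isoFun, h1, ← Finset.sum_div]
  rw [show ∑ j, moment (ξ j) ℓ (act A z) ^ 2 = ∑ j, moment (ξ j) ℓ z ^ 2 from h5]

section base

variable (h : IsConfig ℓ ξ) (hm : ∀ j, hform n m (ξ j) = 0)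
  (hneg : (hform n (ℓ + m) (ℓ + m)).re < 0) (ho : pr (ℓ + m) = o)

include h hm hneg ho

theorem base_ortho (j : Fin k) : hform n (ξ j) (lift o) = 0 := by
  have hmξ : hform n (ξ j) m = 0 := by rw [← hform_conj, hm, map_zero]
  rw [← ho, lift_pr (ne_zero_of_hform_neg hneg), hform_smul_right, hform_add_right, h.ortho', hmξ,
    add_zero, mul_zero]

theorem base_mem : o ∈ focalSet ℓ ξ := by
  refine ⟨ho ▸ pr_mem_CH hneg, fun j => ?_⟩
  rw [moment, h.base_ortho hm hneg ho]
  simp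

/-- The matrix of the complex structure on the normal space at the base point. -/
theorem metric_I_gradient (x : Fin k → ℝ) (i : Fin k) :
    metric n o (Complex.I • ∑ j, x j • gradient (metric n) (moment (ξ j) ℓ) o)
      (gradient (metric n) (moment (ξ i) ℓ) o) =
        -(moment ℓ ℓ o / 4) * ∑ j, (hform n (ξ i) (ξ j)).im * x j := by
  have hoC := (h.base_mem hm hneg ho).1
  have hs := (mem_CH.1 hoC).ne'
  have hξ0 := h.base_ortho hm hneg ho
  have hξ0' : ∀ j, hform n (lift o) (ξ j) = 0 := fun j => by rw [← hform_conj, hξ0, map_zero]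
  have hφ : moment ℓ ℓ o = Complex.normSq (hform n ℓ (lift o)) / (1 - ‖o‖ ^ 2) := by
    rw [moment, Complex.mul_conj, Complex.ofReal_re]
  have hg : ∀ j, gradient (metric n) (moment (ξ j) ℓ) o =
      proj o ((1 / 4 * hform n ℓ (lift o)) • ξ j) := by
    intro j
    rw [gradient_moment _ _ hoC, momentVec, hξ0, zero_smul, zero_add, smul_smul]
  rw [isRiemannian_metric.symm _ hoC, Finset.smul_sum, map_sum, Finset.mul_sum]
  refine Finset.sum_congr rfl fun j _ => ?_
  rw [smul_comm, map_smul, hg, hg, ← LinearMap.map_smul (proj o) Complex.I, metric_proj hoC]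
  simp only [hform_smul_left, hform_smul_right, hξ0, hξ0', mul_zero, Complex.zero_re, zero_div,
    add_zero, hφ, smul_eq_mul]
  have e1 : Complex.I * (1 / 4 * hform n ℓ (lift o) * (conj (1 / 4 * hform n ℓ (lift o)) *
      hform n (ξ i) (ξ j))) = ((Complex.normSq (hform n ℓ (lift o)) / 16 : ℝ) : ℂ) *
        (Complex.I * hform n (ξ i) (ξ j)) := by
    have h4 : conj (1 / 4 : ℂ) = 1 / 4 := by
      rw [show (1 / 4 : ℂ) = ((1 / 4 : ℝ) : ℂ) by push_cast; ring, Complex.conj_ofReal]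
    rw [map_mul, h4]
    push_cast
    rw [Complex.normSq_eq_conj_mul_self]
    ring
  rw [e1, Complex.re_ofReal_mul]
  simp only [Complex.mul_re, Complex.I_re, Complex.I_im]
  field_simp
  ring

/-- In terms of the skew matrix `Ω = (Im [ξ_i, ξ_j])`, which represents the projection of `J` to
the normal space up to sign, constant Kähler angle `φ` means that `|Ω x|² = cos² φ |x|²`. -/
theorem exists_kahler_const (hK : HasConstantKahlerAngle o (normalSpace ℓ ξ o)) :
    ∃ κ : ℝ, ∀ x : Fin k → ℝ,
      (Matrix.of fun i j => (hform n (ξ i) (ξ j)).im).mulVec x ⬝ᵥ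
        (Matrix.of fun i j => (hform n (ξ i) (ξ j)).im).mulVec x = κ * (x ⬝ᵥ x) := by
  obtain ⟨φ, hφ⟩ := hK
  refine ⟨Real.cos φ ^ 2, fun x => ?_⟩
  have hof := h.base_mem hm hneg ho
  have hpos := h.moment_pos hof.1
  rcases eq_or_ne x 0 with rfl | hx
  · simp
  have hsq : ∀ x : Fin k → ℝ, ∑ j, x j ^ 2 = x ⬝ᵥ x := fun x => by simp [dotProduct, pow_two]
  set η := ∑ j, x j • gradient (metric n) (moment (ξ j) ℓ) o with hη
  have hηη : metric n o η η = (x ⬝ᵥ x) * (moment ℓ ℓ o / 4) := by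
    rw [hη, h.metric_normal hof, hsq]
  have hη0 : η ≠ 0 := by
    intro h0
    rw [h0, map_zero, eq_comm, mul_eq_zero, dotProduct_self_eq_zero] at hηη
    rcases hηη with h1 | h1
    · exact hx h1
    · linarith
  obtain ⟨-, F, hF, hFn, hFF⟩ := hφ η (mem_normalSpace.2 ⟨x, rfl⟩) hη0
  obtain ⟨d, rfl⟩ := mem_normalSpace.1 hF
  have hd : d = -(Matrix.of fun i j => (hform n (ξ i) (ξ j)).im).mulVec x := by
    funext i
    have h1 := hFn _ (mem_normalSpace.2 ⟨Pi.single i 1, rfl⟩)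
    have h0 : ∑ j, (Pi.single i 1 : Fin k → ℝ) j • gradient (metric n) (moment (ξ j) ℓ) o =
        gradient (metric n) (moment (ξ i) ℓ) o := by
      rw [Finset.sum_eq_single i (fun j _ hj => by simp [hj]) (by simp), Pi.single_eq_same,
        one_smul]
    rw [h0, (metric n o).map_sub, sub_apply, h.metric_I_gradient hm hneg ho,
      isRiemannian_metric.symm _ hof.1, isRiemannian_metric.gradient_apply hof.1,
      h.fderiv_height_normal hof] at h1
    have h2 : (d i + ∑ j, (hform n (ξ i) (ξ j)).im * x j) * (moment ℓ ℓ o / 4) = 0 := by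
      linarith
    have h3 := (mul_eq_zero.1 h2).resolve_right (by positivity)
    rw [Pi.neg_apply, Matrix.mulVec, dotProduct]
    simp only [Matrix.of_apply]
    linarith
  rw [h.metric_normal hof, hsq, hηη, hd, neg_dotProduct, dotProduct_neg, neg_neg,
    ← mul_assoc] at hFF
  exact mul_right_cancel₀ (by positivity) hFF

/-- The isotropy group at the base point acts transitively on the unit normal vectors. -/
theorem exists_isotropy (hK : HasConstantKahlerAngle o (normalSpace ℓ ξ o)) {x y : Fin k → ℝ}
    (hxy : x ⬝ᵥ x = y ⬝ᵥ y) :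
    ∃ A : Mat n, PreservesIsoFun ℓ ξ A ∧ A.mulVec (lift o) = lift o ∧
      A.mulVec (∑ j, (x j : ℂ) • ξ j) = ∑ j, (y j : ℂ) • ξ j := by
  obtain ⟨κ, hκ⟩ := h.exists_kahler_const hm hneg ho hK
  set Ω : (Fin k → ℝ) →ₗ[ℝ] Fin k → ℝ :=
    (Matrix.of fun i j => (hform n (ξ i) (ξ j)).im).mulVecLin with hΩ
  have hform_eq : ∀ x y : Fin k → ℝ, hform n (∑ j, (x j : ℂ) • ξ j) (∑ j, (y j : ℂ) • ξ j) =
      ((x ⬝ᵥ y : ℝ) : ℂ) + ((x ⬝ᵥ Ω y : ℝ) : ℂ) * Complex.I := by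
    intro x y
    have e1 : ∀ i j, hform n (ξ i) (ξ j) = ((if i = j then 1 else 0 : ℝ) : ℂ) +
        ((hform n (ξ i) (ξ j)).im : ℂ) * Complex.I := fun i j => by
      conv_lhs => rw [← Complex.re_add_im (hform n (ξ i) (ξ j)), h.orthonormal]
    have e2 : ∀ i, ∑ j, (y j : ℂ) * hform n (ξ i) (ξ j) = (y i : ℂ) + (Ω y i : ℂ) * Complex.I := by
      intro i
      have e3 : ∀ j, (y j : ℂ) * hform n (ξ i) (ξ j) = (if i = j then (y j : ℂ) else 0) +
          (((hform n (ξ i) (ξ j)).im * y j : ℝ) : ℂ) * Complex.I := fun j => by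
        conv_lhs => rw [e1]
        split_ifs <;> push_cast <;> ring
      simp only [e3, Finset.sum_add_distrib, Finset.sum_ite_eq, Finset.mem_univ, if_true,
        ← Finset.sum_mul, ← Complex.ofReal_sum]
      rfl
    rw [hform_sum_left]
    simp only [hform_smul_left, Complex.conj_ofReal, hform_sum_right, hform_smul_right]
    simp only [dotProduct, Complex.ofReal_sum, Complex.ofReal_mul, Finset.sum_mul,
      ← Finset.sum_add_distrib]
    refine Finset.sum_congr rfl fun i _ => ?_
    rw [mul_assoc (x i : ℂ), ← mul_add, ← e2, Finset.mul_sum]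
    exact Finset.sum_congr rfl fun j _ => by ring
  have hskew : ∀ z w, Ω z ⬝ᵥ w = -(z ⬝ᵥ Ω w) := by
    intro z w
    have h1 := congrArg Complex.im (hform_conj (∑ j, (w j : ℂ) • ξ j) (∑ j, (z j : ℂ) • ξ j))
    rw [hform_eq, hform_eq] at h1
    simp at h1
    rw [dotProduct_comm]
    linarith
  -- an orthogonal `T` that commutes with `Ω` preserves the Gram matrix of `ξ`, so it extends to a
  -- linear isometry of `ℂ^{1,n}`
  obtain ⟨T, hT, hTΩ, hTx⟩ := exists_orthogonal_commuting Ω hskew hκ hxy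
  obtain ⟨A, hA, hAℓ, hAm, hAξ⟩ := exists_preserves_family hneg (x := ξ)
    (y := fun i => ∑ j, (T (Pi.single i 1) j : ℂ) • ξ j) h.ortho hm
    (fun i => by simp [h.ortho]) (fun i => by simp [hm]) (fun i j => by
      have e1 : ∀ i, ∑ j, ((Pi.single i 1 : Fin k → ℝ) j : ℂ) • ξ j = ξ i := fun i => by
        rw [Finset.sum_eq_single i (fun j _ hj => by simp [hj]) (by simp)]
        simp
      rw [hform_eq, hT, hTΩ, ← hform_eq, e1, e1]) Finset.univ
  have hAT : ∀ x : Fin k → ℝ, A.mulVec (∑ j, (x j : ℂ) • ξ j) = ∑ j, (T x j : ℂ) • ξ j := by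
    intro x
    rw [Matrix.mulVec_sum]
    simp only [Matrix.mulVec_smul, hAξ _ (Finset.mem_univ _), Finset.smul_sum, smul_smul]
    rw [Finset.sum_comm]
    refine Finset.sum_congr rfl fun j _ => ?_
    rw [← Finset.sum_smul, LinearMap.pi_apply_eq_sum_univ T x]
    congr 1
    simp [Finset.sum_apply]
    refine Finset.sum_congr rfl fun i _ => ?_
    have e1 : (Pi.single i 1 : Fin k → ℝ) = fun j => if i = j then 1 else 0 := by
      funext j
      simp [Pi.single_apply, eq_comm]
    rw [e1]
  refine ⟨A, preservesIsoFun_of_orthogonal hA hAℓ T hT hAT, ?_, by rw [hAT, hTx]⟩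
  rw [← ho, lift_pr (ne_zero_of_hform_neg hneg), Matrix.mulVec_smul, Matrix.mulVec_add, hAℓ, hAm]

/-- A point of the tube is moved to the normal geodesics at `o` by the transitive action on the
focal submanifold, and these are moved to each other by the isotropy group. -/
theorem isHomogeneous_of_hasConstantKahlerAngle {r : ℝ} (hr : 0 < r)
    (htrans : ∀ p ∈ focalSet ℓ ξ, ∃ A : Mat n, PreservesIsoFun ℓ ξ A ∧ act A o = p)
    (hK : HasConstantKahlerAngle o (normalSpace ℓ ξ o)) :
    IsHomogeneous {f | ∃ A ∈ SU n, f = act (A : Mat n)}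
      (tube (metric n) (CH n) (focalSet ℓ ξ) r) := by
  have hof := h.base_mem hm hneg ho
  have hξ0 := h.base_ortho hm hneg ho
  have hsq : ∀ x : Fin k → ℝ, ∑ j, x j ^ 2 = x ⬝ᵥ x := fun x => by simp [dotProduct, pow_two]
  -- every point of the tube can be moved to a normal geodesic that starts at `o`
  have key : ∀ p ∈ tube (metric n) (CH n) (focalSet ℓ ξ) r, ∃ (A : Mat n) (c : Fin k → ℝ) (q : ℝ),
      PreservesIsoFun ℓ ξ A ∧ 0 < q ∧ q ^ 2 = 1 - ‖o‖ ^ 2 ∧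
      (c ⬝ᵥ c) * (moment ℓ ℓ o / 4) = 1 ∧
      (hform n (hyp ((q : ℂ)⁻¹ • lift o) ((((2 * q : ℝ) : ℂ)⁻¹ * hform n ℓ (lift o)) •
        ∑ j, (c j : ℂ) • ξ j) r) (hyp ((q : ℂ)⁻¹ • lift o) ((((2 * q : ℝ) : ℂ)⁻¹ *
          hform n ℓ (lift o)) • ∑ j, (c j : ℂ) • ξ j) r)).re < 0 ∧
      p = act A (pr (hyp ((q : ℂ)⁻¹ • lift o) ((((2 * q : ℝ) : ℂ)⁻¹ * hform n ℓ (lift o)) •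
        ∑ j, (c j : ℂ) • ξ j) r)) := by
    rintro _ ⟨γ, hγ, hγ0, hγ1, rfl⟩
    obtain ⟨A, hA, hAo⟩ := htrans _ hγ0
    obtain ⟨B, hB, hAB, hBA⟩ := hA.exists_inv
    have hBγ0 : act B (γ 0) = o := by rw [← hAo, hBA o hof.1]
    have h1 := hγ1.fderiv_isometry isOpen_CH (fun z hz => hz.1) hB.1.act_mem_isometries
      hA.1.act_mem_isometries hBA hAB (fun z hz => h.act_mem_focalSet hA hz) hγ0
    have hBγ := (isRiemannian_metric (n := n)).isGeodesic_comp hB.1.act_mem_isometries hγ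
    have hd : deriv (act B ∘ γ) 0 = fderiv ℝ (act B) (γ 0) (deriv γ 0) :=
      ((hB.1.hasFDerivAt_act hγ0.1).differentiableAt.hasFDerivAt.comp_hasDerivAt 0
        (hγ.smooth.contDiffAt.differentiableAt (by simp)).hasDerivAt).deriv
    rw [hBγ0, ← hd] at h1
    obtain ⟨c, hc, hcd⟩ := (h.isUnitNormal_iff hof).1 h1
    obtain ⟨q, V, hq, hqs, hV, hF, hVd⟩ := h.exists_normal_frame hof hc
    have hq' : (q : ℂ) ≠ 0 := by exact_mod_cast hq.ne'
    have hV' : V = (((2 * q : ℝ) : ℂ)⁻¹ * hform n ℓ (lift o)) • ∑ j, (c j : ℂ) • ξ j := by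
      rw [hV, mul_smul, Finset.smul_sum (s := Finset.univ) (r := hform n ℓ (lift o))]
      congr 1
      refine Finset.sum_congr rfl fun j _ => ?_
      rw [momentVec, hξ0, zero_smul, zero_add, smul_comm]
    have heq := hF.eq_of_deriv hBγ (by
      rw [Function.comp_apply, hBγ0, pr_smul (inv_ne_zero hq'), pr_lift]) (hcd.trans hVd)
    refine ⟨A, c, q, hA, hq, hqs, by rw [← hsq, hc], ?_, ?_⟩
    · rw [← hV']; exact hF.hyp_neg r
    · rw [← hV', ← congrFun heq r, Function.comp_apply, hAB _ (hγ.mem r)]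
  intro p hp p' hp'
  obtain ⟨A, c, q, hA, hq, hqs, hc, hn, rfl⟩ := key p hp
  obtain ⟨A', c', q', hA', hq', hqs', hc', hn', rfl⟩ := key p' hp'
  obtain rfl : q = q' := by
    rw [← sq_eq_sq₀ hq.le hq'.le, hqs, hqs']
  have hφ := h.moment_pos hof.1
  obtain ⟨C, hC, hCo, hCc⟩ := h.exists_isotropy hm hneg ho hK (x := c) (y := c')
    (mul_right_cancel₀ (by positivity) (hc.trans hc'.symm))
  obtain ⟨B, hB, -, hBA⟩ := hA.exists_inv
  have hD := hA'.mul (hC.mul hB)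
  obtain ⟨D, hDS, hDact⟩ := hD.1.exists_mem_SU
  refine ⟨act (D : Mat n), ⟨D, hDS, rfl⟩, ?_, ?_⟩
  · rw [hDact, h.act_image_tube hD hr]
  · have hz := pr_mem_CH hn
    have hAz := hA.1.act_mem hz
    rw [hDact, (hC.mul hB).1.act_mul hAz, hB.1.act_mul hAz, hBA _ hz, Preserves.act_pr hn, hyp, hyp,
      Matrix.mulVec_add, Matrix.mulVec_smul, Matrix.mulVec_smul, Matrix.mulVec_smul,
      Matrix.mulVec_smul, hCo, hCc]

end base

end IsConfig

/-! ### The Lie algebra `𝔰𝔲(1,n)` and its exponential map -/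

attribute [local instance] Matrix.linftyOpNormedRing Matrix.linftyOpNormedAlgebra in
theorem hasSum_exp_mulVec (S : Mat n) (w : Fin (n + 1) → ℂ) :
    HasSum (fun k : ℕ => ((k.factorial : ℝ)⁻¹) • (S ^ k).mulVec w)
      ((NormedSpace.exp S).mulVec w) := by
  have h1 := NormedSpace.exp_series_hasSum_exp' (𝕂 := ℝ) S
  have hc : Continuous fun A : Mat n => A.mulVec w := by fun_prop
  let g : Mat n →+ (Fin (n + 1) → ℂ) :=
    { toFun := fun A => A.mulVec w
      map_zero' := Matrix.zero_mulVec w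
      map_add' := fun A B => Matrix.add_mulVec A B w }
  have h2 : HasSum (fun k : ℕ => (((k.factorial : ℝ)⁻¹) • S ^ k).mulVec w)
      ((NormedSpace.exp S).mulVec w) := h1.map g hc
  simpa only [Matrix.smul_mulVec] using h2

/-- If `S` maps `w` and a subspace `L` to `L`, then `exp S` does not change `w` modulo `L`. -/
theorem exp_mulVec_sub_mem {S : Mat n} {w : Fin (n + 1) → ℂ} (L : Submodule ℝ (Fin (n + 1) → ℂ))
    (hw : S.mulVec w ∈ L) (hL : ∀ x ∈ L, S.mulVec x ∈ L) :
    (NormedSpace.exp S).mulVec w - w ∈ L := by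
  have h1 := hasSum_exp_mulVec S w
  have h2 := (hasSum_nat_add_iff' 1).2 h1
  simp only [Finset.range_one, Finset.sum_singleton, pow_zero, Matrix.one_mulVec,
    Nat.factorial_zero, Nat.cast_one, inv_one, one_smul] at h2
  have h3 : ∀ k, (S ^ (k + 1)).mulVec w ∈ L := by
    intro k
    induction k with
    | zero => simpa using hw
    | succ k ih =>
      rw [pow_succ', ← Matrix.mulVec_mulVec]
      exact hL _ ih
  exact (Submodule.closed_of_finiteDimensional L).mem_of_tendsto h2
    (Filter.Eventually.of_forall fun s => Submodule.sum_mem _ fun k _ =>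
      Submodule.smul_mem _ _ (h3 k))

theorem hform_eq_dotProduct (x y : Fin (n + 1) → ℂ) :
    hform n x y = star x ⬝ᵥ (form n).mulVec y := by
  rw [hform_apply, form, dotProduct, Fin.sum_univ_succ]
  simp [Matrix.mulVec_diagonal]

/-- The elements of `𝔰𝔲(1,n)` are the trace-free skew-Hermitian transformations. -/
theorem mem_su {X : Mat n} : X ∈ su n ↔
    (∀ x y, hform n (X.mulVec x) y = -hform n x (X.mulVec y)) ∧ X.trace = 0 := by
  have hX : ∀ x y, hform n (X.mulVec x) y + hform n x (X.mulVec y) =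
      star x ⬝ᵥ (X.conjTranspose * form n + form n * X).mulVec y := by
    intro x y
    rw [hform_eq_dotProduct, hform_eq_dotProduct, Matrix.star_mulVec, ← Matrix.dotProduct_mulVec,
      Matrix.mulVec_mulVec, Matrix.mulVec_mulVec, Matrix.add_mulVec, dotProduct_add]
  refine and_congr ⟨fun h x y => ?_, fun h => ?_⟩ Iff.rfl
  · rw [eq_neg_iff_add_eq_zero, hX]
    have : X.conjTranspose * form n + form n * X = 0 := h
    rw [this]
    simp
  · show X.conjTranspose * form n + form n * X = 0
    ext i j
    have h1 := hX (Pi.single i 1) (Pi.single j 1)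
    rw [h, neg_add_cancel] at h1
    simpa using h1.symm

theorem form_mul_form : form n * form n = 1 := by
  rw [form, Matrix.diagonal_mul_diagonal, ← Matrix.diagonal_one]
  congr 1
  funext i
  refine Fin.cases ?_ (fun i => ?_) i <;> simp

theorem preserves_exp {X : Mat n} (hX : X ∈ su n) : Preserves (NormedSpace.exp X) := by
  rw [preserves_iff]
  have h0 : X.conjTranspose * form n + form n * X = 0 := hX.1
  have hu : IsUnit (form n) := ⟨⟨form n, form n, form_mul_form, form_mul_form⟩, rfl⟩
  have hinv : (form n)⁻¹ = form n := Matrix.inv_eq_right_inv form_mul_form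
  have h1 : X.conjTranspose = form n * (-X) * (form n)⁻¹ := by
    have h2 := congrArg (· * form n) (eq_neg_of_add_eq_zero_left h0)
    simp only [mul_assoc, form_mul_form, mul_one] at h2
    rw [hinv, h2, mul_neg, neg_mul]
  have hud : IsUnit (NormedSpace.exp X).det :=
    (Matrix.isUnit_iff_isUnit_det _).1 (Matrix.isUnit_exp X)
  rw [← Matrix.exp_conjTranspose, h1, Matrix.exp_conj _ _ hu, Matrix.exp_neg, hinv,
    mul_assoc (form n * _), form_mul_form, mul_one, mul_assoc, Matrix.nonsing_inv_mul _ hud, mul_one]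

/-- The rank one matrix `z ↦ [y, z] x`. -/
noncomputable def outer (x y : Fin (n + 1) → ℂ) : Mat n :=
  Matrix.vecMulVec x fun j => hform n y (Pi.single j 1)

theorem hform_eq_sum (y z : Fin (n + 1) → ℂ) :
    hform n y z = (fun j => hform n y (Pi.single j 1)) ⬝ᵥ z := by
  rw [LinearMap.pi_apply_eq_sum_univ (hform n y) z, dotProduct]
  refine Finset.sum_congr rfl fun j _ => ?_
  have e1 : (Pi.single j 1 : Fin (n + 1) → ℂ) = fun i => if j = i then 1 else 0 := by
    funext i
    simp [Pi.single_apply, eq_comm]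
  rw [e1, smul_eq_mul, mul_comm]

theorem outer_mulVec (x y z : Fin (n + 1) → ℂ) : (outer x y).mulVec z = hform n y z • x := by
  rw [outer, Matrix.vecMulVec_mulVec, ← hform_eq_sum]
  simp

theorem trace_outer (x y : Fin (n + 1) → ℂ) : (outer x y).trace = hform n y x := by
  rw [outer, Matrix.trace_vecMulVec, hform_eq_sum, dotProduct_comm]

theorem mul_outer (X : Mat n) (x y : Fin (n + 1) → ℂ) : X * outer x y = outer (X.mulVec x) y :=
  Matrix.mul_vecMulVec _ _ _

theorem mat_ext {X Y : Mat n} (h : ∀ z, X.mulVec z = Y.mulVec z) : X = Y := by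
  ext i j
  have := congrFun (h (Pi.single j 1)) i
  simpa using this

/-- The infinitesimal rotation `z ↦ [y, z] x - [x, z] y`. -/
noncomputable def rot (x y : Fin (n + 1) → ℂ) : Mat n := outer x y - outer y x

theorem rot_mulVec (x y z : Fin (n + 1) → ℂ) :
    (rot x y).mulVec z = hform n y z • x - hform n x z • y := by
  rw [rot, Matrix.sub_mulVec, outer_mulVec, outer_mulVec]

theorem rot_mem_su {x y : Fin (n + 1) → ℂ} (h : (hform n x y).im = 0) : rot x y ∈ su n := by
  refine mem_su.2 ⟨fun z w => ?_, ?_⟩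
  · simp only [rot_mulVec, hform_sub_left, hform_sub_right, hform_smul_left, hform_smul_right,
      hform_conj]
    ring
  · rw [rot, Matrix.trace_sub, trace_outer, trace_outer, ← hform_conj x y,
      Complex.conj_eq_iff_im.2 h, sub_self]

/-- The elements of `𝔰𝔲(1,n)` with eigenvector `lift o` belong to the isotropy algebra of `o`. -/
theorem mem_isotropyAlgebra {o : EuclideanSpace ℂ (Fin n)} {X : Mat n} (hX : X ∈ su n) {c : ℂ}
    (h : X.mulVec (lift o) = c • lift o) : X ∈ isotropyAlgebra o := by
  refine ⟨hX, fun t => ?_⟩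
  let L : Submodule ℝ (Fin (n + 1) → ℂ) := (ℂ ∙ lift o).restrictScalars ℝ
  have hL : ∀ d : ℂ, d • lift o ∈ L := fun d => Submodule.mem_span_singleton.2 ⟨d, rfl⟩
  have h1 := exp_mulVec_sub_mem (S := t • X) (w := lift o) L
    (by
      rw [Matrix.smul_mulVec, h, ← Complex.coe_smul, smul_smul]
      exact hL _)
    (by
      intro x hx
      obtain ⟨d, rfl⟩ := Submodule.mem_span_singleton.1 hx
      rw [Matrix.smul_mulVec, Matrix.mulVec_smul, h, ← Complex.coe_smul, smul_smul, smul_smul]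
      exact hL _)
  obtain ⟨d, hd⟩ := Submodule.mem_span_singleton.1 h1
  have h2 : (NormedSpace.exp (t • X)).mulVec (lift o) = (d + 1) • lift o := by
    rw [add_smul, hd, one_smul, sub_add_cancel]
  have h3 : d + 1 ≠ 0 := by
    intro h0
    rw [h0, zero_smul] at h2
    have hinj := Matrix.mulVec_injective_of_isUnit (Matrix.isUnit_exp (t • X))
    have h4 : lift o = 0 := hinj (by rw [h2, Matrix.mulVec_zero])
    have := congrFun h4 0
    simp at this
  rw [act_eq, h2, pr_smul h3, pr_lift]

/-! ### The Cartan decomposition and the restricted roots -/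

/-- A representative of length `-1` of a point of the ball. -/
theorem exists_unit_lift {o : EuclideanSpace ℂ (Fin n)} (ho : o ∈ CH n) :
    ∃ (O : Fin (n + 1) → ℂ) (q : ℂ), q ≠ 0 ∧ hform n O O = -1 ∧ lift o = q • O := by
  have hs := mem_CH.1 ho
  obtain ⟨q, hq, hqs⟩ : ∃ q : ℝ, 0 < q ∧ q ^ 2 = 1 - ‖o‖ ^ 2 :=
    ⟨_, Real.sqrt_pos.2 hs, Real.sq_sqrt hs.le⟩
  have hq' : (q : ℂ) ≠ 0 := by exact_mod_cast hq.ne'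
  refine ⟨(q : ℂ)⁻¹ • lift o, q, hq', ?_, (smul_inv_smul₀ hq' _).symm⟩
  rw [hform_smul_left, hform_smul_right, hform_lift_self, ← hqs, map_inv₀, Complex.conj_ofReal]
  push_cast
  field_simp

/-- The trace-free skew-Hermitian transformation with axis `a`. -/
theorem axis_mem_su (a : Fin (n + 1) → ℂ) :
    Complex.I • (outer a a - (hform n a a / (n + 1)) • (1 : Mat n)) ∈ su n := by
  have hc : conj (hform n a a / (n + 1)) = hform n a a / (n + 1) := by
    rw [map_div₀, hform_conj]
    simp
  have hn : (n + 1 : ℂ) ≠ 0 := by exact_mod_cast Nat.succ_ne_zero n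
  refine mem_su.2 ⟨fun z w => ?_, ?_⟩
  · simp only [Matrix.smul_mulVec, Matrix.sub_mulVec, outer_mulVec, Matrix.one_mulVec,
      hform_sub_left, hform_sub_right, hform_smul_left, hform_smul_right, hc, hform_conj,
      Complex.conj_I]
    ring
  · rw [Matrix.trace_smul, Matrix.trace_sub, trace_outer, Matrix.trace_smul, Matrix.trace_one]
    simp only [Fintype.card_fin, smul_eq_mul]
    push_cast
    field_simp
    ring

/-- The elements of the Cartan complement are infinitesimal rotations. -/
theorem eq_rot_of_mem_cartanComplement {o : EuclideanSpace ℂ (Fin n)} {O : Fin (n + 1) → ℂ} {q : ℂ}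
    (hO : hform n O O = -1) (hoO : lift o = q • O) {X : Mat n}
    (hX : X ∈ cartanComplement o) : hform n O (X.mulVec O) = 0 ∧ X = rot O (X.mulVec O) := by
  have hXs := mem_su.1 hX.1
  have hflip : ∀ u w : Fin (n + 1) → ℂ, hform n u w = 0 → hform n w u = 0 := fun u w h => by
    rw [← hform_conj, h, map_zero]
  -- test against the rotations of the isotropy group with axis `a`
  have htest : ∀ a : Fin (n + 1) → ℂ, (∃ d : ℂ, hform n a (lift o) • a = d • lift o) →
      hform n a (X.mulVec a) = 0 := by
    rintro a ⟨d, hd⟩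
    have h1 := hX.2 _ (mem_isotropyAlgebra (o := o) (axis_mem_su a)
      (c := Complex.I * (d - hform n a a / (n + 1))) (by
        rw [Matrix.smul_mulVec, Matrix.sub_mulVec, outer_mulVec, hd, Matrix.smul_mulVec,
          Matrix.one_mulVec, ← sub_smul, smul_smul]))
    rw [mul_smul_comm, Matrix.trace_smul, mul_sub, mul_outer, Matrix.trace_sub, trace_outer,
      mul_smul_comm, mul_one, Matrix.trace_smul, hXs.2, smul_zero, sub_zero] at h1
    simp only [smul_eq_mul, Complex.mul_re, Complex.I_re, Complex.I_im,
      zero_mul, one_mul, zero_sub, mul_neg, neg_eq_zero] at h1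
    have h2 : (hform n a (X.mulVec a)).im = 0 := by
      refine (mul_eq_zero.1 h1).resolve_left ?_
      positivity
    have h3 := hform_re_comm (X.mulVec a) a
    rw [hXs.1, Complex.neg_re] at h3
    exact Complex.ext (by rw [Complex.zero_re]; linarith) h2
  have hOX : hform n O (X.mulVec O) = 0 := by
    refine htest O ⟨hform n O (lift o) * q⁻¹, ?_⟩
    rcases eq_or_ne q 0 with h0 | h0
    · have := congrFun hoO 0
      simp [h0] at this
    · rw [hoO, smul_smul, mul_assoc, inv_mul_cancel₀ h0, mul_one]
  have hperp : ∀ a, hform n O a = 0 → hform n a (X.mulVec a) = 0 := fun a ha =>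
    htest a ⟨0, by rw [hoO, hform_smul_right, hflip _ _ ha]; simp⟩
  have hpol : ∀ a b, hform n O a = 0 → hform n O b = 0 → hform n a (X.mulVec b) = 0 := by
    have him : ∀ a b, hform n O a = 0 → hform n O b = 0 → (hform n a (X.mulVec b)).im = 0 := by
      intro a b ha hb
      have h1 := hperp (a + b) (by rw [hform_add_right, ha, hb, add_zero])
      rw [Matrix.mulVec_add] at h1
      simp only [hform_add_left, hform_add_right, hperp a ha, hperp b hb] at h1
      have h2 : hform n b (X.mulVec a) = -conj (hform n a (X.mulVec b)) := by
        rw [hform_conj, hXs.1, neg_neg]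
      rw [h2] at h1
      have := congrArg Complex.im h1
      simp at this
      linarith
    intro a b ha hb
    have h1 := him a (Complex.I • b) ha (by rw [hform_smul_right, hb, mul_zero])
    rw [Matrix.mulVec_smul, hform_smul_right] at h1
    simp at h1
    exact Complex.ext h1 (him a b ha hb)
  refine ⟨hOX, mat_ext fun z => ?_⟩
  set v := X.mulVec O with hv
  have hvO := hflip _ _ hOX
  -- split off the component of `z` along `O`
  obtain ⟨z', c, hz', rfl⟩ : ∃ (z' : Fin (n + 1) → ℂ) (c : ℂ), hform n O z' = 0 ∧
      z = z' - c • O :=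
    ⟨z + hform n O z • O, hform n O z, by rw [hform_add_right, hform_smul_right, hO]; ring,
      by abel⟩
  have h1 : X.mulVec z' = hform n v z' • O := by
    rw [← sub_eq_zero]
    refine hform_nondegenerate fun y => ?_
    have e1 : y = (y + hform n O y • O) - hform n O y • O := by abel
    have e2 := hpol (y + hform n O y • O) z' (by
      rw [hform_add_right, hform_smul_right, hO]; ring) hz'
    rw [e1, hform_sub_left, hform_sub_right, e2]
    simp only [hform_sub_right, hform_add_left, hform_smul_left, hform_smul_right, hO, hv,
      hXs.1, hform_conj]
    ring
  rw [Matrix.mulVec_sub, Matrix.mulVec_smul, h1, rot_mulVec]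
  simp only [hform_sub_right, hform_smul_right, hz', hO, hvO, ← hv]
  module

/-- Null vectors `ℓ`, `m` that span a Lorentzian plane whose negative line contains the point `o`. -/
structure IsBase (o : EuclideanSpace ℂ (Fin n)) (ℓ m : Fin (n + 1) → ℂ) : Prop where
  left_null : hform n ℓ ℓ = 0
  right_null : hform n m m = 0
  pair : hform n ℓ m = -1
  base : pr (ℓ + m) = o

namespace IsBase

variable {o : EuclideanSpace ℂ (Fin n)} {ℓ m : Fin (n + 1) → ℂ}

theorem pair' (h : IsBase o ℓ m) : hform n m ℓ = -1 := by
  rw [← hform_conj, h.pair]; simp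

theorem symm (h : IsBase o ℓ m) : IsBase o m ℓ :=
  ⟨h.right_null, h.left_null, h.pair', by rw [add_comm]; exact h.base⟩

theorem neg (h : IsBase o ℓ m) : (hform n (ℓ + m) (ℓ + m)).re < 0 := by
  simp only [hform_add_left, hform_add_right, h.left_null, h.right_null, h.pair, h.pair']
  norm_num

theorem rot_left (h : IsBase o ℓ m) : (rot m ℓ).mulVec ℓ = ℓ := by
  rw [rot_mulVec, h.left_null, h.pair']; module

theorem rot_right (h : IsBase o ℓ m) : (rot m ℓ).mulVec m = -m := by
  rw [rot_mulVec, h.right_null, h.pair]; module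

theorem rot_perp {z : Fin (n + 1) → ℂ} (hℓ : hform n ℓ z = 0) (hm : hform n m z = 0) :
    (rot m ℓ).mulVec z = 0 := by
  rw [rot_mulVec, hℓ, hm]; module

/-- The decomposition of `ℂ^{1,n}` into eigenvectors of `rot m ℓ`. -/
theorem exists_decomposition (h : IsBase o ℓ m) (z : Fin (n + 1) → ℂ) :
    ∃ z', hform n ℓ z' = 0 ∧ hform n m z' = 0 ∧
      z = (-hform n m z) • ℓ + (-hform n ℓ z) • m + z' := by
  refine ⟨z + hform n m z • ℓ + hform n ℓ z • m, ?_, ?_, by module⟩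
  · simp only [hform_add_right, hform_smul_right, h.left_null, h.pair]; ring
  · simp only [hform_add_right, hform_smul_right, h.right_null, h.pair']; ring

theorem rot_cube (h : IsBase o ℓ m) (z : Fin (n + 1) → ℂ) :
    (rot m ℓ).mulVec ((rot m ℓ).mulVec ((rot m ℓ).mulVec z)) = (rot m ℓ).mulVec z := by
  obtain ⟨z', h1, h2, hz⟩ := h.exists_decomposition z
  rw [hz]
  simp only [Matrix.mulVec_add, Matrix.mulVec_smul, h.rot_left, h.rot_right, rot_perp h1 h2,
    Matrix.mulVec_neg, Matrix.mulVec_zero, smul_neg]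
  module

/-- By `rot_cube`, the eigenvalues of `rot m ℓ` are roots of `c³ = c`. -/
theorem eigenvalue (h : IsBase o ℓ m) {z : Fin (n + 1) → ℂ} {c : ℝ}
    (hz : (rot m ℓ).mulVec z = (c : ℂ) • z) (hne : z ≠ 0) : c = 0 ∨ c = 1 ∨ c = -1 := by
  have h1 := h.rot_cube z
  simp only [hz, Matrix.mulVec_smul, smul_smul] at h1
  rw [← sub_eq_zero, ← sub_smul, smul_eq_zero, or_iff_left hne] at h1
  have h2 : c * ((c - 1) * (c + 1)) = 0 := by
    have : c * c * c - c = 0 := by exact_mod_cast h1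
    linarith
  rcases mul_eq_zero.1 h2 with h3 | h3
  · exact Or.inl h3
  · rcases mul_eq_zero.1 h3 with h4 | h4
    · right; left; linarith
    · right; right; linarith

/-- A matrix is determined by its values on `ℓ`, `m` and on their orthogonal complement. -/
theorem mat_ext (h : IsBase o ℓ m) {X Y : Mat n} (hℓ : X.mulVec ℓ = Y.mulVec ℓ)
    (hm : X.mulVec m = Y.mulVec m)
    (hz : ∀ z, hform n ℓ z = 0 → hform n m z = 0 → X.mulVec z = Y.mulVec z) : X = Y := by
  refine ComplexHyperbolic.mat_ext fun z => ?_
  obtain ⟨z', h1, h2, hz'⟩ := h.exists_decomposition z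
  rw [hz', Matrix.mulVec_add, Matrix.mulVec_add, Matrix.mulVec_smul, Matrix.mulVec_smul, hℓ, hm,
    hz _ h1 h2, Matrix.mulVec_add, Matrix.mulVec_add, Matrix.mulVec_smul, Matrix.mulVec_smul]

/-- An eigenvector of `ad H` shifts the eigenvalues of `H`. -/
theorem mulVec_eigen {H X : Mat n} {c μ : ℝ} (hX : ⁅H, X⁆ = c • X) {z : Fin (n + 1) → ℂ}
    (hz : H.mulVec z = (μ : ℂ) • z) :
    H.mulVec (X.mulVec z) = ((μ + c : ℝ) : ℂ) • X.mulVec z := by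
  rw [Ring.lie_def, sub_eq_iff_eq_add] at hX
  rw [Matrix.mulVec_mulVec, hX, Matrix.add_mulVec, ← Matrix.mulVec_mulVec, hz, Matrix.mulVec_smul,
    Matrix.smul_mulVec, ← Complex.coe_smul c, ← add_smul]
  congr 1
  push_cast
  ring

/-- The eigenvalues of `ad (rot m ℓ)` are differences of the eigenvalues `0`, `1`, `-1`. -/
theorem ad_eigenvalue (h : IsBase o ℓ m) {X : Mat n} {c : ℝ} (hX : ⁅rot m ℓ, X⁆ = c • X)
    (hne : X ≠ 0) (hc : c ≠ 0) : c ^ 2 = 1 ∨ c ^ 2 = 4 := by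
  have key : ∃ μ : ℝ, (μ = 0 ∨ μ = 1 ∨ μ = -1) ∧ (μ + c = 0 ∨ μ + c = 1 ∨ μ + c = -1) := by
    by_contra hcon
    push Not at hcon
    have h0 : ∀ (μ : ℝ) (z : Fin (n + 1) → ℂ), (μ = 0 ∨ μ = 1 ∨ μ = -1) →
        (rot m ℓ).mulVec z = (μ : ℂ) • z → X.mulVec z = 0 := by
      intro μ z hμ hz
      by_contra hXz
      rcases h.eigenvalue (mulVec_eigen hX hz) hXz with h1 | h1 | h1
      · exact (hcon μ hμ).1 h1
      · exact (hcon μ hμ).2.1 h1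
      · exact (hcon μ hμ).2.2 h1
    refine hne (h.mat_ext ?_ ?_ fun z h1 h2 => ?_)
    · rw [Matrix.zero_mulVec]
      exact h0 1 _ (by norm_num) (by rw [h.rot_left]; simp)
    · rw [Matrix.zero_mulVec]
      exact h0 (-1) _ (by norm_num) (by rw [h.rot_right]; simp)
    · rw [Matrix.zero_mulVec]
      exact h0 0 _ (by norm_num) (by rw [rot_perp h1 h2]; simp)
  obtain ⟨μ, rfl | rfl | rfl, h2 | h2 | h2⟩ := key
  · exact absurd (by linarith) hc
  · left; rw [show c = 1 by linarith]; norm_num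
  · left; rw [show c = -1 by linarith]; norm_num
  · left; rw [show c = -1 by linarith]; norm_num
  · exact absurd (by linarith) hc
  · right; rw [show c = -2 by linarith]; norm_num
  · left; rw [show c = 1 by linarith]; norm_num
  · right; rw [show c = 2 by linarith]; norm_num
  · exact absurd (by linarith) hc

end IsBase

theorem rot_smul_right (t : ℝ) (x y : Fin (n + 1) → ℂ) : rot x (t • y) = t • rot x y := by
  refine mat_ext fun z => ?_
  rw [Matrix.smul_mulVec, rot_mulVec, rot_mulVec, ← Complex.coe_smul t y, hform_smul_left,
    Complex.conj_ofReal, ← Complex.coe_smul]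
  module

theorem rot_comm (x y : Fin (n + 1) → ℂ) : rot x y = -rot y x := by
  rw [rot, rot, neg_sub]

/-- Commuting rotations of the Cartan complement are proportional. -/
theorem eq_smul_of_commute {O v w : Fin (n + 1) → ℂ} (hO : hform n O O = -1)
    (hv : hform n O v = 0) (hw : hform n O w = 0) (hvw : ⁅rot O v, rot O w⁆ = 0) (hne : v ≠ 0) :
    ∃ t : ℝ, w = t • v := by
  have hflip : ∀ u w : Fin (n + 1) → ℂ, hform n u w = 0 → hform n w u = 0 := fun u w h => by
    rw [← hform_conj, h, map_zero]
  have hpos : 0 < (hform n v v).re := hform_pos_of_ortho (Z := O) (by rw [hO]; simp) hv hne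
  have h1 : ∀ z, (rot O v).mulVec ((rot O w).mulVec z) = (rot O w).mulVec ((rot O v).mulVec z) := by
    intro z
    rw [Ring.lie_def, sub_eq_zero] at hvw
    rw [Matrix.mulVec_mulVec, Matrix.mulVec_mulVec, hvw]
  have h2 := congrArg (hform n O) (h1 O)
  have h3 := h1 v
  simp only [rot_mulVec, hform_sub_right, hform_smul_right, hO, hv, hw, hflip _ _ hv,
    hflip _ _ hw] at h2 h3
  have h4 : hform n v w = hform n w v := by linear_combination -h2
  have h5 : (hform n v w).im = 0 := by
    have := congrArg Complex.im (hform_conj v w)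
    rw [← h4, Complex.conj_im] at this
    linarith
  have hvv : (hform n v v) = ((hform n v v).re : ℂ) := by
    apply Complex.ext <;> simp [hform_self_im]
  have hwv : hform n w v = ((hform n v w).re : ℂ) := by
    rw [← h4]; apply Complex.ext <;> simp [h5]
  refine ⟨(hform n v w).re / (hform n v v).re, ?_⟩
  have h6 : ((hform n v v).re : ℂ) • w = ((hform n v w).re : ℂ) • v := by
    rw [← hvv, ← hwv]
    have h7 : hform n v v • w - hform n w v • v = 0 := by
      have := sub_eq_zero.2 h3
      rw [← neg_eq_zero, ← this]
      module
    exact sub_eq_zero.1 h7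
  rw [div_eq_inv_mul, mul_smul, ← Complex.coe_smul _ v, ← h6, Complex.coe_smul,
    inv_smul_smul₀ hpos.ne']

/-- The flat `𝔞` is spanned by `rot m ℓ` for suitable null vectors, and `α (rot m ℓ) = 1`. -/
theorem exists_isBase {o : EuclideanSpace ℂ (Fin n)} (ho : o ∈ CH n)
    {𝔞 : Submodule ℝ (Mat n)} (h𝔞 : 𝔞 ≤ cartanComplement o)
    (hcomm : ∀ X ∈ 𝔞, ∀ Y ∈ 𝔞, ⁅X, Y⁆ = 0)
    {α : Module.Dual ℝ 𝔞} (hα : α ≠ 0) (h1 : rootSpace 𝔞 α ≠ ⊥)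
    (h2 : rootSpace 𝔞 ((2 : ℝ) • α) ≠ ⊥) :
    ∃ (ℓ m : Fin (n + 1) → ℂ) (hH : rot m ℓ ∈ 𝔞), IsBase o ℓ m ∧
      (∀ X ∈ 𝔞, ∃ t : ℝ, X = t • rot m ℓ) ∧ α ⟨rot m ℓ, hH⟩ = 1 := by
  obtain ⟨O, q, hq, hO, hoO⟩ := exists_unit_lift ho
  obtain ⟨⟨X₀, hX₀⟩, hαX₀⟩ : ∃ X, α X ≠ 0 := by
    by_contra hcon
    push Not at hcon
    exact hα (LinearMap.ext hcon)
  have hX₀ne : X₀ ≠ 0 := by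
    rintro rfl
    exact hαX₀ (map_zero α)
  obtain ⟨hOv, hX₀v⟩ := eq_rot_of_mem_cartanComplement hO hoO (h𝔞 hX₀)
  set v₀ := X₀.mulVec O with hv₀
  have hv₀ne : v₀ ≠ 0 := by
    intro h0
    rw [h0] at hX₀v
    refine hX₀ne (hX₀v.trans (mat_ext fun z => ?_))
    rw [rot_mulVec]; simp
  have hpos : 0 < (hform n v₀ v₀).re := hform_pos_of_ortho (Z := O) (by rw [hO]; simp) hOv hv₀ne
  set d : ℝ := (√(hform n v₀ v₀).re)⁻¹ with hc
  have hc0 : 0 < d := inv_pos.2 (Real.sqrt_pos.2 hpos)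
  have hcsq : d * d * (hform n v₀ v₀).re = 1 := by
    rw [hc, ← mul_inv, Real.mul_self_sqrt hpos.le, inv_mul_cancel₀ hpos.ne']
  set v : Fin (n + 1) → ℂ := d • v₀ with hv
  have hvv : hform n v v = 1 := by
    rw [hv, ← Complex.coe_smul, hform_smul_left, hform_smul_right, Complex.conj_ofReal, ← mul_assoc,
      ← Complex.ofReal_mul]
    have e1 : hform n v₀ v₀ = ((hform n v₀ v₀).re : ℂ) := by
      apply Complex.ext <;> simp [hform_self_im]
    rw [e1, ← Complex.ofReal_mul, hcsq, Complex.ofReal_one]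
  have hOv' : hform n O v = 0 := by
    rw [hv, ← Complex.coe_smul, hform_smul_right, hOv, mul_zero]
  have hvO : hform n v O = 0 := by rw [← hform_conj, hOv', map_zero]
  have hvne : v ≠ 0 := smul_ne_zero hc0.ne' hv₀ne
  have hHmem : rot O v ∈ 𝔞 := by
    rw [hv, rot_smul_right, ← hX₀v]
    exact Submodule.smul_mem _ _ hX₀
  have hspan : ∀ X ∈ 𝔞, ∃ t : ℝ, X = t • rot O v := by
    intro X hX
    obtain ⟨hOw, hXw⟩ := eq_rot_of_mem_cartanComplement hO hoO (h𝔞 hX)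
    obtain ⟨t, ht⟩ := eq_smul_of_commute hO hOv' hOw (by
      rw [← hXw]; exact hcomm _ hHmem _ hX) hvne
    exact ⟨t, by rw [hXw, ht, rot_smul_right]⟩
  -- the null vectors of the plane spanned by `O` and `v`
  obtain ⟨b, hb⟩ : ∃ b : ℝ, (b : ℂ) * b = 1 / 2 := by
    refine ⟨(√2)⁻¹, ?_⟩
    rw [← Complex.ofReal_mul, ← mul_inv, Real.mul_self_sqrt (by norm_num)]
    norm_num
  have hb0 : (b : ℂ) ≠ 0 := by
    intro h0
    rw [h0] at hb
    norm_num at hb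
  have hbase : IsBase o ((b : ℂ) • (O + v)) ((b : ℂ) • (O - v)) := by
    refine ⟨?_, ?_, ?_, ?_⟩
    · simp only [hform_smul_left, hform_smul_right, hform_add_left, hform_add_right, hO, hvv, hOv',
        hvO]
      ring
    · simp only [hform_smul_left, hform_smul_right, hform_sub_left, hform_sub_right, hO, hvv, hOv',
        hvO]
      ring
    · simp only [hform_smul_left, hform_smul_right, hform_add_left, hform_sub_right, hO, hvv, hOv',
        hvO, Complex.conj_ofReal]
      linear_combination (-2) * hb
    · have e1 : (b : ℂ) • (O + v) + (b : ℂ) • (O - v) = (2 * b * q⁻¹ : ℂ) • lift o := by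
        rw [hoO, smul_smul, mul_assoc, inv_mul_cancel₀ hq]
        module
      rw [e1, pr_smul (mul_ne_zero (mul_ne_zero two_ne_zero hb0) (inv_ne_zero hq)), pr_lift]
  have hrot : rot ((b : ℂ) • (O - v)) ((b : ℂ) • (O + v)) = rot O v := by
    refine mat_ext fun z => ?_
    simp only [rot_mulVec, hform_smul_left, hform_add_left, hform_sub_left, Complex.conj_ofReal]
    have e1 : ∀ x y : ℂ, ((b : ℂ) * (x + y)) • (b : ℂ) • (O - v) -
        ((b : ℂ) * (x - y)) • (b : ℂ) • (O + v) = ((b : ℂ) * b) • ((2 * y) • O - (2 * x) • v) :=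
      fun x y => by module
    rw [e1, hb]
    module
  rw [← hrot] at hHmem hspan
  generalize (b : ℂ) • (O + v) = ℓ at *
  generalize (b : ℂ) • (O - v) = m at *
  -- `c` and `2 c` are eigenvalues of `ad (rot m ℓ)`, that is, `± 1` or `± 2`, so `c = ± 1`; if `c
  -- = -1`, then `ℓ` and `m` have to be exchanged
  set c : ℝ := α ⟨rot m ℓ, hHmem⟩ with hcdef
  have hc0 : c ≠ 0 := by
    intro h0
    obtain ⟨t, ht⟩ := hspan X₀ hX₀
    have e1 : (⟨X₀, hX₀⟩ : 𝔞) = t • ⟨rot m ℓ, hHmem⟩ := Subtype.ext ht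
    rw [e1, map_smul, ← hcdef, h0, smul_zero] at hαX₀
    exact hαX₀ rfl
  obtain ⟨X, hX, hXne⟩ := Submodule.exists_mem_ne_zero_of_ne_bot h1
  obtain ⟨Y, hY, hYne⟩ := Submodule.exists_mem_ne_zero_of_ne_bot h2
  have e1 := hbase.ad_eigenvalue (hX.2 ⟨rot m ℓ, hHmem⟩) hXne hc0
  have e2 := hbase.ad_eigenvalue (c := 2 * c) (hY.2 ⟨rot m ℓ, hHmem⟩) hYne
    (mul_ne_zero two_ne_zero hc0)
  have hcsq : c ^ 2 = 1 ^ 2 := by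
    rcases e1 with e1 | e1
    · rw [e1]; norm_num
    · rcases e2 with e2 | e2 <;> exfalso <;> nlinarith
  rcases sq_eq_sq_iff_eq_or_eq_neg.1 hcsq with h3 | h3
  · exact ⟨ℓ, m, hHmem, hbase, hspan, h3⟩
  · have hneg : rot ℓ m ∈ 𝔞 := by rw [rot_comm]; exact Submodule.neg_mem _ hHmem
    refine ⟨m, ℓ, hneg, hbase.symm, fun X hX => ?_, ?_⟩
    · obtain ⟨t, ht⟩ := hspan X hX
      exact ⟨-t, by rw [ht, rot_comm ℓ m, smul_neg, neg_smul, neg_neg]⟩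
    · have e3 : (⟨rot ℓ m, hneg⟩ : 𝔞) = -⟨rot m ℓ, hHmem⟩ := Subtype.ext (rot_comm ℓ m)
      rw [e3, map_neg, ← hcdef, h3, neg_neg]

/-! ### The nilpotent part and the normal space -/

/-- A positive definite symmetric form has an orthonormal basis. -/
theorem exists_orthonormal_basis {V : Type*} [AddCommGroup V] [Module ℝ V] [FiniteDimensional ℝ V]
    (B : LinearMap.BilinForm ℝ V) (hB : ∀ x y, B x y = B y x) (hpos : ∀ x, x ≠ 0 → 0 < B x x) :
    ∃ b : Module.Basis (Fin (Module.finrank ℝ V)) ℝ V,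
      ∀ i j, B (b i) (b j) = if i = j then 1 else 0 := by
  obtain ⟨v, hv⟩ := LinearMap.BilinForm.exists_orthogonal_basis (B := B) ⟨hB⟩
  have h0 : ∀ i, 0 < B (v i) (v i) := fun i => hpos _ (v.ne_zero i)
  have hu : ∀ i, IsUnit (√(B (v i) (v i)))⁻¹ := fun i =>
    (inv_ne_zero (Real.sqrt_pos.2 (h0 i)).ne').isUnit
  refine ⟨v.isUnitSMul hu, fun i j => ?_⟩
  rw [Module.Basis.isUnitSMul_apply, Module.Basis.isUnitSMul_apply, map_smul, LinearMap.map_smul,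
    LinearMap.smul_apply, smul_eq_mul, smul_eq_mul]
  split_ifs with hij
  · subst hij
    rw [← mul_assoc, ← mul_inv, Real.mul_self_sqrt (h0 i).le, inv_mul_cancel₀ (h0 i).ne']
  · rw [hv hij, mul_zero, mul_zero]

/-- The data of the restricted root space decomposition: `𝔞` is spanned by `rot m ℓ`, on which the
root `α` takes the value `1`. -/
structure IsRootData (o : EuclideanSpace ℂ (Fin n)) (𝔞 : Submodule ℝ (Mat n))
    (α : Module.Dual ℝ 𝔞) (ℓ m : Fin (n + 1) → ℂ) : Prop extends IsBase o ℓ m where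
  mem : rot m ℓ ∈ 𝔞
  span : ∀ X ∈ 𝔞, ∃ t : ℝ, X = t • rot m ℓ
  root : α ⟨rot m ℓ, mem⟩ = 1

theorem velocity_eq (o : EuclideanSpace ℂ (Fin n)) (X : Mat n) :
    velocity o X = proj o (X.mulVec (lift o)) := rfl

/-- The eigenspace of `rot m ℓ` for the eigenvalue `1` is spanned by `ℓ`. -/
theorem IsBase.eq_smul_of_rot_eq {o : EuclideanSpace ℂ (Fin n)} {ℓ m : Fin (n + 1) → ℂ}
    (h : IsBase o ℓ m) {w : Fin (n + 1) → ℂ} (hw : (rot m ℓ).mulVec w = w) :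
    w = (-hform n m w) • ℓ := by
  rw [rot_mulVec] at hw
  have h1 := congrArg (hform n ℓ) hw
  rw [hform_sub_right, hform_smul_right, hform_smul_right, h.left_null, h.pair] at h1
  have h2 : hform n ℓ w = 0 := by linear_combination (-1 / 2) * h1
  rw [h2, zero_smul, zero_sub, ← neg_smul] at hw
  exact hw.symm

namespace IsRootData

variable {o : EuclideanSpace ℂ (Fin n)} {𝔞 : Submodule ℝ (Mat n)} {α : Module.Dual ℝ 𝔞}
  {ℓ m : Fin (n + 1) → ℂ} {𝔴 : Submodule ℝ (Mat n)} {X Y : Mat n} {u w : Fin (n + 1) → ℂ}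

theorem mem_rootSpace_of_lie (h : IsRootData o 𝔞 α ℓ m) (hX : X ∈ su n) {c : ℝ}
    (hXc : ⁅rot m ℓ, X⁆ = c • X) : X ∈ rootSpace 𝔞 (c • α) := by
  refine ⟨hX, ?_⟩
  rintro ⟨Y, hY⟩
  obtain ⟨t, rfl⟩ := h.span Y hY
  have e1 : (⟨t • rot m ℓ, hY⟩ : 𝔞) = t • ⟨rot m ℓ, h.mem⟩ := rfl
  rw [e1, map_smul, LinearMap.smul_apply, h.root]
  show ⁅t • rot m ℓ, X⁆ = _
  rw [Ring.lie_def, smul_mul_assoc, mul_smul_comm, ← smul_sub, ← Ring.lie_def, hXc, smul_smul]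
  simp

theorem lie_of_mem_rootSpace (h : IsRootData o 𝔞 α ℓ m) {c : ℝ}
    (hX : X ∈ rootSpace 𝔞 (c • α)) : ⁅rot m ℓ, X⁆ = c • X := by
  have := hX.2 ⟨rot m ℓ, h.mem⟩
  rw [LinearMap.smul_apply, h.root, smul_eq_mul, mul_one] at this
  exact this

theorem lie_rot (h : IsRootData o 𝔞 α ℓ m) (hℓ : hform n ℓ u = 0) (hm : hform n m u = 0) :
    ⁅rot m ℓ, rot ℓ u⁆ = rot ℓ u := by
  have hℓ' : hform n u ℓ = 0 := by rw [← hform_conj, hℓ, map_zero]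
  have hm' : hform n u m = 0 := by rw [← hform_conj, hm, map_zero]
  refine ComplexHyperbolic.mat_ext fun z => ?_
  rw [Ring.lie_def, Matrix.sub_mulVec, ← Matrix.mulVec_mulVec, ← Matrix.mulVec_mulVec]
  simp only [rot_mulVec, hform_sub_right, hform_smul_right, hℓ, hm, hℓ', hm', h.left_null, h.pair,
    h.pair']
  module

/-- The root space `𝔤_α`, a copy of the orthogonal complement of `ℓ` and `m`: an element shifts the
eigenvalues `-1`, `0`, `1` of `rot m ℓ` by one. -/
theorem mem_rootSpace (h : IsRootData o 𝔞 α ℓ m) : X ∈ rootSpace 𝔞 α ↔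
    ∃ u, hform n ℓ u = 0 ∧ hform n m u = 0 ∧ X = rot ℓ u := by
  constructor
  · intro hX
    have h1 : ⁅rot m ℓ, X⁆ = (1 : ℝ) • X := h.lie_of_mem_rootSpace (by rwa [one_smul])
    have hs := (mem_su.1 hX.1).1
    have hXℓ : X.mulVec ℓ = 0 := by
      by_contra hne
      rcases h.eigenvalue (IsBase.mulVec_eigen (μ := 1) h1 (by rw [h.rot_left]; simp)) hne
        with h2 | h2 | h2 <;> norm_num at h2
    have hXm : (rot m ℓ).mulVec (X.mulVec m) = 0 := by
      rw [IsBase.mulVec_eigen (μ := -1) h1 (by rw [h.rot_right]; simp)]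
      simp
    have h2 := congrArg (hform n ℓ) hXm
    have h3 := congrArg (hform n m) hXm
    rw [rot_mulVec] at h2 h3
    simp only [hform_sub_right, hform_smul_right, h.left_null, h.right_null, h.pair, h.pair',
      map_zero] at h2 h3
    refine ⟨X.mulVec m, by linear_combination -h2, by linear_combination h3, h.mat_ext ?_ ?_
      fun z hz1 hz2 => ?_⟩
    · rw [hXℓ, rot_mulVec, h.left_null, hs, hXℓ]
      simp
    · rw [rot_mulVec, h.pair, hs]
      have e1 : hform n m (X.mulVec m) = 0 := by linear_combination h3
      rw [e1]
      module
    · have h4 : X.mulVec z = _ := h.eq_smul_of_rot_eq (by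
        rw [IsBase.mulVec_eigen (μ := 0) h1 (by rw [IsBase.rot_perp hz1 hz2]; simp)]
        simp)
      rw [rot_mulVec, hz1, hs, zero_smul, sub_zero]
      exact h4
  · rintro ⟨u, hℓ, hm, rfl⟩
    have := h.mem_rootSpace_of_lie (c := 1) (rot_mem_su (x := ℓ) (y := u) (by rw [hℓ]; rfl))
      (by rw [one_smul, h.lie_rot hℓ hm])
    rwa [one_smul] at this

/-- The root space `𝔤_{2α}`: an element maps `m` to an imaginary multiple of `ℓ`, and vanishes on
the other eigenvectors of `rot m ℓ`. -/
theorem mem_rootSpace_two (h : IsRootData o 𝔞 α ℓ m) : X ∈ rootSpace 𝔞 ((2 : ℝ) • α) ↔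
    ∃ s : ℝ, X = ((s : ℂ) * Complex.I) • outer ℓ ℓ := by
  constructor
  · intro hX
    have h1 := h.lie_of_mem_rootSpace hX
    have hs := (mem_su.1 hX.1).1
    have hXm : X.mulVec m = _ := h.eq_smul_of_rot_eq (by
      rw [IsBase.mulVec_eigen (μ := -1) h1 (by rw [h.rot_right]; simp)]
      norm_num)
    have hre : (hform n m (X.mulVec m)).re = 0 := by
      have h2 := hform_re_comm (X.mulVec m) m
      rw [hs, Complex.neg_re] at h2
      linarith
    have him : hform n m (X.mulVec m) = ((hform n m (X.mulVec m)).im : ℂ) * Complex.I := by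
      apply Complex.ext <;> simp [hre]
    refine ⟨(hform n m (X.mulVec m)).im, ?_⟩
    rw [← him]
    refine h.mat_ext ?_ ?_ fun z hz1 hz2 => ?_
    · rw [Matrix.smul_mulVec, outer_mulVec, h.left_null, zero_smul, smul_zero]
      by_contra hne
      rcases h.eigenvalue (IsBase.mulVec_eigen (μ := 1) h1 (by rw [h.rot_left]; simp)) hne
        with h2 | h2 | h2 <;> norm_num at h2
    · rw [Matrix.smul_mulVec, outer_mulVec, h.pair, smul_smul, mul_neg_one]
      exact hXm
    · rw [Matrix.smul_mulVec, outer_mulVec, hz1, zero_smul, smul_zero]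
      by_contra hne
      rcases h.eigenvalue (IsBase.mulVec_eigen (μ := 0) h1
        (by rw [IsBase.rot_perp hz1 hz2]; simp)) hne with h2 | h2 | h2 <;> norm_num at h2
  · rintro ⟨s, rfl⟩
    refine h.mem_rootSpace_of_lie (mem_su.2 ⟨fun z w => ?_, ?_⟩)
      (ComplexHyperbolic.mat_ext fun z => ?_)
    · simp only [Matrix.smul_mulVec, outer_mulVec, hform_smul_left, hform_smul_right, map_mul,
        Complex.conj_ofReal, Complex.conj_I, hform_conj]
      ring
    · rw [Matrix.trace_smul, trace_outer, h.left_null, smul_zero]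
    · rw [Ring.lie_def, Matrix.sub_mulVec, ← Matrix.mulVec_mulVec, ← Matrix.mulVec_mulVec]
      simp only [Matrix.smul_mulVec, outer_mulVec, Matrix.mulVec_smul, rot_mulVec, hform_sub_right,
        hform_smul_right, h.left_null, h.pair, h.pair']
      rw [← Complex.coe_smul]
      push_cast
      module

theorem rot_base (h : IsRootData o 𝔞 α ℓ m) (hm : hform n m u = 0) : (rot ℓ u).mulVec m = u := by
  have hm' : hform n u m = 0 := by rw [← hform_conj, hm, map_zero]
  rw [rot_mulVec, h.pair, hm']
  module

/-- On the root space, `X ↦ X m` is the inverse of `u ↦ rot ℓ u`. -/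
theorem mulVec_base (h : IsRootData o 𝔞 α ℓ m) (hX : X ∈ rootSpace 𝔞 α) :
    hform n ℓ (X.mulVec m) = 0 ∧ hform n m (X.mulVec m) = 0 ∧ X = rot ℓ (X.mulVec m) := by
  obtain ⟨u, h1, h2, rfl⟩ := h.mem_rootSpace.1 hX
  rw [h.rot_base h2]
  exact ⟨h1, h2, rfl⟩

theorem lift_base (h : IsRootData o 𝔞 α ℓ m) :
    lift o = ((ℓ + m) 0)⁻¹ • (ℓ + m) := by
  rw [← h.base, lift_pr (ne_zero_of_hform_neg h.neg)]

theorem base_mem_CH (h : IsRootData o 𝔞 α ℓ m) : o ∈ CH n := h.base ▸ pr_mem_CH h.neg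

/-- The tangent vector at `o` given by an element of `𝔤_α`. -/
theorem velocity_rootSpace (h : IsRootData o 𝔞 α ℓ m) (hX : X ∈ rootSpace 𝔞 α) :
    velocity o X = proj o (((ℓ + m) 0)⁻¹ • X.mulVec m) := by
  obtain ⟨h1, h2, h3⟩ := h.mulVec_base hX
  have h4 : X.mulVec ℓ = 0 := by
    have : hform n (X.mulVec m) ℓ = 0 := by rw [← hform_conj, h1, map_zero]
    rw [h3, rot_mulVec, this, h.left_null]
    module
  rw [velocity_eq]
  conv_lhs => rw [h.lift_base]
  rw [Matrix.mulVec_smul, Matrix.mulVec_add, h4, zero_add]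

/-- The inner product of `𝔤_α` is twice the real part of the Hermitian product of `{ℓ, m}^⊥`. -/
theorem metric_velocity (h : IsRootData o 𝔞 α ℓ m) (hX : X ∈ rootSpace 𝔞 α)
    (hY : Y ∈ rootSpace 𝔞 α) :
    metric n o (velocity o X) (velocity o Y) =
      2 * (hform n (X.mulVec m) (Y.mulVec m)).re := by
  obtain ⟨h1, h2, -⟩ := h.mulVec_base hX
  have h1' : hform n (X.mulVec m) ℓ = 0 := by rw [← hform_conj, h1, map_zero]
  have h2' : hform n (X.mulVec m) m = 0 := by rw [← hform_conj, h2, map_zero]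
  have hc := ne_zero_of_hform_neg h.neg
  have hs := hform_lift_self o
  have hL : hform n (X.mulVec m) (lift o) = 0 := by
    rw [h.lift_base, hform_smul_right, hform_add_right, h1', h2', add_zero, mul_zero]
  rw [h.velocity_rootSpace hX, h.velocity_rootSpace hY, metric_proj h.base_mem_CH]
  rw [h.lift_base] at hs
  simp only [hform_smul_left, hform_smul_right, hform_add_left, hform_add_right, h.left_null,
    h.right_null, h.pair, h.pair'] at hs
  simp only [hform_smul_left, hform_smul_right, hL, mul_zero, zero_mul, Complex.zero_re, zero_div,
    add_zero]
  generalize (ℓ + m) 0 = c at *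
  have e1 : ∀ z : ℂ, c⁻¹ * (conj c⁻¹ * z) = ((Complex.normSq c)⁻¹ : ℝ) * z := fun z => by
    rw [← mul_assoc, Complex.mul_conj, Complex.normSq_inv]
  have e2 : ∀ z : ℂ, conj c⁻¹ * (c⁻¹ * z) = ((Complex.normSq c)⁻¹ : ℝ) * z := fun z => by
    rw [← e1]; ring
  have hN := (Complex.normSq_pos.2 hc).ne'
  have e3 : 1 - ‖o‖ ^ 2 = 2 * (Complex.normSq c)⁻¹ := by
    have h3 : ((-(1 - ‖o‖ ^ 2) : ℝ) : ℂ) = ((-(2 * (Complex.normSq c)⁻¹) : ℝ) : ℂ) := by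
      rw [← hs]
      simp only [zero_add, add_zero]
      rw [← mul_add, e1]
      push_cast
      ring
    linarith [Complex.ofReal_inj.1 h3]
  rw [e1, Complex.re_ofReal_mul, e3]
  field_simp
  ring

theorem mulVec_base_ne_zero (h : IsRootData o 𝔞 α ℓ m) (hX : X ∈ rootSpace 𝔞 α) (hne : X ≠ 0) :
    X.mulVec m ≠ 0 := by
  intro h0
  obtain ⟨-, -, h3⟩ := h.mulVec_base hX
  rw [h0] at h3
  exact hne (h3.trans (ComplexHyperbolic.mat_ext fun z => by rw [rot_mulVec]; simp))

theorem hform_pos (h : IsRootData o 𝔞 α ℓ m) (hℓ : hform n ℓ u = 0) (hm : hform n m u = 0)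
    (hu : u ≠ 0) : 0 < (hform n u u).re :=
  hform_pos_of_ortho h.neg (by rw [hform_add_left, hℓ, hm, add_zero]) hu

/-- An orthonormal basis of a subspace of the root space. -/
theorem exists_basis (h : IsRootData o 𝔞 α ℓ m) {S : Submodule ℝ (Mat n)}
    (hS : S ≤ rootSpace 𝔞 α) :
    ∃ b : Module.Basis (Fin (Module.finrank ℝ S)) ℝ S, ∀ i j,
      (hform n ((b i : Mat n).mulVec m) ((b j : Mat n).mulVec m)).re = if i = j then 1 else 0 := by
  let B : LinearMap.BilinForm ℝ S := LinearMap.mk₂ ℝ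
    (fun X Y => (hform n ((X : Mat n).mulVec m) ((Y : Mat n).mulVec m)).re)
    (fun X X' Y => by
      rw [Submodule.coe_add, Matrix.add_mulVec, hform_add_left, Complex.add_re])
    (fun c X Y => by
      rw [Submodule.coe_smul, Matrix.smul_mulVec, ← Complex.coe_smul, hform_smul_left,
        Complex.conj_ofReal, Complex.re_ofReal_mul, smul_eq_mul])
    (fun X Y Y' => by
      rw [Submodule.coe_add, Matrix.add_mulVec, hform_add_right, Complex.add_re])
    (fun c X Y => by
      rw [Submodule.coe_smul, Matrix.smul_mulVec, ← Complex.coe_smul, hform_smul_right,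
        Complex.re_ofReal_mul, smul_eq_mul])
  exact exists_orthonormal_basis B (fun X Y => hform_re_comm _ _) fun X hX => by
    obtain ⟨h1, h2, -⟩ := h.mulVec_base (hS X.2)
    exact h.hform_pos h1 h2 (h.mulVec_base_ne_zero (hS X.2) (by simpa using hX))

theorem mem_wPerp (h : IsRootData o 𝔞 α ℓ m) (h𝔴 : 𝔴 ≤ rootSpace 𝔞 α) :
    X ∈ wPerp o 𝔞 α 𝔴 ↔ X ∈ rootSpace 𝔞 α ∧
      ∀ Y ∈ 𝔴, (hform n (X.mulVec m) (Y.mulVec m)).re = 0 := by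
  refine and_congr_right fun hX => forall₂_congr fun Y hY => ?_
  rw [h.metric_velocity hX (h𝔴 hY)]
  simp

/-- `𝔴` is the orthogonal complement of `𝔴^⊥`. -/
theorem mem_of_forall_wPerp (h : IsRootData o 𝔞 α ℓ m) (h𝔴 : 𝔴 ≤ rootSpace 𝔞 α)
    (hX : X ∈ rootSpace 𝔞 α)
    (hXw : ∀ Y ∈ wPerp o 𝔞 α 𝔴, (hform n (Y.mulVec m) (X.mulVec m)).re = 0) : X ∈ 𝔴 := by
  obtain ⟨b, hb⟩ := h.exists_basis h𝔴
  let P : 𝔴 := ∑ i, (hform n ((b i : Mat n).mulVec m) (X.mulVec m)).re • b i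
  have hP : (P : Mat n).mulVec m = ∑ i,
      ((hform n ((b i : Mat n).mulVec m) (X.mulVec m)).re : ℂ) • (b i : Mat n).mulVec m := by
    simp only [P, Submodule.coe_sum, Submodule.coe_smul, Matrix.sum_mulVec, Matrix.smul_mulVec,
      Complex.coe_smul]
  have hD : X - P ∈ rootSpace 𝔞 α := Submodule.sub_mem _ hX (h𝔴 P.2)
  have hDb : ∀ j, (hform n ((X - P).mulVec m) ((b j : Mat n).mulVec m)).re = 0 := by
    intro j
    rw [Matrix.sub_mulVec, hform_sub_left, Complex.sub_re, hP, hform_sum_left, Complex.re_sum]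
    simp only [hform_smul_left, Complex.conj_ofReal, Complex.re_ofReal_mul, hb]
    rw [hform_re_comm (X.mulVec m)]
    simp
  have hD𝔴 : ∀ Y ∈ 𝔴, (hform n ((X - P).mulVec m) (Y.mulVec m)).re = 0 := by
    intro Y hY
    have e1 : Y = ∑ i, (b.repr ⟨Y, hY⟩ i) • (b i : Mat n) := by
      refine (congrArg Subtype.val (b.sum_repr ⟨Y, hY⟩)).symm.trans ?_
      rw [Submodule.coe_sum]
      rfl
    rw [e1, Matrix.sum_mulVec, hform_sum_right, Complex.re_sum]
    refine Finset.sum_eq_zero fun j _ => ?_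
    rw [Matrix.smul_mulVec, ← Complex.coe_smul, hform_smul_right, Complex.re_ofReal_mul, hDb,
      mul_zero]
  have hDw := hXw _ ((h.mem_wPerp h𝔴).2 ⟨hD, hD𝔴⟩)
  by_contra hXn
  have hne : X - P ≠ 0 := by
    intro h0
    exact hXn (by rw [sub_eq_zero.1 h0]; exact P.2)
  obtain ⟨h1, h2, -⟩ := h.mulVec_base hD
  have hpos := h.hform_pos h1 h2 (h.mulVec_base_ne_zero hD hne)
  have e2 : (X - (P : Mat n)).mulVec m = X.mulVec m - (P : Mat n).mulVec m :=
    Matrix.sub_mulVec _ _ _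
  conv at hpos => enter [2, 1, 2]; rw [e2]
  rw [hform_sub_right, Complex.sub_re, hDw, hD𝔴 P P.2, sub_zero] at hpos
  exact lt_irrefl _ hpos

/-- The configuration that describes the submanifold `W_𝔴`. -/
theorem isConfig (h : IsRootData o 𝔞 α ℓ m) {k : ℕ} {b : Fin k → Mat n}
    (hb : ∀ i, b i ∈ rootSpace 𝔞 α) (hbo : ∀ i j,
      (hform n ((b i).mulVec m) ((b j).mulVec m)).re = if i = j then 1 else 0) :
    IsConfig ℓ fun i => (b i).mulVec m where
  ne_zero := by
    rintro rfl
    have := h.pair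
    simp at this
  null := h.left_null
  ortho j := (h.mulVec_base (hb j)).1
  orthonormal := hbo

end IsRootData

/-! ### The orbit as the focal set -/

theorem exp_mulVec_of_eigen {S : Mat n} {w : Fin (n + 1) → ℂ} {c : ℝ} (h : S.mulVec w = c • w) :
    (NormedSpace.exp S).mulVec w = Real.exp c • w := by
  have h1 : ∀ k, (S ^ k).mulVec w = c ^ k • w := by
    intro k
    induction k with
    | zero => simp
    | succ k ih =>
      rw [pow_succ, ← Matrix.mulVec_mulVec, h, Matrix.mulVec_smul, ih, smul_smul, pow_succ']
  have h2 := (NormedSpace.exp_series_hasSum_exp' (𝕂 := ℝ) c).smul_const w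
  rw [← Real.exp_eq_exp_ℝ] at h2
  refine (hasSum_exp_mulVec S w).unique ?_
  simpa only [h1, smul_smul, smul_eq_mul] using h2

/-- The exponential of a transformation that is nilpotent of order three at a vector. -/
theorem exp_mulVec_of_cube {S : Mat n} {w : Fin (n + 1) → ℂ}
    (h : S.mulVec (S.mulVec (S.mulVec w)) = 0) :
    (NormedSpace.exp S).mulVec w = w + S.mulVec w + (1 / 2 : ℝ) • S.mulVec (S.mulVec w) := by
  have h1 : ∀ k, 3 ≤ k → (S ^ k).mulVec w = 0 := by
    intro k hk
    obtain ⟨j, rfl⟩ := Nat.exists_eq_add_of_le' hk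
    rw [pow_add, ← Matrix.mulVec_mulVec, pow_succ, pow_two, ← Matrix.mulVec_mulVec,
      ← Matrix.mulVec_mulVec, h, Matrix.mulVec_zero]
  refine (hasSum_exp_mulVec S w).unique ?_
  have h2 := hasSum_sum_of_ne_finset_zero (L := SummationFilter.unconditional ℕ) (s := Finset.range 3)
    (f := fun k : ℕ => ((k.factorial : ℝ)⁻¹) • (S ^ k).mulVec w) fun k hk => by
      rw [h1 k (by simpa using hk), smul_zero]
  rw [Finset.sum_range_succ, Finset.sum_range_succ, Finset.sum_range_one] at h2
  convert h2 using 2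
  · simp
  · rw [pow_two, ← Matrix.mulVec_mulVec]
    norm_num [Nat.factorial]

namespace IsRootData

variable {o : EuclideanSpace ℂ (Fin n)} {𝔞 : Submodule ℝ (Mat n)} {α : Module.Dual ℝ 𝔞}
  {ℓ m : Fin (n + 1) → ℂ} {𝔴 : Submodule ℝ (Mat n)} {X S : Mat n} {u w : Fin (n + 1) → ℂ}

/-- The elements of `𝔞 ⊕ 𝔴 ⊕ 𝔤_{2α}`. -/
theorem exists_eq_of_mem_sup (h : IsRootData o 𝔞 α ℓ m) (h𝔴 : 𝔴 ≤ rootSpace 𝔞 α)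
    (hS : S ∈ 𝔞 ⊔ 𝔴 ⊔ rootSpace 𝔞 ((2 : ℝ) • α)) :
    ∃ (t : ℝ) (u : Fin (n + 1) → ℂ) (s : ℝ), rot ℓ u ∈ 𝔴 ∧ hform n ℓ u = 0 ∧ hform n m u = 0 ∧
      S = t • rot m ℓ + rot ℓ u + ((s : ℂ) * Complex.I) • outer ℓ ℓ := by
  obtain ⟨T, hT, Y, hY, rfl⟩ := Submodule.mem_sup.1 hS
  obtain ⟨H, hH, X, hX, rfl⟩ := Submodule.mem_sup.1 hT
  obtain ⟨t, rfl⟩ := h.span H hH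
  obtain ⟨u, h1, h2, rfl⟩ := h.mem_rootSpace.1 (h𝔴 hX)
  obtain ⟨s, rfl⟩ := h.mem_rootSpace_two.1 hY
  exact ⟨t, u, s, hX, h1, h2, rfl⟩

attribute [local instance 100] LieRing.ofAssociativeRing in
theorem mem_su_of_mem_sup (h : IsRootData o 𝔞 α ℓ m) (h𝔴 : 𝔴 ≤ rootSpace 𝔞 α)
    (hS : S ∈ 𝔞 ⊔ 𝔴 ⊔ rootSpace 𝔞 ((2 : ℝ) • α)) : S ∈ su n := by
  have h1 : 𝔞 ⊔ 𝔴 ⊔ rootSpace 𝔞 ((2 : ℝ) • α) ≤ (su n).toSubmodule := by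
    refine sup_le (sup_le (fun X hX => ?_) fun X hX => (h𝔴 hX).1) fun X hX => hX.1
    obtain ⟨t, rfl⟩ := h.span X hX
    exact (su n).smul_mem t (rot_mem_su (by rw [h.pair']; simp))
  exact h1 hS

/-- The one-parameter groups of `𝔞 ⊕ 𝔴 ⊕ 𝔤_{2α}` rescale `ℓ` and move the normal vectors by
imaginary multiples of `ℓ`. -/
theorem preservesIsoFun_exp (h : IsRootData o 𝔞 α ℓ m) (h𝔴 : 𝔴 ≤ rootSpace 𝔞 α) {k : ℕ}
    {b : Fin k → Mat n} (hb : ∀ i, b i ∈ wPerp o 𝔞 α 𝔴) (hbo : ∀ i j,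
      (hform n ((b i).mulVec m) ((b j).mulVec m)).re = if i = j then 1 else 0)
    (hS : S ∈ 𝔞 ⊔ 𝔴 ⊔ rootSpace 𝔞 ((2 : ℝ) • α)) :
    PreservesIsoFun ℓ (fun i => (b i).mulVec m) (NormedSpace.exp S) := by
  have hSsu := h.mem_su_of_mem_sup h𝔴 hS
  obtain ⟨t, u, s, hu, h1, h2, rfl⟩ := h.exists_eq_of_mem_sup h𝔴 hS
  set S := t • rot m ℓ + rot ℓ u + ((s : ℂ) * Complex.I) • outer ℓ ℓ with hSdef
  have h1' : hform n u ℓ = 0 := by rw [← hform_conj, h1, map_zero]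
  have hSz : ∀ z, S.mulVec z = t • (rot m ℓ).mulVec z + (rot ℓ u).mulVec z +
      ((s : ℂ) * Complex.I) • hform n ℓ z • ℓ := fun z => by
    rw [hSdef, Matrix.add_mulVec, Matrix.add_mulVec, Matrix.smul_mulVec, Matrix.smul_mulVec,
      outer_mulVec]
  have hSℓ : S.mulVec ℓ = t • ℓ := by
    rw [hSz, h.rot_left, rot_mulVec, h1', h.left_null]
    simp
  refine (h.isConfig (fun i => (hb i).1) hbo).preservesIsoFun_of_adapted (preserves_exp hSsu)
    (Real.exp_pos t).ne' ?_ fun j => ?_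
  · rw [exp_mulVec_of_eigen hSℓ, Complex.coe_smul]
  · obtain ⟨h3, h4, -⟩ := h.mulVec_base (hb j).1
    have h5 : (hform n u ((b j).mulVec m)).re = 0 := by
      have := ((h.mem_wPerp h𝔴).1 (hb j)).2 _ hu
      rwa [h.rot_base h2, hform_re_comm] at this
    have h6 : hform n u ((b j).mulVec m) = ((hform n u ((b j).mulVec m)).im : ℂ) * Complex.I := by
      apply Complex.ext <;> simp [h5]
    have hL : ∀ x : ℝ, ((x : ℂ) * Complex.I) • ℓ ∈ ℝ ∙ (Complex.I • ℓ) := fun x =>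
      Submodule.mem_span_singleton.2 ⟨x, by rw [← Complex.coe_smul, smul_smul]⟩
    have h7 := exp_mulVec_sub_mem (S := S) (w := (b j).mulVec m) (ℝ ∙ (Complex.I • ℓ))
      (by
        rw [hSz, IsBase.rot_perp h3 h4, rot_mulVec, h3, h6]
        simpa using hL _)
      (by
        intro x hx
        obtain ⟨d, rfl⟩ := Submodule.mem_span_singleton.1 hx
        rw [Matrix.mulVec_smul, Matrix.mulVec_smul, hSℓ, smul_comm Complex.I t]
        exact Submodule.smul_mem _ _ (Submodule.smul_mem _ _ (Submodule.mem_span_singleton_self _)))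
    obtain ⟨d, hd⟩ := Submodule.mem_span_singleton.1 h7
    refine ⟨d, ?_⟩
    rw [mul_smul, Complex.coe_smul, hd]
    simp

/-- The function `F` is invariant under the group with Lie algebra `𝔞 ⊕ 𝔴 ⊕ 𝔤_{2α}`. -/
theorem preservesIsoFun_of_mem_connectedSubgroup (h : IsRootData o 𝔞 α ℓ m)
    (h𝔴 : 𝔴 ≤ rootSpace 𝔞 α) {k : ℕ} {b : Fin k → Mat n} (hb : ∀ i, b i ∈ wPerp o 𝔞 α 𝔴)
    (hbo : ∀ i j, (hform n ((b i).mulVec m) ((b j).mulVec m)).re = if i = j then 1 else 0)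
    {A : (Mat n)ˣ} (hA : A ∈ connectedSubgroup (𝔞 ⊔ 𝔴 ⊔ rootSpace 𝔞 ((2 : ℝ) • α))) :
    PreservesIsoFun ℓ (fun i => (b i).mulVec m) (A : Mat n) := by
  induction hA using Subgroup.closure_induction with
  | mem A hA =>
    obtain ⟨X, hX, hAX⟩ := hA
    rw [hAX]
    exact h.preservesIsoFun_exp h𝔴 hb hbo hX
  | one => exact ⟨Preserves.one, fun z _ => by rw [Units.val_one, act_one]⟩
  | mul A B _ _ hA hB => exact hA.mul hB
  | inv A _ hA =>
    have h1 : (A : Mat n) * ((A⁻¹ : (Mat n)ˣ) : Mat n) = 1 := A.mul_inv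
    have h2 : Preserves ((A⁻¹ : (Mat n)ˣ) : Mat n) := fun x y => by
      rw [← hA.1, Matrix.mulVec_mulVec, Matrix.mulVec_mulVec, h1, Matrix.one_mulVec,
        Matrix.one_mulVec]
    exact ⟨h2, fun z hz => by rw [← hA.2 _ (h2.act_mem hz), ← h2.act_mul hz, h1, act_one]⟩

theorem exp_unit_mem_connectedSubgroup {𝔥 : Submodule ℝ (Mat n)} (hX : X ∈ 𝔥) :
    (Matrix.isUnit_exp X).unit ∈ connectedSubgroup 𝔥 :=
  Subgroup.subset_closure ⟨X, hX, IsUnit.unit_spec _⟩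

/-- The subgroup with Lie algebra `𝔞 ⊕ 𝔴 ⊕ 𝔤_{2α}` acts transitively on the focal set. -/
theorem exists_mem_connectedSubgroup (h : IsRootData o 𝔞 α ℓ m) (h𝔴 : 𝔴 ≤ rootSpace 𝔞 α) {k : ℕ}
    {b : Fin k → Mat n} (hb : wPerp o 𝔞 α 𝔴 ≤ Submodule.span ℝ (Set.range b))
    (hb' : ∀ i, b i ∈ wPerp o 𝔞 α 𝔴) {p : EuclideanSpace ℂ (Fin n)}
    (hp : p ∈ focalSet ℓ fun i => (b i).mulVec m) :
    ∃ A ∈ connectedSubgroup (𝔞 ⊔ 𝔴 ⊔ rootSpace 𝔞 ((2 : ℝ) • α)), act (A : Mat n) o = p := by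
  have hneg := hform_lift_neg hp.1
  have hℓ0 : ℓ ≠ 0 := by
    rintro rfl
    simpa using h.pair
  have hL : hform n ℓ (lift p) ≠ 0 := by
    intro h0
    have h1 := hform_pos_of_ortho hneg (x := ℓ) (by rw [← hform_conj, h0, map_zero]) hℓ0
    rw [h.left_null] at h1
    simp at h1
  -- the representative `Z = a ℓ + m + z₀` of the negative line of `p`
  obtain ⟨Z, hZ, hpZ, hZneg⟩ : ∃ Z, hform n ℓ Z = -1 ∧ pr Z = p ∧ (hform n Z Z).re < 0 := by
    have hc : -(hform n ℓ (lift p))⁻¹ ≠ 0 := neg_ne_zero.2 (inv_ne_zero hL)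
    refine ⟨-(hform n ℓ (lift p))⁻¹ • lift p, ?_, by rw [pr_smul hc, pr_lift], ?_⟩
    · rw [hform_smul_right]
      field_simp
    · rw [hform_smul_left, hform_smul_right, ← mul_assoc, mul_comm (conj _), Complex.mul_conj,
        Complex.re_ofReal_mul]
      exact mul_neg_of_pos_of_neg (Complex.normSq_pos.2 hc) hneg
  obtain ⟨z₀, h1, h2, hZz⟩ := h.exists_decomposition Z
  rw [hZ, neg_neg, one_smul] at hZz
  set a := -hform n m Z with ha
  have h1' : hform n z₀ ℓ = 0 := by rw [← hform_conj, h1, map_zero]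
  have h2' : hform n z₀ m = 0 := by rw [← hform_conj, h2, map_zero]
  have hq : 0 < a.re - (hform n z₀ z₀).re / 2 := by
    rw [hZz] at hZneg
    simp only [hform_add_left, hform_add_right, hform_smul_left, hform_smul_right, h.left_null,
      h.right_null, h.pair, h.pair', h1, h2, h1', h2', mul_zero, zero_add, add_zero,
      Complex.add_re, Complex.mul_re, Complex.conj_re, Complex.conj_im, Complex.neg_re,
      Complex.neg_im, Complex.one_re, Complex.one_im] at hZneg
    linarith
  -- the component `z₀` is tangent to the orbit
  have hXmem : rot ℓ z₀ ∈ 𝔴 := by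
    refine h.mem_of_forall_wPerp h𝔴 (h.mem_rootSpace.2 ⟨z₀, h1, h2, rfl⟩) fun Y hY => ?_
    rw [h.rot_base h2]
    refine Submodule.span_induction (p := fun Y _ => (hform n (Y.mulVec m) z₀).re = 0) ?_ ?_ ?_ ?_
      (hb hY)
    · rintro _ ⟨j, rfl⟩
      obtain ⟨h3, h4, -⟩ := h.mulVec_base (hb' j).1
      have h3' : hform n ((b j).mulVec m) ℓ = 0 := by rw [← hform_conj, h3, map_zero]
      have h4' : hform n ((b j).mulVec m) m = 0 := by rw [← hform_conj, h4, map_zero]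
      have h5 := hp.2 j
      rw [← hpZ, moment_pr hZneg, hZ, div_eq_zero_iff, or_iff_left (by linarith)] at h5
      rw [hZz] at h5
      simp only [hform_add_right, hform_smul_right, h3', h4', mul_zero, zero_add] at h5
      simpa using h5
    · simp
    · intro Y Y' _ _ hY hY'
      rw [Matrix.add_mulVec, hform_add_left, Complex.add_re, hY, hY', add_zero]
    · intro c Y _ hY
      rw [Matrix.smul_mulVec, ← Complex.coe_smul, hform_smul_left, Complex.conj_ofReal,
        Complex.re_ofReal_mul, hY, mul_zero]
  -- up to the factor `exp (-t)`, the groups of `𝔞` and `rot ℓ z₀` move `ℓ + m` to `(exp (2 t) +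
  -- [z₀, z₀] / 2) ℓ + m + z₀`, and that of `𝔤_{2α}` adjusts the imaginary part of the coefficient
  -- of `ℓ`
  obtain ⟨t, ht⟩ : ∃ t : ℝ, Real.exp t = Real.exp (-t) * (a.re - (hform n z₀ z₀).re / 2) := by
    refine ⟨Real.log (a.re - (hform n z₀ z₀).re / 2) / 2, ?_⟩
    conv_rhs => rw [← Real.exp_log hq, ← Real.exp_add]
    congr 1
    simp only [Real.log_exp]
    ring
  have hz₀ : hform n z₀ z₀ = ((hform n z₀ z₀).re : ℂ) := by
    apply Complex.ext <;> simp [hform_self_im]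
  have hA1 : t • rot m ℓ ∈ 𝔞 ⊔ 𝔴 ⊔ rootSpace 𝔞 ((2 : ℝ) • α) :=
    Submodule.mem_sup_left (Submodule.mem_sup_left (Submodule.smul_mem _ _ h.mem))
  have hA2 : rot ℓ z₀ ∈ 𝔞 ⊔ 𝔴 ⊔ rootSpace 𝔞 ((2 : ℝ) • α) :=
    Submodule.mem_sup_left (Submodule.mem_sup_right hXmem)
  have hA3 : (((-a.im : ℝ) : ℂ) * Complex.I) • outer ℓ ℓ ∈
      𝔞 ⊔ 𝔴 ⊔ rootSpace 𝔞 ((2 : ℝ) • α) :=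
    Submodule.mem_sup_right (h.mem_rootSpace_two.2 ⟨-a.im, rfl⟩)
  refine ⟨_, mul_mem (exp_unit_mem_connectedSubgroup hA3)
    (mul_mem (exp_unit_mem_connectedSubgroup hA2) (exp_unit_mem_connectedSubgroup hA1)), ?_⟩
  have e1 : (NormedSpace.exp (t • rot m ℓ)).mulVec (ℓ + m) =
      Real.exp t • ℓ + Real.exp (-t) • m := by
    rw [Matrix.mulVec_add, exp_mulVec_of_eigen (c := t) (by
        rw [Matrix.smul_mulVec, h.rot_left]), exp_mulVec_of_eigen (c := -t) (by
        rw [Matrix.smul_mulVec, h.rot_right, smul_neg, neg_smul])]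
  have x1 : (rot ℓ z₀).mulVec ℓ = 0 := by rw [rot_mulVec, h1', h.left_null]; simp
  have x2 : (rot ℓ z₀).mulVec z₀ = hform n z₀ z₀ • ℓ := by rw [rot_mulVec, h1]; simp
  have e2 : (NormedSpace.exp (rot ℓ z₀)).mulVec ℓ = ℓ := by
    rw [exp_mulVec_of_cube] <;> simp [x1]
  have e3 : (NormedSpace.exp (rot ℓ z₀)).mulVec m =
      m + z₀ + (1 / 2 : ℝ) • hform n z₀ z₀ • ℓ := by
    rw [exp_mulVec_of_cube] <;> rw [h.rot_base h2, x2]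
    rw [Matrix.mulVec_smul, x1, smul_zero]
  have y1 : ∀ z, ((((-a.im : ℝ) : ℂ) * Complex.I) • outer ℓ ℓ).mulVec z =
      (((-a.im : ℝ) : ℂ) * Complex.I) • hform n ℓ z • ℓ := fun z => by
    rw [Matrix.smul_mulVec, outer_mulVec]
  have e4 : ∀ z, (NormedSpace.exp ((((-a.im : ℝ) : ℂ) * Complex.I) • outer ℓ ℓ)).mulVec z =
      z + (((-a.im : ℝ) : ℂ) * Complex.I) • hform n ℓ z • ℓ := fun z => by
    have y2 : ∀ c : ℂ, ((((-a.im : ℝ) : ℂ) * Complex.I) • outer ℓ ℓ).mulVec (c • ℓ) = 0 :=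
      fun c => by rw [y1, hform_smul_right, h.left_null, mul_zero, zero_smul, smul_zero]
    have y3 : ((((-a.im : ℝ) : ℂ) * Complex.I) • outer ℓ ℓ).mulVec
        (((((-a.im : ℝ) : ℂ) * Complex.I) • outer ℓ ℓ).mulVec z) = 0 := by
      rw [y1 z, smul_smul, y2]
    rw [exp_mulVec_of_cube (by rw [y3, Matrix.mulVec_zero]), y3, y1, smul_zero, add_zero]
  rw [← h.base, Preserves.act_pr h.neg, ← hpZ, Units.val_mul, Units.val_mul, IsUnit.unit_spec,
    IsUnit.unit_spec, IsUnit.unit_spec, ← Matrix.mulVec_mulVec, ← Matrix.mulVec_mulVec, e1,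
    Matrix.mulVec_add, Matrix.mulVec_smul, Matrix.mulVec_smul, e2, e3, e4]
  have hexp : ((Real.exp (-t) : ℝ) : ℂ) ≠ 0 := by exact_mod_cast (Real.exp_pos _).ne'
  rw [← pr_smul hexp Z]
  congr 1
  have ht' : (Real.exp t : ℂ) = ((Real.exp (-t) : ℝ) : ℂ) * (a.re - (hform n z₀ z₀).re / 2) := by
    exact_mod_cast ht
  have ha' : a = a.re + a.im * Complex.I := (Complex.re_add_im a).symm
  conv_rhs => rw [hZz, ha']
  simp only [← Complex.coe_smul (Real.exp _), ← Complex.coe_smul (1 / 2 : ℝ), hform_add_right,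
    hform_smul_right, h.left_null, h.pair, h1, ht']
  rw [hz₀]
  push_cast
  generalize ((Real.exp (-t) : ℝ) : ℂ) = E
  module

/-- The orbit `W_𝔴` is the focal set. -/
theorem orbitW_eq (h : IsRootData o 𝔞 α ℓ m) (h𝔴 : 𝔴 ≤ rootSpace 𝔞 α) {k : ℕ}
    {b : Fin k → Mat n} (hb : wPerp o 𝔞 α 𝔴 ≤ Submodule.span ℝ (Set.range b))
    (hb' : ∀ i, b i ∈ wPerp o 𝔞 α 𝔴) (hbo : ∀ i j,
      (hform n ((b i).mulVec m) ((b j).mulVec m)).re = if i = j then 1 else 0) :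
    orbitW o 𝔞 α 𝔴 = focalSet ℓ fun i => (b i).mulVec m := by
  have hc := h.isConfig (fun i => (hb' i).1) hbo
  refine Set.Subset.antisymm ?_ fun p hp => h.exists_mem_connectedSubgroup h𝔴 hb hb' hp
  rintro _ ⟨A, hA, rfl⟩
  exact hc.act_mem_focalSet (h.preservesIsoFun_of_mem_connectedSubgroup h𝔴 hb' hbo hA)
    (hc.base_mem (fun j => (h.mulVec_base (hb' j).1).2.1) h.neg h.base)

/-- The subspace `𝔴^⊥` corresponds to the normal space of the focal set at `o`. -/
theorem velocity_wPerp (h : IsRootData o 𝔞 α ℓ m) {k : ℕ}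
    {b : Fin k → Mat n} (hb : wPerp o 𝔞 α 𝔴 ≤ Submodule.span ℝ (Set.range b))
    (hb' : ∀ i, b i ∈ wPerp o 𝔞 α 𝔴) :
    (wPerp o 𝔞 α 𝔴).map (velocity o) = normalSpace ℓ (fun i => (b i).mulVec m) o := by
  have hg : ∀ j, gradient (metric n) (moment ((b j).mulVec m) ℓ) o =
      (-1 / 4 : ℝ) • velocity o (b j) := by
    intro j
    obtain ⟨h1, h2, -⟩ := h.mulVec_base (hb' j).1
    have h1' : hform n ((b j).mulVec m) ℓ = 0 := by rw [← hform_conj, h1, map_zero]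
    have h2' : hform n ((b j).mulVec m) m = 0 := by rw [← hform_conj, h2, map_zero]
    have e1 : hform n ((b j).mulVec m) (lift o) = 0 := by
      rw [h.lift_base, hform_smul_right, hform_add_right, h1', h2', add_zero, mul_zero]
    have e2 : hform n ℓ (lift o) = -((ℓ + m) 0)⁻¹ := by
      rw [h.lift_base, hform_smul_right, hform_add_right, h.left_null, h.pair, zero_add, mul_neg,
        mul_one]
    rw [gradient_moment _ _ h.base_mem_CH, momentVec, e1, e2, h.velocity_rootSpace (hb' j).1,
      ← Complex.coe_smul, ← LinearMap.map_smul (proj o)]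
    congr 1
    push_cast
    module
  refine le_antisymm ?_ ?_
  · refine (Submodule.map_mono hb).trans ?_
    rw [Submodule.map_span, Submodule.span_le]
    rintro _ ⟨_, ⟨j, rfl⟩, rfl⟩
    have e3 : velocity o (b j) =
        (-4 : ℝ) • gradient (metric n) (moment ((b j).mulVec m) ℓ) o := by
      rw [hg, smul_smul]; norm_num
    rw [e3]
    exact Submodule.smul_mem _ _ (Submodule.subset_span ⟨j, rfl⟩)
  · refine Submodule.span_le.2 ?_
    rintro _ ⟨j, rfl⟩
    simp only [hg]
    exact Submodule.smul_mem _ _ (Submodule.mem_map_of_mem (hb' j))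

theorem finrank_wPerp_pos (h : IsRootData o 𝔞 α ℓ m) (h𝔴 : 𝔴 < rootSpace 𝔞 α) :
    0 < Module.finrank ℝ (wPerp o 𝔞 α 𝔴) := by
  rw [Module.finrank_pos_iff_exists_ne_zero]
  by_contra hcon
  push Not at hcon
  refine h𝔴.not_ge fun X hX => h.mem_of_forall_wPerp h𝔴.le hX fun Y hY => ?_
  have : Y = 0 := congrArg Subtype.val (hcon ⟨Y, hY⟩)
  rw [this]
  simp

end IsRootData

/-! ### Tubes around the orbits -/

theorem exists_ortho_ne_zero {j : ℕ} (hj : j < n + 1) (x : Fin j → Fin (n + 1) → ℂ) :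
    ∃ z : Fin (n + 1) → ℂ, z ≠ 0 ∧ ∀ i, hform n (x i) z = 0 := by
  have h1 := LinearMap.ker_ne_bot_of_finrank_lt (f := LinearMap.pi fun i => hform n (x i))
    (by simpa using hj)
  obtain ⟨z, hz, hne⟩ := Submodule.exists_mem_ne_zero_of_ne_bot h1
  exact ⟨z, hne, fun i => congrFun (LinearMap.mem_ker.1 hz) i⟩

namespace IsRootData

variable {o : EuclideanSpace ℂ (Fin n)} {𝔞 : Submodule ℝ (Mat n)} {α : Module.Dual ℝ 𝔞}
  {ℓ m : Fin (n + 1) → ℂ} {𝔴 : Submodule ℝ (Mat n)} {r : ℝ} {u e : Fin (n + 1) → ℂ}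

/-- The submanifold `W_𝔴` is the focal set of a configuration, whose vectors correspond to an
orthonormal basis of `𝔴^⊥`. -/
theorem exists_isConfig (h : IsRootData o 𝔞 α ℓ m) (h𝔴 : 𝔴 ≤ rootSpace 𝔞 α) :
    ∃ ξ : Fin (Module.finrank ℝ (wPerp o 𝔞 α 𝔴)) → Fin (n + 1) → ℂ, IsConfig ℓ ξ ∧
      (∀ j, hform n m (ξ j) = 0) ∧ orbitW o 𝔞 α 𝔴 = focalSet ℓ ξ ∧
      (∀ p ∈ focalSet ℓ ξ, ∃ A, PreservesIsoFun ℓ ξ A ∧ act A o = p) ∧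
      (wPerp o 𝔞 α 𝔴).map (velocity o) = normalSpace ℓ ξ o := by
  obtain ⟨b, hbo⟩ := h.exists_basis (S := wPerp o 𝔞 α 𝔴) fun X hX => hX.1
  have hb' : ∀ i, (b i : Mat n) ∈ wPerp o 𝔞 α 𝔴 := fun i => (b i).2
  have hb : wPerp o 𝔞 α 𝔴 ≤ Submodule.span ℝ (Set.range fun i => (b i : Mat n)) := by
    have h1 := congrArg (Submodule.map (wPerp o 𝔞 α 𝔴).subtype) b.span_eq
    rw [Submodule.map_span, ← Set.range_comp, Submodule.map_subtype_top] at h1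
    exact h1.ge
  refine ⟨fun i => (b i : Mat n).mulVec m, h.isConfig (fun i => (hb' i).1) hbo,
    fun j => (h.mulVec_base (hb' j).1).2.1, h.orbitW_eq h𝔴 hb hb' hbo, fun p hp => ?_,
    h.velocity_wPerp hb hb'⟩
  obtain ⟨A, hA, hAo⟩ := h.exists_mem_connectedSubgroup h𝔴 hb hb' hp
  exact ⟨A, h.preservesIsoFun_of_mem_connectedSubgroup h𝔴 hb' hbo hA, hAo⟩

theorem isIsoparametricHypersurface_tube (h : IsRootData o 𝔞 α ℓ m) (h𝔴 : 𝔴 < rootSpace 𝔞 α)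
    (hr : 0 < r) : IsIsoparametricHypersurface (metric n) (CH n)
      (tube (metric n) (CH n) (orbitW o 𝔞 α 𝔴) r) := by
  obtain ⟨ξ, hc, hm, hW, -, -⟩ := h.exists_isConfig h𝔴.le
  rw [hW]
  exact hc.isIsoparametricHypersurface_tube (h.finrank_wPerp_pos h𝔴)
    (hc.base_mem hm h.neg h.base) hr

theorem hasMeanCurvatureAt_tube (h : IsRootData o 𝔞 α ℓ m) (h𝔴 : 𝔴 ≤ rootSpace 𝔞 α)
    (hr : 0 < r) {γ : ℝ → EuclideanSpace ℂ (Fin n)} (hγ : IsGeodesic (metric n) (CH n) γ)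
    (h0 : γ 0 ∈ orbitW o 𝔞 α 𝔴)
    (h1 : IsUnitNormal (metric n) (orbitW o 𝔞 α 𝔴) (γ 0) (deriv γ 0)) :
    HasMeanCurvatureAt (metric n) (tube (metric n) (CH n) (orbitW o 𝔞 α 𝔴) r) (γ r) (-deriv γ r)
      (((Module.finrank ℝ (wPerp o 𝔞 α 𝔴) : ℝ) - 1 + 2 * n * Real.sinh (r / 2) ^ 2) /
        (2 * Real.sinh (r / 2) * Real.cosh (r / 2))) := by
  obtain ⟨ξ, hc, hm, hW, -, -⟩ := h.exists_isConfig h𝔴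
  rw [hW] at h0 h1 ⊢
  exact hc.hasMeanCurvatureAt_tube hr hγ h0 h1

theorem hasConstantKahlerAngle_of_isHomogeneous (h : IsRootData o 𝔞 α ℓ m)
    (h𝔴 : 𝔴 ≤ rootSpace 𝔞 α) (hr : 0 < r)
    (hM : IsHomogeneous (isometries (metric n) (CH n))
      (tube (metric n) (CH n) (orbitW o 𝔞 α 𝔴) r)) :
    HasConstantKahlerAngle o ((wPerp o 𝔞 α 𝔴).map (velocity o)) := by
  obtain ⟨ξ, hc, hm, hW, -, hV⟩ := h.exists_isConfig h𝔴
  rw [hW] at hM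
  rw [hV]
  exact hc.hasConstantKahlerAngle_of_isHomogeneous hr (hc.base_mem hm h.neg h.base) hM

theorem isHomogeneous_of_hasConstantKahlerAngle (h : IsRootData o 𝔞 α ℓ m)
    (h𝔴 : 𝔴 ≤ rootSpace 𝔞 α) (hr : 0 < r)
    (hK : HasConstantKahlerAngle o ((wPerp o 𝔞 α 𝔴).map (velocity o))) :
    IsHomogeneous {f | ∃ A ∈ SU n, f = act (A : Mat n)}
      (tube (metric n) (CH n) (orbitW o 𝔞 α 𝔴) r) := by
  obtain ⟨ξ, hc, hm, hW, htrans, hV⟩ := h.exists_isConfig h𝔴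
  rw [hV] at hK
  rw [hW]
  exact hc.isHomogeneous_of_hasConstantKahlerAngle hm h.neg h.base hr htrans hK

theorem I_smul_velocity (h : IsRootData o 𝔞 α ℓ m) (hℓ : hform n ℓ u = 0) (hm : hform n m u = 0) :
    Complex.I • velocity o (rot ℓ u) = velocity o (rot ℓ (Complex.I • u)) := by
  have hℓ' : hform n ℓ (Complex.I • u) = 0 := by rw [hform_smul_right, hℓ, mul_zero]
  have hm' : hform n m (Complex.I • u) = 0 := by rw [hform_smul_right, hm, mul_zero]
  rw [h.velocity_rootSpace (h.mem_rootSpace.2 ⟨u, hℓ, hm, rfl⟩),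
    h.velocity_rootSpace (h.mem_rootSpace.2 ⟨_, hℓ', hm', rfl⟩), h.rot_base hm, h.rot_base hm',
    ← LinearMap.map_smul (proj o), smul_comm]

theorem velocity_ne_zero (h : IsRootData o 𝔞 α ℓ m) (hℓ : hform n ℓ u = 0) (hm : hform n m u = 0)
    (hu : u ≠ 0) : velocity o (rot ℓ u) ≠ 0 := by
  have hX := h.mem_rootSpace.2 ⟨u, hℓ, hm, rfl⟩
  intro h0
  have h1 := h.metric_velocity hX hX
  rw [h0, h.rot_base hm] at h1
  have h2 := h.hform_pos hℓ hm hu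
  rw [map_zero] at h1
  simp at h1
  linarith

theorem rot_mem_wPerp_span (h : IsRootData o 𝔞 α ℓ m) (hℓe : hform n ℓ e = 0)
    (hme : hform n m e = 0) (hℓ : hform n ℓ u = 0) (hm : hform n m u = 0)
    (hue : (hform n u e).re = 0) : rot ℓ u ∈ wPerp o 𝔞 α (ℝ ∙ rot ℓ e) := by
  refine (h.mem_wPerp ?_).2 ⟨h.mem_rootSpace.2 ⟨u, hℓ, hm, rfl⟩, fun Y hY => ?_⟩
  · rw [Submodule.span_singleton_le_iff_mem]
    exact h.mem_rootSpace.2 ⟨e, hℓe, hme, rfl⟩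
  · obtain ⟨c, rfl⟩ := Submodule.mem_span_singleton.1 hY
    rw [h.rot_base hm, Matrix.smul_mulVec, h.rot_base hme, ← Complex.coe_smul, hform_smul_right,
      Complex.re_ofReal_mul, hue, mul_zero]

/-- The orthogonal complement of a real line in `𝔤_α` contains vectors of Kähler angle `π / 2` (in
the complex line of the real line) and, if `n ≥ 3`, of Kähler angle `0`. -/
theorem not_hasConstantKahlerAngle (h : IsRootData o 𝔞 α ℓ m) (hℓe : hform n ℓ e = 0)
    (hme : hform n m e = 0) (he : e ≠ 0) (hℓ : hform n ℓ u = 0) (hm : hform n m u = 0)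
    (heu : hform n e u = 0) (hu : u ≠ 0) :
    ¬ HasConstantKahlerAngle o ((wPerp o 𝔞 α (ℝ ∙ rot ℓ e)).map (velocity o)) := by
  rintro ⟨φ, hφ⟩
  have hpos : ∀ v, v ≠ 0 → 0 < metric n o v v := isRiemannian_metric.pos o h.base_mem_CH
  have hI : ∀ {x : Fin (n + 1) → ℂ}, x ≠ 0 → Complex.I • x ≠ 0 := fun hx =>
    smul_ne_zero Complex.I_ne_zero hx
  have hIm : ∀ x y : Fin (n + 1) → ℂ, hform n x y = 0 → hform n x (Complex.I • y) = 0 :=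
    fun x y hxy => by rw [hform_smul_right, hxy, mul_zero]
  have hue : hform n u e = 0 := by rw [← hform_conj, heu, map_zero]
  set V := (wPerp o 𝔞 α (ℝ ∙ rot ℓ e)).map (velocity o) with hV
  have hX1 : velocity o (rot ℓ (Complex.I • e)) ∈ V := Submodule.mem_map_of_mem
    (h.rot_mem_wPerp_span hℓe hme (hIm _ _ hℓe) (hIm _ _ hme) (by
      rw [hform_smul_left]; simp [hform_self_im]))
  have hX2 : velocity o (rot ℓ u) ∈ V := Submodule.mem_map_of_mem
    (h.rot_mem_wPerp_span hℓe hme hℓ hm (by rw [hue, Complex.zero_re]))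
  have hX3 : velocity o (rot ℓ (Complex.I • u)) ∈ V := Submodule.mem_map_of_mem
    (h.rot_mem_wPerp_span hℓe hme (hIm _ _ hℓ) (hIm _ _ hm) (by
      rw [hform_smul_left, hue, mul_zero, Complex.zero_re]))
  -- `J` maps the vector of `i e` to the line `𝔴`, which is orthogonal to the normal space
  have hcos : Real.cos φ ^ 2 = 0 := by
    have hne := h.velocity_ne_zero (hIm _ _ hℓe) (hIm _ _ hme) (hI he)
    obtain ⟨-, F, hF, hFη, hFF⟩ := hφ _ hX1 hne
    have h1 : Complex.I • velocity o (rot ℓ (Complex.I • e)) = -velocity o (rot ℓ e) := by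
      rw [← h.I_smul_velocity hℓe hme, smul_smul, Complex.I_mul_I, neg_one_smul]
    have h2 : metric n o (velocity o (rot ℓ e)) F = 0 := by
      obtain ⟨Y, hY, rfl⟩ := hF
      rw [isRiemannian_metric.symm o h.base_mem_CH]
      exact hY.2 _ (Submodule.mem_span_singleton_self _)
    have h3 := hFη F hF
    rw [h1, (metric n o).map_sub, (metric n o).map_neg, sub_apply, neg_apply, h2, neg_zero,
      zero_sub, neg_eq_zero, hFF] at h3
    exact (mul_eq_zero.1 h3).resolve_right (hpos _ hne).ne'
  have hne := h.velocity_ne_zero hℓ hm hu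
  obtain ⟨-, F, hF, hFη, hFF⟩ := hφ _ hX2 hne
  rw [hcos, zero_mul] at hFF
  -- but `J` maps the vector of `u` into the normal space
  have hF0 : F = 0 := by
    by_contra hF0
    exact (hpos F hF0).ne' hFF
  have h4 := hFη _ hX3
  rw [hF0, sub_zero, h.I_smul_velocity hℓ hm] at h4
  exact (hpos _ (h.velocity_ne_zero (hIm _ _ hℓ) (hIm _ _ hm) (hI hu))).ne' h4

/-- A real line `𝔴` in `𝔤_α`; the vector `u` orthogonal to its complex span needs `n ≥ 3`. -/
theorem exists_not_hasConstantKahlerAngle (h : IsRootData o 𝔞 α ℓ m) (hn : 3 ≤ n) :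
    ∃ 𝔴 : Submodule ℝ (Mat n), 𝔴 < rootSpace 𝔞 α ∧
      ¬ HasConstantKahlerAngle o ((wPerp o 𝔞 α 𝔴).map (velocity o)) := by
  obtain ⟨e, he, hxe⟩ := exists_ortho_ne_zero (by omega : 2 < n + 1) ![ℓ, m]
  obtain ⟨u, hu, hxu⟩ := exists_ortho_ne_zero (by omega : 3 < n + 1) ![ℓ, m, e]
  have hℓe := hxe 0
  have hme := hxe 1
  have hℓ := hxu 0
  have hm := hxu 1
  have heu := hxu 2
  refine ⟨ℝ ∙ rot ℓ e, lt_of_le_of_ne ?_ fun heq => ?_,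
    h.not_hasConstantKahlerAngle hℓe hme he hℓ hm heu hu⟩
  · rw [Submodule.span_singleton_le_iff_mem]
    exact h.mem_rootSpace.2 ⟨e, hℓe, hme, rfl⟩
  · have h1 : rot ℓ u ∈ ℝ ∙ rot ℓ e := heq ▸ h.mem_rootSpace.2 ⟨u, hℓ, hm, rfl⟩
    obtain ⟨c, hc⟩ := Submodule.mem_span_singleton.1 h1
    have h2 := congrArg (fun X : Mat n => hform n u (X.mulVec m)) hc
    have hue : hform n u e = 0 := by rw [← hform_conj]; exact (congrArg conj heu).trans (map_zero _)
    simp only [Matrix.smul_mulVec, h.rot_base hme, h.rot_base hm, ← Complex.coe_smul,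
      hform_smul_right, hue, mul_zero] at h2
    have h3 := h.hform_pos hℓ hm hu
    rw [← h2] at h3
    simp at h3

end IsRootData

end ComplexHyperbolic

theorem theorem1 (n : ℕ) (hn : 2 ≤ n) (o : EuclideanSpace ℂ (Fin n)) (ho : o ∈ CH n)
    (𝔞 : Submodule ℝ (Mat n)) (h𝔞 : IsMaximalAbelian (cartanComplement o) 𝔞)
    (α : Module.Dual ℝ 𝔞) (hα : α ≠ 0) (h1 : rootSpace 𝔞 α ≠ ⊥)
    (h2 : rootSpace 𝔞 ((2 : ℝ) • α) ≠ ⊥) :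
    (∀ 𝔴 : Submodule ℝ (Mat n), 𝔴 < rootSpace 𝔞 α → ∀ r : ℝ, 0 < r →
      IsIsoparametricHypersurface (metric n) (CH n)
        (tube (metric n) (CH n) (orbitW o 𝔞 α 𝔴) r) ∧
      (∀ γ : ℝ → EuclideanSpace ℂ (Fin n), IsGeodesic (metric n) (CH n) γ →
        γ 0 ∈ orbitW o 𝔞 α 𝔴 →
        IsUnitNormal (metric n) (orbitW o 𝔞 α 𝔴) (γ 0) (deriv γ 0) →
        HasMeanCurvatureAt (metric n) (tube (metric n) (CH n) (orbitW o 𝔞 α 𝔴) r)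
          (γ r) (-deriv γ r)
          (((Module.finrank ℝ (wPerp o 𝔞 α 𝔴) : ℝ) - 1 + 2 * n * Real.sinh (r / 2) ^ 2) /
            (2 * Real.sinh (r / 2) * Real.cosh (r / 2)))) ∧
      (IsHomogeneous (isometries (metric n) (CH n))
          (tube (metric n) (CH n) (orbitW o 𝔞 α 𝔴) r) ↔
        HasConstantKahlerAngle o ((wPerp o 𝔞 α 𝔴).map (velocity o))) ∧
      (IsHomogeneous {f | ∃ A ∈ SU n, f = act (A : Mat n)}
          (tube (metric n) (CH n) (orbitW o 𝔞 α 𝔴) r) ↔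
        HasConstantKahlerAngle o ((wPerp o 𝔞 α 𝔴).map (velocity o)))) ∧
    (3 ≤ n → ∃ 𝔴 : Submodule ℝ (Mat n), 𝔴 < rootSpace 𝔞 α ∧ ∀ r : ℝ, 0 < r →
      IsIsoparametricHypersurface (metric n) (CH n)
        (tube (metric n) (CH n) (orbitW o 𝔞 α 𝔴) r) ∧
      ¬ IsHomogeneous (isometries (metric n) (CH n))
          (tube (metric n) (CH n) (orbitW o 𝔞 α 𝔴) r)) := by
  obtain ⟨ℓ, m, hH, hbase, hspan, hroot⟩ :=
    exists_isBase ho h𝔞.prop.1 h𝔞.prop.2 hα h1 h2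
  have h : IsRootData o 𝔞 α ℓ m := ⟨hbase, hH, hspan, hroot⟩
  refine ⟨fun 𝔴 h𝔴 r hr => ⟨h.isIsoparametricHypersurface_tube h𝔴 hr,
    fun γ hγ h0 hu => h.hasMeanCurvatureAt_tube h𝔴.le hr hγ h0 hu, ?_, ?_⟩, fun hn3 => ?_⟩
  · refine ⟨h.hasConstantKahlerAngle_of_isHomogeneous h𝔴.le hr, fun hK p hp q hq => ?_⟩
    obtain ⟨_, ⟨A, hA, rfl⟩, hf⟩ := h.isHomogeneous_of_hasConstantKahlerAngle h𝔴.le hr hK p hp q hq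
    exact ⟨_, (Preserves.of_mem_SU hA).act_mem_isometries, hf⟩
  · refine ⟨fun hM => h.hasConstantKahlerAngle_of_isHomogeneous h𝔴.le hr fun p hp q hq => ?_,
      h.isHomogeneous_of_hasConstantKahlerAngle h𝔴.le hr⟩
    obtain ⟨_, ⟨A, hA, rfl⟩, hf⟩ := hM p hp q hq
    exact ⟨_, (Preserves.of_mem_SU hA).act_mem_isometries, hf⟩
  · obtain ⟨𝔴, h𝔴, hK⟩ := h.exists_not_hasConstantKahlerAngle hn3
    exact ⟨𝔴, h𝔴, fun r hr => ⟨h.isIsoparametricHypersurface_tube h𝔴 hr, fun hM =>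
      hK (h.hasConstantKahlerAngle_of_isHomogeneous h𝔴.le hr hM)⟩⟩
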